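/- Throughout, ideals of C*-algebras are closed and two-sided, the zero algebra is regarded as unital, base spaces may be empty, $M_n$ denotes the C*-algebra of complex $n\times n$ matrices, $\dim$ is the covering dimension (defined by finite open covers), and the spectrum of a C*-algebra is the set of unitary equivalence classes of its irreducible representations with the hull-kernel topology. For a C*-algebra $A$, $\widetilde A=\mathbb C\oplus A$ denotes the C*-algebra obtained by adjoining a unit (also if $A$ is already unital); for a *-homomorphism $\rho\colon P\to C$ with $C$ unital, $\rho^\dagger\colon\widetilde P\to C$ is its unital extension. **Definitions.** A decomposition (RSH$_0$-decomposition) of length $k$ of a C*-algebra $A$ is a sequence $(P_i,X_{i+1},X_{i+1}^{(0)},n_{i+1},\rho_i)_{i=0}^{k-1}$, together with $P_0=\mathrm C_0(X_0,M_{n_0})$ and $A\cong P_k$, such that for $1\le i\le k$ $$P_i=\mathrm C_0(X_i,M_{n_i})\oplus_{\mathrm C_0(X_i^{(0)},M_{n_i})}P_{i-1}=\{(f,a): f|_{X_i^{(0)}}=\rho_{i-1}(a)\},$$ where the $X_i$ are locally compact Hausdorff spaces, $X_i^{(0)}\subseteq X_i$ is closed, the $n_i$ are positive integers, and $\rho_{i-1}\colon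 P_{i-1}\to \mathrm C_0(X_i^{(0)},M_{n_i})$ is a *-homomorphism. Its topological dimension is $\dim\big(\coprod_{i=0}^kX_i\big)$. $A$ is an RSH$_0$-algebra if it has such a decomposition. It is an RSH-algebra if it has an RSH-decomposition, i.e. one in which all the $X_i$ are compact and all the algebras and *-homomorphisms are unital. The decomposition is standard, with unital degree $l$, if * (a) all $X_i$ and $X_i^{(0)}$ are compact; * (b) for every $i$, the closed two-sided ideal generated by $\rho_i(P_i)$ is $\mathrm C(X_{i+1}^{(0)},M_{n_{i+1}})$; * (c) $0\le l\le k$, $P_l$ is unital, $P_{l+1}$ is not unital if $l<k$, and $(P_i,X_{i+1},X_{i+1}^{(0)},n_{i+1},\rho_i)_{i=0}^{l-1}$ is an RSH-decomposition of $P_l$. **Proposition.** Let $A$ be an RSH$_0$-algebra. 1. If $I$ is an ideal of $A$, then $I$ and $A/I$ are RSH$_0$-algebras. 2. $A$ has compact spectrum if and only if $A$ has a standard decomposition (for some unital degree $l$). 3. If $A$ has compact spectrum and $(P_i,X_{i+1},X_{i+1}^{(0)},n_{i+1},\rho_i)_{i=0}^{k-1}$ is a standard decomposition of $A$ with unital degree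 $l$, then $\widetilde A$ is an RSH-algebra with an RSH-decomposition $(Q_i,Y_{i+1},Y_{i+1}^{(0)},m_{i+1},\mu_i)_{i=0}^{k}$ given, up to the canonical identifications (with $Y_0=X_0$ and $m_0=n_0$), by $$(Q_i,Y_{i+1},Y_{i+1}^{(0)},m_{i+1},\mu_i)=\begin{cases}(P_i,X_{i+1},X_{i+1}^{(0)},n_{i+1},\rho_i)&0\le i\le l-1,\\ (P_l,\{y_l\},\varnothing,1,P_l\to0)&i=l,\\ (\widetilde P_{i-1},X_i,X_i^{(0)},n_i,\rho_{i-1}^\dagger)&l+1\le i\le k.\end{cases}$$ 4. If $X$ is a locally compact Hausdorff space, then $\mathrm C_0(X)\otimes A$ (the completion of the algebraic tensor product in any C*-norm) is an RSH$_0$-algebra. If moreover $X$ is compact and $A$ has compact spectrum, then $\mathrm C(X)\otimes A$ has compact spectrum. 5. If $A$ has compact spectrum and $p\in A$ is a projection, then $pAp$ is an RSH-algebra. In addition, given any RSH$_0$-decomposition of $A$, the decompositions of $I$ and $A/I$ in (1), the standard decomposition of $A$ in (2) (when $A$ has compact spectrum), and the RSH-decomposition of $pAp$ in (5) can be chosen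 with topological dimension no greater than that of the given decomposition. -/

import Mathlib

open scoped ZeroAtInfty TensorProduct ComplexOrder

universe u

noncomputable section

/-! ### Units, closed ideals, corners -/

/-- `e` is a two-sided identity element of `A`. -/
def IsIdentityElement {A : Type*} [Mul A] (e : A) : Prop :=
  ∀ a : A, e * a = a ∧ a * e = a

/-- The algebra `A` is unital. (The zero algebra is unital.) -/
def IsUnitalAlgebra (A : Type*) [Mul A] : Prop :=
  ∃ e : A, IsIdentityElement e

/-- The closed two-sided ideal generated by a subset of a C*-algebra, as a set. -/
def closedIdealGenerated {A : Type*} [NonUnitalCStarAlgebra A] (S : Set A) : Set A :=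
  closure (TwoSidedIdeal.span S : Set A)

/-- The corner `pAp` of a C*-algebra, for a projection `p`. -/
def cornerSubalgebra {A : Type*} [NonUnitalCStarAlgebra A] (p : A) (hp : IsStarProjection p) :
    NonUnitalStarSubalgebra ℂ A where
  carrier := {x | ∃ a : A, x = p * a * p}
  zero_mem' := ⟨0, by simp⟩
  add_mem' := by
    rintro _ _ ⟨a, rfl⟩ ⟨b, rfl⟩
    exact ⟨a + b, by rw [mul_add, add_mul]⟩
  mul_mem' := by
    rintro _ _ ⟨a, rfl⟩ ⟨b, rfl⟩
    exact ⟨a * p * (p * b), by simp only [mul_assoc]⟩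
  smul_mem' := by
    rintro c _ ⟨a, rfl⟩
    exact ⟨c • a, by rw [mul_smul_comm, smul_mul_assoc]⟩
  star_mem' := by
    rintro _ ⟨a, rfl⟩
    exact ⟨star a, by simp only [star_mul, hp.isSelfAdjoint.star_eq, mul_assoc]⟩

instance cornerSubalgebra_isClosed {A : Type*} [NonUnitalCStarAlgebra A] (p : A)
    (hp : IsStarProjection p) : IsClosed (cornerSubalgebra p hp : Set A) := by
  have h : (cornerSubalgebra p hp : Set A) = {x | p * x * p = x} := by
    ext x
    constructor
    · rintro ⟨a, rfl⟩
      have hpp : p * p = p := hp.isIdempotentElem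
      change p * (p * a * p) * p = p * a * p
      rw [← mul_assoc p (p * a) p, ← mul_assoc p p a, hpp, mul_assoc (p * a) p p, hpp]
    · intro hx
      exact ⟨x, Eq.symm hx⟩
  rw [h]
  exact isClosed_eq (by fun_prop) continuous_id

/-! ### The spectrum of a C*-algebra -/

/-- A (nonzero) irreducible representation of a C*-algebra on a Hilbert space. -/
structure IrreducibleRep (A : Type u) [NonUnitalCStarAlgebra A] where
  H : Type u
  [normed : NormedAddCommGroup H]
  [inner : InnerProductSpace ℂ H]
  [complete : CompleteSpace H]
  π : A →⋆ₙₐ[ℂ] (H →L[ℂ] H)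
  ne_zero : π ≠ 0
  irreducible : ∀ K : Submodule ℂ H, IsClosed (K : Set H) →
    (∀ a : A, ∀ x ∈ K, π a x ∈ K) → K = ⊥ ∨ K = ⊤

attribute [instance] IrreducibleRep.normed IrreducibleRep.inner IrreducibleRep.complete

/-- Unitary equivalence of irreducible representations. -/
def IrreducibleRep.setoid (A : Type u) [NonUnitalCStarAlgebra A] :
    Setoid (IrreducibleRep A) where
  r σ τ := ∃ U : σ.H ≃ₗᵢ[ℂ] τ.H, ∀ (a : A) (x : σ.H), U (σ.π a x) = τ.π a (U x)
  iseqv :=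
    { refl := fun σ => ⟨LinearIsometryEquiv.refl ℂ σ.H, fun _ _ => rfl⟩
      symm := by
        rintro σ τ ⟨U, hU⟩
        refine ⟨U.symm, fun a x => ?_⟩
        apply U.injective
        rw [hU, U.apply_symm_apply, U.apply_symm_apply]
      trans := by
        rintro σ τ ω ⟨U, hU⟩ ⟨V, hV⟩
        refine ⟨U.trans V, fun a x => ?_⟩
        simp only [LinearIsometryEquiv.trans_apply, hU, hV] }

/-- The hull-kernel topology: the open sets are the sets of representations that do not vanish
on a given closed two-sided ideal. -/
instance IrreducibleRep.topology (A : Type u) [NonUnitalCStarAlgebra A] :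
    TopologicalSpace (IrreducibleRep A) :=
  TopologicalSpace.generateFrom
    {W | ∃ I : TwoSidedIdeal A, IsClosed (I : Set A) ∧ W = {σ | ∃ a ∈ I, σ.π a ≠ 0}}

/-- The spectrum of a C*-algebra: the unitary equivalence classes of its irreducible
representations. -/
def CStarSpectrum (A : Type u) [NonUnitalCStarAlgebra A] : Type (u + 1) :=
  Quotient (IrreducibleRep.setoid A)

instance CStarSpectrum.topology (A : Type u) [NonUnitalCStarAlgebra A] :
    TopologicalSpace (CStarSpectrum A) :=
  inferInstanceAs (TopologicalSpace (Quotient (IrreducibleRep.setoid A)))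

/-- The C*-algebra `A` has compact spectrum. -/
def HasCompactSpectrum (A : Type u) [NonUnitalCStarAlgebra A] : Prop :=
  CompactSpace (CStarSpectrum A)

/-! ### Covering dimension -/

/-- `dim X ≤ d`: every finite open cover of `X` has a finite open refinement covering `X` such
that every point lies in at most `d + 1` of its members. Here `d = ⊥` stands for dimension `-1`,
the dimension of the empty space. -/
def HasCoveringDimLE (X : Type*) [TopologicalSpace X] (d : WithBot ℕ∞) : Prop :=
  ∀ 𝒰 : Set (Set X), 𝒰.Finite → (∀ U ∈ 𝒰, IsOpen U) → ⋃₀ 𝒰 = Set.univ →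
    ∃ 𝒱 : Set (Set X), 𝒱.Finite ∧ (∀ V ∈ 𝒱, IsOpen V) ∧ ⋃₀ 𝒱 = Set.univ ∧
      (∀ V ∈ 𝒱, ∃ U ∈ 𝒰, V ⊆ U) ∧
      ∀ x : X, (({V ∈ 𝒱 | x ∈ V}.encard : ℕ∞) : WithBot ℕ∞) ≤ d + 1

/-- The (Lebesgue) covering dimension. -/
def coveringDim (X : Type*) [TopologicalSpace X] : WithBot ℕ∞ :=
  sInf {d | HasCoveringDimLE X d}

/-! ### Recursive subhomogeneous decompositions -/

/-- The C*-algebra of complex `n × n` matrices. -/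
abbrev Mat (n : ℕ) : Type := CStarMatrix (Fin n) (Fin n) ℂ

/-- The pullback of the restriction map `C₀(X, Mₙ) → C₀(X⁽⁰⁾, Mₙ)` and of
`ρ : P → C₀(X⁽⁰⁾, Mₙ)`. -/
def restrictionPullback {X : Type u} [TopologicalSpace X] (X₀ : Set X) (n : ℕ)
    {P : Type u} [NonUnitalCStarAlgebra P] (ρ : P →⋆ₙₐ[ℂ] C₀(X₀, Mat n)) :
    NonUnitalStarSubalgebra ℂ (C₀(X, Mat n) × P) where
  carrier := {z | ∀ x : X₀, z.1 (x : X) = ρ z.2 x}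
  zero_mem' := fun x => by simp
  add_mem' := fun {a b} ha hb x => by
    rw [Prod.fst_add, Prod.snd_add, map_add, ZeroAtInftyContinuousMap.add_apply,
      ZeroAtInftyContinuousMap.add_apply, ha x, hb x]
  mul_mem' := fun {a b} ha hb x => by
    rw [Prod.fst_mul, Prod.snd_mul, map_mul, ZeroAtInftyContinuousMap.mul_apply,
      ZeroAtInftyContinuousMap.mul_apply, ha x, hb x]
  smul_mem' := fun c a ha x => by
    rw [Prod.smul_fst, Prod.smul_snd, map_smul, ZeroAtInftyContinuousMap.smul_apply,
      ZeroAtInftyContinuousMap.smul_apply, ha x]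
  star_mem' := fun {a} ha x => by
    rw [Prod.fst_star, Prod.snd_star, map_star, ZeroAtInftyContinuousMap.star_apply,
      ZeroAtInftyContinuousMap.star_apply, ha x]

/-- A decomposition of the C*-algebra `A` as an iterated pullback
`P₀ = C₀(X₀, M_{n₀})`, `Pᵢ = C₀(Xᵢ, M_{nᵢ}) ⊕_{C₀(Xᵢ⁽⁰⁾, M_{nᵢ})} Pᵢ₋₁`, `A ≅ Pₖ`, with
`Xᵢ` locally compact Hausdorff, `Xᵢ⁽⁰⁾ ⊆ Xᵢ` closed and `nᵢ` positive. In `step`, `A` is the last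
pullback of the sequence, `P` the one before it. -/
inductive RSHZeroDecomposition : (A : Type u) → [NonUnitalCStarAlgebra A] → Type (u + 1)
  | base {A : Type u} [NonUnitalCStarAlgebra A]
      (X : Type u) [TopologicalSpace X] [T2Space X] [LocallyCompactSpace X]
      (n : ℕ) (hn : 0 < n) (e : A ≃⋆ₐ[ℂ] C₀(X, Mat n)) : RSHZeroDecomposition A
  | step {A P : Type u} [NonUnitalCStarAlgebra A] [NonUnitalCStarAlgebra P]
      (D : RSHZeroDecomposition P)
      (X : Type u) [TopologicalSpace X] [T2Space X] [LocallyCompactSpace X]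
      (X₀ : Set X) (hX₀ : IsClosed X₀) (n : ℕ) (hn : 0 < n)
      (ρ : P →⋆ₙₐ[ℂ] C₀(X₀, Mat n))
      (e : A ≃⋆ₐ[ℂ] restrictionPullback X₀ n ρ) : RSHZeroDecomposition A

/-- `A` is a recursive subhomogeneous algebra vanishing at infinity. -/
def IsRSHZero (A : Type u) [NonUnitalCStarAlgebra A] : Prop :=
  Nonempty (RSHZeroDecomposition A)

/-- A C*-algebra together with a decomposition. -/
structure DecomposedAlgebra where
  carrier : Type u
  [cstar : NonUnitalCStarAlgebra carrier]
  decomposition : RSHZeroDecomposition carrier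

attribute [instance] DecomposedAlgebra.cstar

namespace RSHZeroDecomposition

/-- The length `k` of a decomposition. -/
def length : {A : Type u} → [NonUnitalCStarAlgebra A] → RSHZeroDecomposition A → ℕ
  | _, _, base .. => 0
  | _, _, step D .. => D.length + 1

/-- The `i`-th pullback `Pᵢ` of a decomposition together with its decomposition of length `i`
(for `i` at least the length: the whole decomposition). -/
def stage : {A : Type u} → [NonUnitalCStarAlgebra A] → RSHZeroDecomposition A → ℕ →
    DecomposedAlgebra.{u}
  | A, _, base X n hn e, _ => ⟨A, base X n hn e⟩
  | A, _, step D X X₀ hX₀ n hn ρ e, i =>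
    if i ≤ D.length then D.stage i else ⟨A, step D X X₀ hX₀ n hn ρ e⟩

/-- The total space: the disjoint union of the base spaces. -/
def totalSpace : {A : Type u} → [NonUnitalCStarAlgebra A] → RSHZeroDecomposition A → TopCat.{u}
  | _, _, base X .. => TopCat.of X
  | _, _, step D X .. => TopCat.of (D.totalSpace ⊕ X)

/-- The topological dimension of a decomposition: the covering dimension of its total space. -/
def topDim {A : Type u} [NonUnitalCStarAlgebra A] (D : RSHZeroDecomposition A) : WithBot ℕ∞ :=
  coveringDim D.totalSpace

/-- All the base spaces `Xᵢ` (hence also the closed subspaces `Xᵢ⁽⁰⁾`) are compact. -/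
def AllCompact : {A : Type u} → [NonUnitalCStarAlgebra A] → RSHZeroDecomposition A → Prop
  | _, _, base X .. => CompactSpace X
  | _, _, step D X X₀ .. => D.AllCompact ∧ CompactSpace X ∧ CompactSpace X₀

/-- For all `i`, the closed ideal generated by `ρᵢ(Pᵢ)` is `C₀(Xᵢ₊₁⁽⁰⁾, M_{nᵢ₊₁})`. -/
def AllFull : {A : Type u} → [NonUnitalCStarAlgebra A] → RSHZeroDecomposition A → Prop
  | _, _, base .. => True
  | _, _, step D _ _ _ _ _ ρ _ =>
    D.AllFull ∧ closedIdealGenerated (Set.range ρ) = Set.univ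

/-- The decomposition is an RSH-decomposition: all the base spaces are compact and all the
algebras and all the *-homomorphisms `ρᵢ` are unital. (The restriction maps then are unital.) -/
def IsUnital : {A : Type u} → [NonUnitalCStarAlgebra A] → RSHZeroDecomposition A → Prop
  | A, _, base X .. => CompactSpace X ∧ IsUnitalAlgebra A
  | A, _, step (P := P) D X _ _ _ _ ρ _ =>
    D.IsUnital ∧ CompactSpace X ∧ IsUnitalAlgebra A ∧
      ∃ u : P, IsIdentityElement u ∧ IsIdentityElement (ρ u)

/-- Standard decompositions, with unital degree `l`. -/
structure IsStandard {A : Type u} [NonUnitalCStarAlgebra A] (D : RSHZeroDecomposition A)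
    (l : ℕ) : Prop where
  compact : D.AllCompact
  full : D.AllFull
  le_length : l ≤ D.length
  unital : IsUnitalAlgebra (D.stage l).carrier
  not_unital : l < D.length → ¬ IsUnitalAlgebra (D.stage (l + 1)).carrier
  isUnital : (D.stage l).decomposition.IsUnital

/-- `IsUnitizationOf l D E`: the decomposition `E` of the unitization `Ã` is obtained from the
decomposition `D` of `A` as follows. If `D` is given by `(Pᵢ, Xᵢ₊₁, Xᵢ₊₁⁽⁰⁾, nᵢ₊₁, ρᵢ)`, `i < k`,
then `E` is given by `(Qᵢ, Yᵢ₊₁, Yᵢ₊₁⁽⁰⁾, mᵢ₊₁, μᵢ)`, `i < k + 1`, equal to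
* `(Pᵢ, Xᵢ₊₁, Xᵢ₊₁⁽⁰⁾, nᵢ₊₁, ρᵢ)` for `i < l`,
* `(P_l, {pt}, ∅, 1, P_l → 0)` for `i = l`,
* `(P̃ᵢ₋₁, Xᵢ, Xᵢ⁽⁰⁾, nᵢ, ρᵢ₋₁†)` for `l < i`, where `ρ†` is the unital extension of `ρ` to `P̃`.

In both constructors the last condition says that the isomorphism of the unitization with the
pullback extends the canonical one on the algebra. -/
inductive IsUnitizationOf : {A : Type u} → [NonUnitalCStarAlgebra A] → ℕ →
    RSHZeroDecomposition A → RSHZeroDecomposition (Unitization ℂ A) → Prop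
  | top {A : Type u} [NonUnitalCStarAlgebra A] (D : RSHZeroDecomposition A)
      (μ : A →⋆ₙₐ[ℂ] C₀((∅ : Set PUnit.{u + 1}), Mat 1))
      (e : Unitization ℂ A ≃⋆ₐ[ℂ] restrictionPullback (∅ : Set PUnit.{u + 1}) 1 μ)
      (he : ∀ a : A, (e (Unitization.inr a)).1 = (0, a)) :
      IsUnitizationOf D.length D
        (step D PUnit.{u + 1} ∅ isClosed_empty 1 one_pos μ e)
  | step {A P : Type u} [NonUnitalCStarAlgebra A] [NonUnitalCStarAlgebra P] (l : ℕ)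
      (D : RSHZeroDecomposition P) (E : RSHZeroDecomposition (Unitization ℂ P))
      (hDE : IsUnitizationOf l D E)
      (X : Type u) [TopologicalSpace X] [T2Space X] [LocallyCompactSpace X]
      (X₀ : Set X) (hX₀ : IsClosed X₀) (n : ℕ) (hn : 0 < n)
      (ρ : P →⋆ₙₐ[ℂ] C₀(X₀, Mat n)) (e : A ≃⋆ₐ[ℂ] restrictionPullback X₀ n ρ)
      (ρ' : Unitization ℂ P →⋆ₙₐ[ℂ] C₀(X₀, Mat n))
      (hρ' : ∀ (z : Unitization ℂ P) (x : X₀), ρ' z x = z.fst • (1 : Mat n) + ρ z.snd x)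
      (e' : Unitization ℂ A ≃⋆ₐ[ℂ] restrictionPullback X₀ n ρ')
      (he' : ∀ a : A,
        (e' (Unitization.inr a)).1 = ((e a).1.1, Unitization.inr (e a).1.2)) :
      IsUnitizationOf l (step D X X₀ hX₀ n hn ρ e) (step E X X₀ hX₀ n hn ρ' e')

end RSHZeroDecomposition

/-- `A` is a recursive subhomogeneous algebra. -/
def IsRSH (A : Type u) [NonUnitalCStarAlgebra A] : Prop :=
  ∃ D : RSHZeroDecomposition A, D.IsUnital

/-! ### Tensor products -/

/-- `T`, with the bilinear map `(b, a) ↦ β b a = b ⊗ a`, is a C*-tensor product of `B` and `A`: it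
contains the algebraic tensor product of `B` and `A` as a dense *-subalgebra; that is, `T` is the
completion of the algebraic tensor product in a C*-norm. -/
structure IsCStarTensorProduct {B A T : Type*} [NonUnitalCStarAlgebra B]
    [NonUnitalCStarAlgebra A] [NonUnitalCStarAlgebra T] (β : B →ₗ[ℂ] A →ₗ[ℂ] T) : Prop where
  mul_apply : ∀ (b b' : B) (a a' : A), β b a * β b' a' = β (b * b') (a * a')
  star_apply : ∀ (b : B) (a : A), star (β b a) = β (star b) (star a)
  injective : Function.Injective (TensorProduct.lift β)
  dense : DenseRange (TensorProduct.lift β)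

end

noncomputable section

open ZeroAtInftyContinuousMap Topology

/-! ### Closed ideals and *-homomorphisms of C*-algebras -/

section ClosedIdeals

variable {A : Type*} [NonUnitalCStarAlgebra A]

/-! An RSH₀-algebra arises from the zero algebra by finitely many extensions, and most of the
argument is induction over these. The gluing maps are suppressed: `IsStep` records a surjection `q :
A → P` and a map `φ : A → C₀(X, Mₙ)` that identifies `ker q` with the functions vanishing on a
closed `X₀`. The gluing map is recovered from this in `IsStep.exists_pullback`.

Ideals and quotients. Since `Mₙ` is simple, a closed ideal `I` is determined by the common zero set
`Z` of `φ(I)` and by `q(I)` (`IsStep.mem_ideal_iff`). Hence `I` is a step over `q(I)` with `X₀`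
enlarged to `X₀ ∪ Z`, and `A/I` is a step over `P/q(I)` with base `Z`. Base spaces are kept or
replaced by closed subspaces, so the dimension does not grow.

Compact spectrum. Compactness yields a finite set `S` such that every surjection `τ` onto a matrix
algebra has `‖τ a‖ ≥ 1` for some `a ∈ S`. Evaluations off `X₀` are such surjections, and the
inequality passes to the closure of `X \ X₀`. This closure is therefore compact and `φ(A)` has no
common zero on it, which is fullness. Using it as base space gives a standard decomposition
(`RSHDim.exists_isStandard`). Conversely, compact bases and fullness produce a finite set as in
`HasBoundedReps`. Given a cover of the spectrum by open sets of ideals, the ideals have dense sum,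
so finitely many of them approximate all of `S` within distance `1`, and these already cover.

Unitization. For unital `P_l` it is `ℂ ⊕ P_l`; unitizing a pullback over `P` gives the pullback over
the unitization of `P`.

Tensor products. Every C*-norm is bounded by the supremum norm
(`IsCStarTensorProduct.norm_lift_le`), so `T` is a quotient of `C₀(X, A)`. A nonzero closed ideal of
`C₀(X, A)` contains a nonzero elementary tensor, so the quotient map is injective. Finally `C₀(X,
-)` sends a step with base `Y` to one with base `X × Y`.

Corners. A projection-valued function is locally conjugate to a constant projection. Its support has
a finite cover by compact sets over which the corner is a full matrix algebra of functions, and the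
corner is assembled from these one set at a time (`RSHUnital.of_cover`). -/

lemma exists_continuous_mul_sq_le {ε : ℝ} (hε : 0 < ε) :
    ∃ h : ℝ → ℝ, Continuous h ∧ h 0 = 0 ∧ ∀ t, |t * (1 - t * h t) ^ 2| ≤ ε ^ 2 := by
  -- If `N t² ≥ 1`, then `t h(t) = 1` and the expression vanishes. Otherwise `|t| ≤ ε²`, which is
  -- where `N = ε⁻⁴` comes from, and `1 - t h(t) = 1 - N t²` lies in `[0, 1]`.
  set N : ℝ := (ε ^ 4)⁻¹ with hN
  have hNpos : 0 < N := by positivity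
  refine ⟨fun t => N * t / max 1 (N * t ^ 2), ?_, by simp, fun t => ?_⟩
  · exact Continuous.div (by fun_prop) (by fun_prop) fun t =>
      (lt_of_lt_of_le one_pos (le_max_left _ _)).ne'
  · rcases le_total 1 (N * t ^ 2) with h1 | h1
    · have : t * (N * t / max 1 (N * t ^ 2)) = 1 := by
        have ht : t ≠ 0 := by rintro rfl; norm_num at h1
        rw [max_eq_right h1]; field_simp
      rw [this]; simp; positivity
    · have h3 : t * (N * t / max 1 (N * t ^ 2)) = N * t ^ 2 := by
        rw [max_eq_left h1]; ring
      rw [h3, abs_mul]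
      have h4 : |t| ≤ ε ^ 2 := by
        apply abs_le_of_sq_le_sq _ (by positivity)
        rw [hN, inv_mul_le_iff₀ (by positivity)] at h1
        nlinarith
      have h5 : |(1 - N * t ^ 2) ^ 2| ≤ 1 := by
        rw [abs_of_nonneg (sq_nonneg _)]
        have : 0 ≤ N * t ^ 2 := by positivity
        nlinarith
      calc |t| * |(1 - N * t ^ 2) ^ 2| ≤ ε ^ 2 * 1 := by gcongr
        _ = ε ^ 2 := mul_one _

/-- With `b = y* y` and `k = h(b)`, the C*-identity gives `‖y - y b k‖² = ‖b (1 - b k)²‖`, which the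
choice of `h` bounds by `ε²`. This plays the role of an approximate unit. -/
lemma exists_norm_sub_mul_star_mul_self_le (y : A) {ε : ℝ} (hε : 0 < ε) :
    ∃ k : A, ‖y - y * ((star y * y) * k)‖ ≤ ε := by
  obtain ⟨h, hcont, hh0, hbound⟩ := exists_continuous_mul_sq_le hε
  have hbs : IsSelfAdjoint (star y * y) := .star_mul_self y
  set b := star y * y with hb
  set k := cfcₙ h b with hk
  have hc : b * k = k * b := by
    have h1 : cfcₙ (fun t : ℝ => t) b = b := cfcₙ_id' ℝ b
    have h2 : b * k = cfcₙ (fun t => t * h t) b := by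
      rw [cfcₙ_mul (fun t => t) h b continuousOn_id rfl hcont.continuousOn hh0, h1]
    have h3 : k * b = cfcₙ (fun t => h t * t) b := by
      rw [cfcₙ_mul h (fun t => t) b hcont.continuousOn hh0 continuousOn_id rfl, h1]
    rw [h2, h3]; simp_rw [mul_comm]
  have hks : star k = k := (cfcₙ_predicate h b : IsSelfAdjoint _)
  refine ⟨k, ?_⟩
  set g : ℝ → ℝ := fun t => t * h t with hg
  have hgc : Continuous g := by fun_prop
  have hg0 : g 0 = 0 := by simp [hg]
  have hu : cfcₙ g b = b * k := by
    rw [hg, cfcₙ_mul (fun t => t) h b continuousOn_id rfl hcont.continuousOn hh0, cfcₙ_id' ℝ b]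
  set w : ℝ → ℝ := fun t => t - t * g t with hw
  have hwc : Continuous w := by fun_prop
  have hw0 : w 0 = 0 := by simp [hw]
  have hwu : cfcₙ w b = b - b * (b * k) := by
    rw [hw, cfcₙ_sub (fun t => t) (fun t => t * g t) b continuousOn_id rfl
      (by fun_prop) (by simp), cfcₙ_mul (fun t => t) g b continuousOn_id rfl hgc.continuousOn hg0,
      cfcₙ_id' ℝ b, hu]
  have key : star (y - y * (b * k)) * (y - y * (b * k)) = cfcₙ (fun t => w t - g t * w t) b := by
    rw [cfcₙ_sub w (fun t => g t * w t) b hwc.continuousOn hw0 (by fun_prop) (by simp [hw0]),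
      cfcₙ_mul g w b hgc.continuousOn hg0 hwc.continuousOn hw0, hwu, hu, star_sub, star_mul,
      star_mul, hks, hbs.star_eq, ← hc, sub_mul, mul_sub, mul_sub,
      mul_assoc (b * k) (star y) (y * (b * k)), ← mul_assoc (star y) y (b * k),
      mul_assoc (b * k) (star y) y, ← hb, mul_sub]
  have h2 : ‖star (y - y * (b * k)) * (y - y * (b * k))‖ ≤ ε ^ 2 := by
    rw [key]
    apply norm_cfcₙ_le
    intro t _
    have e1 : w t - g t * w t = t * (1 - t * h t) ^ 2 := by simp only [hw, hg]; ring
    rw [e1]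
    exact hbound t
  rw [CStarRing.norm_star_mul_self] at h2
  exact (sq_le_sq₀ (norm_nonneg _) hε.le).1 (by rwa [sq])

variable {I : TwoSidedIdeal A}

lemma TwoSidedIdeal.mem_of_forall_norm_sub_le (hI : IsClosed (I : Set A)) {y : A}
    (h : ∀ ε > 0, ∃ z ∈ I, ‖y - z‖ ≤ ε) : y ∈ I := by
  have : y ∈ closure (I : Set A) := by
    rw [Metric.mem_closure_iff]
    intro ε hε
    obtain ⟨z, hz, hyz⟩ := h (ε / 2) (by positivity)
    exact ⟨z, hz, by rw [dist_eq_norm]; linarith⟩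
  rwa [hI.closure_eq] at this

/-- The elements `y (y* y) k` lie in `I` and approximate `y`. Stability of closed ideals under the
involution and under scalars both follow. -/
lemma TwoSidedIdeal.mem_of_star_mul_self_mem (hI : IsClosed (I : Set A)) {y : A}
    (h : star y * y ∈ I) : y ∈ I := by
  refine TwoSidedIdeal.mem_of_forall_norm_sub_le hI fun ε hε => ?_
  obtain ⟨k, hk⟩ := exists_norm_sub_mul_star_mul_self_le y hε
  exact ⟨_, I.mul_mem_left _ _ (I.mul_mem_right _ _ h), hk⟩

lemma TwoSidedIdeal.star_mem_of_isClosed (hI : IsClosed (I : Set A)) {y : A}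
    (h : y ∈ I) : star y ∈ I :=
  TwoSidedIdeal.mem_of_star_mul_self_mem hI (I.mul_mem_right _ _ (by rwa [star_star]))

/-- A two-sided ideal is a purely ring-theoretic object here, without scalars; but `(c y)* (c y)` is
a left multiple of `y` in the ring. -/
lemma TwoSidedIdeal.smul_mem_of_isClosed (hI : IsClosed (I : Set A)) (c : ℂ) {y : A}
    (h : y ∈ I) : c • y ∈ I := by
  refine TwoSidedIdeal.mem_of_star_mul_self_mem hI ?_
  rw [mul_smul_comm, ← smul_mul_assoc]
  exact I.mul_mem_left _ _ h

/-- A closed ideal as a *-subalgebra. -/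
def TwoSidedIdeal.toStarSubalgebra (I : TwoSidedIdeal A) (hI : IsClosed (I : Set A)) :
    NonUnitalStarSubalgebra ℂ A where
  carrier := I
  zero_mem' := I.zero_mem
  add_mem' := I.add_mem
  mul_mem' := fun _ h => I.mul_mem_left _ _ h
  smul_mem' := fun c _ h => TwoSidedIdeal.smul_mem_of_isClosed hI c h
  star_mem' := TwoSidedIdeal.star_mem_of_isClosed hI

/-- The closure of an ideal. -/
def TwoSidedIdeal.closedHull (I : TwoSidedIdeal A) : TwoSidedIdeal A :=
  .mk' (closure (I : Set A)) (subset_closure I.zero_mem)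
    (fun hx hy => map_mem_closure₂ continuous_add hx hy fun _ ha _ hb => I.add_mem ha hb)
    (fun hx => map_mem_closure continuous_neg hx fun _ ha => I.neg_mem ha)
    (fun {x _} hy => map_mem_closure (f := fun a => x * a) (continuous_const_mul x) hy
      fun _ ha => I.mul_mem_left _ _ ha)
    (fun {_ y} hx => map_mem_closure (f := fun a => a * y) (continuous_mul_const y) hx
      fun _ ha => I.mul_mem_right _ _ ha)

lemma TwoSidedIdeal.coe_closedHull (I : TwoSidedIdeal A) :
    (I.closedHull : Set A) = closure (I : Set A) := by
  unfold TwoSidedIdeal.closedHull; rw [TwoSidedIdeal.coe_mk']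

lemma TwoSidedIdeal.isClosed_closedHull (I : TwoSidedIdeal A) :
    IsClosed (I.closedHull : Set A) := by
  rw [TwoSidedIdeal.coe_closedHull]; exact isClosed_closure

lemma TwoSidedIdeal.le_closedHull (I : TwoSidedIdeal A) : I ≤ I.closedHull := by
  rw [TwoSidedIdeal.le_iff, TwoSidedIdeal.coe_closedHull]; exact subset_closure

end ClosedIdeals

/-! ### *-Homomorphisms: closed range, factorization, kernels and images. -/

section Hom

variable {A B P : Type*} [NonUnitalCStarAlgebra A] [NonUnitalCStarAlgebra B]
  [NonUnitalCStarAlgebra P]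

lemma NonUnitalStarAlgHom.continuous_of_cstar (θ : A →⋆ₙₐ[ℂ] B) : Continuous θ :=
  AddMonoidHomClass.continuous_of_bound θ 1
    (by simpa only [one_mul] using NonUnitalStarAlgHom.norm_apply_le θ)

/-- Truncate `a` at height `‖θ a‖` by functional calculus. This commutes with `θ` and leaves `θ a`
unchanged, as the spectrum of `θ a` already lies in the truncation interval. -/
lemma NonUnitalStarAlgHom.exists_selfAdjoint_preimage (θ : A →⋆ₙₐ[ℂ] B) {a : A}
    (ha : IsSelfAdjoint a) : ∃ a' : A, θ a' = θ a ∧ ‖a'‖ ≤ ‖θ a‖ := by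
  set δ := ‖θ a‖ with hδ
  have hδ0 : 0 ≤ δ := norm_nonneg _
  set f : ℝ → ℝ := fun t => max (-δ) (min t δ) with hf
  have hf0 : f 0 = 0 := by simp [hf, hδ0]
  have hc : Continuous f := by fun_prop
  refine ⟨cfcₙ f a, ?_, ?_⟩
  · rw [NonUnitalStarAlgHom.map_cfcₙ θ f a hc.continuousOn hf0 θ.continuous_of_cstar ha (ha.map θ)]
    have hsa : IsSelfAdjoint (θ a) := ha.map θ
    conv_rhs => rw [← cfcₙ_id ℝ (θ a)]
    apply cfcₙ_congr
    intro t ht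
    have : ‖t‖ ≤ δ := by
      have := norm_apply_le_norm_cfcₙ (id : ℝ → ℝ) (θ a) ht
      rwa [cfcₙ_id ℝ (θ a)] at this
    rw [Real.norm_eq_abs, abs_le] at this
    simp [hf, this.1, this.2]
  · apply norm_cfcₙ_le
    intro t _
    rw [Real.norm_eq_abs, abs_le]
    simp only [hf]
    exact ⟨le_max_left _ _, max_le (by linarith) (min_le_right _ _)⟩

/-- Real and imaginary parts are lifted separately, whence the factor `2`. Any uniform constant
suffices for the range to be closed. -/
lemma NonUnitalStarAlgHom.exists_preimage_norm_le (θ : A →⋆ₙₐ[ℂ] B) (a : A) :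
    ∃ a' : A, θ a' = θ a ∧ ‖a'‖ ≤ 2 * ‖θ a‖ := by
  obtain ⟨x, hx, hxn⟩ := θ.exists_selfAdjoint_preimage (a := (realPart a : A)) (realPart a).2
  obtain ⟨y, hy, hyn⟩ :=
    θ.exists_selfAdjoint_preimage (a := (imaginaryPart a : A)) (imaginaryPart a).2
  have hre : θ (realPart a : A) = (realPart (θ a) : B) := map_realPart θ a
  have him : θ (imaginaryPart a : A) = (imaginaryPart (θ a) : B) := map_imaginaryPart θ a
  refine ⟨x + Complex.I • y, ?_, ?_⟩
  · rw [map_add, map_smul, hx, hy, ← map_smul, ← map_add, realPart_add_I_smul_imaginaryPart]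
  · rw [hre] at hxn
    rw [him] at hyn
    have h1 : ‖(realPart (θ a) : B)‖ ≤ ‖θ a‖ := realPart.norm_le (θ a)
    have h2 : ‖(imaginaryPart (θ a) : B)‖ ≤ ‖θ a‖ := imaginaryPart.norm_le (θ a)
    calc ‖x + Complex.I • y‖ ≤ ‖x‖ + ‖Complex.I • y‖ := norm_add_le _ _
      _ = ‖x‖ + ‖y‖ := by rw [norm_smul]; simp
      _ ≤ 2 * ‖θ a‖ := by linarith

/-- The range of a *-homomorphism of C*-algebras is closed. -/
lemma NonUnitalStarAlgHom.isClosed_range (θ : A →⋆ₙₐ[ℂ] B) : IsClosed (Set.range θ) := by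
  let f : NormedAddGroupHom A B := AddMonoidHom.mkNormedAddGroupHom (θ : A →+ B) 1
    (fun a => by simpa using NonUnitalStarAlgHom.norm_apply_le θ a)
  let K : AddSubgroup B := AddMonoidHom.range (θ : A →+ B)
  have hK : f.SurjectiveOnWith K 2 := by
    rintro _ ⟨a, rfl⟩
    obtain ⟨a', h1, h2⟩ := θ.exists_preimage_norm_le a
    exact ⟨a', h1, h2⟩
  have := controlled_closure_of_complete (ε := 1) two_pos one_pos hK
  apply isClosed_of_closure_subset
  intro b hb
  obtain ⟨a, ha, -⟩ := this b hb
  exact ⟨a, ha⟩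

/-- A *-homomorphism that vanishes on the kernel of a surjective one factors through it. -/
lemma NonUnitalStarAlgHom.exists_factor (q : A →⋆ₙₐ[ℂ] P) (hq : Function.Surjective q)
    (ψ : A →⋆ₙₐ[ℂ] B) (h : ∀ a, q a = 0 → ψ a = 0) : ∃ ρ : P →⋆ₙₐ[ℂ] B, ∀ a, ρ (q a) = ψ a := by
  have key : ∀ a a', q a = q a' → ψ a = ψ a' := fun a a' haa => by
    rw [← sub_eq_zero, ← map_sub]; exact h _ (by rw [map_sub, haa, sub_self])
  let g := Function.surjInv hq
  have hs : ∀ p, q (g p) = p := Function.surjInv_eq hq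
  refine ⟨{ toFun := fun p => ψ (g p), map_smul' := ?_, map_zero' := ?_, map_add' := ?_,
            map_mul' := ?_, map_star' := ?_ }, fun a => key _ _ (hs _)⟩
  · intro c p; change ψ _ = c • ψ _; rw [← map_smul]; exact key _ _ (by rw [map_smul, hs, hs])
  · exact h _ (hs _)
  · intro p p'; rw [← map_add]; exact key _ _ (by rw [map_add, hs, hs, hs])
  · intro p p'; rw [← map_mul]; exact key _ _ (by rw [map_mul, hs, hs, hs])
  · intro p; rw [← map_star]; exact key _ _ (by rw [map_star, hs, hs])

/-- The kernel of a *-homomorphism as an ideal. -/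
def NonUnitalStarAlgHom.kerIdeal (θ : A →⋆ₙₐ[ℂ] B) : TwoSidedIdeal A :=
  .mk' {a | θ a = 0} (map_zero θ) (fun {x y} hx hy => by
      change θ _ = 0; rw [map_add, show θ x = 0 from hx, show θ y = 0 from hy, add_zero])
    (fun {x} hx => by change θ _ = 0; rw [map_neg, show θ x = 0 from hx, neg_zero])
    (fun {x y} hy => by change θ _ = 0; rw [map_mul, show θ y = 0 from hy, mul_zero])
    (fun {x y} hx => by change θ _ = 0; rw [map_mul, show θ x = 0 from hx, zero_mul])

@[simp] lemma NonUnitalStarAlgHom.mem_kerIdeal (θ : A →⋆ₙₐ[ℂ] B) (a : A) :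
    a ∈ θ.kerIdeal ↔ θ a = 0 := TwoSidedIdeal.mem_mk' ..

lemma NonUnitalStarAlgHom.isClosed_kerIdeal (θ : A →⋆ₙₐ[ℂ] B) :
    IsClosed (θ.kerIdeal : Set A) := by
  have : (θ.kerIdeal : Set A) = {a | θ a = 0} := by ext a; simp
  rw [this]; exact isClosed_eq θ.continuous_of_cstar continuous_const

/-- The image of an ideal under a surjective *-homomorphism. -/
def TwoSidedIdeal.image (I : TwoSidedIdeal A) (q : A →⋆ₙₐ[ℂ] P) (hq : Function.Surjective q) :
    TwoSidedIdeal P :=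
  .mk' (q '' I) ⟨0, I.zero_mem, map_zero q⟩
    (by rintro _ _ ⟨a, ha, rfl⟩ ⟨b, hb, rfl⟩; exact ⟨a + b, I.add_mem ha hb, map_add ..⟩)
    (by rintro _ ⟨a, ha, rfl⟩; exact ⟨-a, I.neg_mem ha, map_neg ..⟩)
    (by rintro x _ ⟨b, hb, rfl⟩
        obtain ⟨a, rfl⟩ := hq x
        exact ⟨a * b, I.mul_mem_left _ _ hb, map_mul ..⟩)
    (by rintro _ y ⟨b, hb, rfl⟩
        obtain ⟨a, rfl⟩ := hq y
        exact ⟨b * a, I.mul_mem_right _ _ hb, map_mul ..⟩)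

lemma TwoSidedIdeal.coe_image (I : TwoSidedIdeal A) (q : A →⋆ₙₐ[ℂ] P)
    (hq : Function.Surjective q) : (I.image q hq : Set P) = q '' I := TwoSidedIdeal.coe_mk' ..

lemma TwoSidedIdeal.mem_image (I : TwoSidedIdeal A) (q : A →⋆ₙₐ[ℂ] P)
    (hq : Function.Surjective q) (p : P) : p ∈ I.image q hq ↔ ∃ a ∈ I, q a = p := by
  rw [← SetLike.mem_coe, TwoSidedIdeal.coe_image]; rfl

lemma TwoSidedIdeal.isClosed_image (I : TwoSidedIdeal A) (hI : IsClosed (I : Set A))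
    (q : A →⋆ₙₐ[ℂ] P) (hq : Function.Surjective q) : IsClosed (I.image q hq : Set P) := by
  have : IsClosed (I.toStarSubalgebra hI : Set A) := hI
  have := (q.comp (NonUnitalStarSubalgebraClass.subtype (I.toStarSubalgebra hI))).isClosed_range
  convert this using 1
  rw [TwoSidedIdeal.coe_image]
  ext p
  constructor
  · rintro ⟨a, ha, rfl⟩; exact ⟨⟨a, ha⟩, rfl⟩
  · rintro ⟨a, rfl⟩; exact ⟨a, a.2, rfl⟩

end Hom

/-! ### Functions vanishing at infinity -/

namespace ZeroAtInftyContinuousMap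

open Filter Topology

/-! ### Partitions of unity, extension and gluing. -/

section General

variable {X E : Type*} [TopologicalSpace X] [NormedAddCommGroup E]

lemma norm_apply_le (f : C₀(X, E)) (x : X) : ‖f x‖ ≤ ‖f‖ := f.toBCF.norm_coe_le_norm x

lemma norm_le_of_forall {f : C₀(X, E)} {C : ℝ} (hC : 0 ≤ C) (h : ∀ x, ‖f x‖ ≤ C) : ‖f‖ ≤ C :=
  (BoundedContinuousFunction.norm_le (f := f.toBCF) hC).2 h

lemma isCompact_le_norm (f : C₀(X, E)) {ε : ℝ} (hε : 0 < ε) : IsCompact {x | ε ≤ ‖f x‖} := by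
  have h := f.zero_at_infty'
  have h2 : ∀ᶠ x in cocompact X, ‖f x‖ < ε := by
    exact (h.norm).eventually (gt_mem_nhds (by simpa using hε))
  rw [Filter.Eventually, Filter.mem_cocompact] at h2
  obtain ⟨K, hK, hKs⟩ := h2
  refine hK.of_isClosed_subset (isClosed_le continuous_const (map_continuous f).norm) ?_
  intro x hx
  by_contra hxK
  exact absurd (show ‖f x‖ < ε from hKs hxK) (not_lt.2 hx)

lemma tendsto_cocompact_zero {f : X → E}
    (h : ∀ ε > 0, ∃ K : Set X, IsCompact K ∧ ∀ x, x ∉ K → ‖f x‖ < ε) :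
    Tendsto f (cocompact X) (𝓝 0) := by
  rw [Metric.tendsto_nhds]
  intro ε hε
  obtain ⟨K, hK, hKf⟩ := h ε hε
  filter_upwards [hK.compl_mem_cocompact] with x hx
  simpa using hKf x hx

/-- Evaluation at a point, as an additive map. -/
def evalAddHom (x : X) : C₀(X, E) →+ E where
  toFun f := f x
  map_zero' := rfl
  map_add' _ _ := rfl

@[simp] lemma evalAddHom_apply (x : X) (f : C₀(X, E)) : evalAddHom x f = f x := rfl

/-- The product of a compactly supported function and a continuous function. -/
def bump [NormedSpace ℂ E] (ψ : C(X, ℝ)) (hψ : HasCompactSupport ψ) (k : C(X, E)) : C₀(X, E) where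
  toFun x := (ψ x : ℂ) • k x
  continuous_toFun := by fun_prop
  zero_at_infty' := tendsto_cocompact_zero fun ε hε => ⟨tsupport ψ, hψ, fun x hx => by
    rw [image_eq_zero_of_notMem_tsupport hx]; simpa using hε⟩

@[simp] lemma bump_apply [NormedSpace ℂ E] (ψ : C(X, ℝ)) (hψ : HasCompactSupport ψ) (k : C(X, E))
    (x : X) : bump ψ hψ k x = (ψ x : ℂ) • k x := rfl

/-- Approximation of a function by means of a partition of unity. -/
theorem exists_sum_bump_norm_sub_le [NormedSpace ℂ E] [T2Space X] [LocallyCompactSpace X]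
    (g : C₀(X, E)) {ε : ℝ} (hε : 0 < ε) (k : X → C(X, E)) {U : X → Set X} (hUo : ∀ x, IsOpen (U x))
    (hxU : ∀ x, x ∈ U x) (hkx : ∀ x, ‖k x x - g x‖ < ε) :
    ∃ (t : Finset X) (ψ : t → C(X, ℝ)) (hψ : ∀ i, HasCompactSupport (ψ i)),
      (∀ i y, ψ i y ∈ Set.Icc (0 : ℝ) 1) ∧ (∀ y, ∑ i, ψ i y ≤ 1) ∧ (∀ i, tsupport (ψ i) ⊆ U i) ∧
        ‖∑ i, bump (ψ i) (hψ i) (k i) - g‖ ≤ ε := by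
  -- On `V x` the local model `k x` is within `ε` of `g`. Only the compact set where `‖g‖ ≥ ε` has
  -- to be covered.
  let V : X → Set X := fun x => U x ∩ {y | ‖k x y - g y‖ < ε}
  have hVo : ∀ x, IsOpen (V x) := fun x => (hUo x).inter
    (isOpen_lt (((k x).continuous.sub (map_continuous g)).norm) continuous_const)
  have hK := isCompact_le_norm g hε
  obtain ⟨t, ht⟩ := hK.elim_finite_subcover V hVo
    (fun x _ => Set.mem_iUnion.2 ⟨x, hxU x, hkx x⟩)
  obtain ⟨ψ, hψs, hψc⟩ := PartitionOfUnity.exists_isSubordinate_of_locallyFinite_t2space hK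
    (fun i : t => V i) (fun i => hVo _) (locallyFinite_of_finite _) (by
      intro x hx
      obtain ⟨y, hy⟩ := Set.mem_iUnion.1 (ht hx)
      obtain ⟨hyt, hxy⟩ := Set.mem_iUnion.1 hy
      exact Set.mem_iUnion.2 ⟨⟨y, hyt⟩, hxy⟩)
  have hψI : ∀ i y, ψ i y ∈ Set.Icc (0 : ℝ) 1 := fun i y => ⟨ψ.nonneg i y, ψ.le_one i y⟩
  have hs1 : ∀ y, ∑ i, ψ i y ≤ 1 := fun y => by
    have := ψ.sum_le_one y; rwa [finsum_eq_sum_of_fintype] at this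
  refine ⟨t, fun i => ψ i, hψc, hψI, hs1, fun i => (hψs i).trans Set.inter_subset_left,
    norm_le_of_forall hε.le fun y => ?_⟩
  have hsum : (∑ i, bump (ψ i) (hψc i) (k i)) y = ∑ i, (ψ i y : ℂ) • k i y := by
    rw [← evalAddHom_apply, map_sum]; rfl
  have h1 : ∑ i, (ψ i y : ℂ) • k i y - g y =
      ∑ i, (ψ i y : ℂ) • (k i y - g y) - ((1 - ∑ i, ψ i y : ℝ) : ℂ) • g y := by
    simp only [smul_sub, Finset.sum_sub_distrib, ← Finset.sum_smul, Complex.ofReal_sub,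
      Complex.ofReal_one, sub_smul, one_smul, Complex.ofReal_sum]
    abel
  have h2 : ∀ i, ‖(ψ i y : ℂ) • (k i y - g y)‖ ≤ ψ i y * ε := by
    intro i
    rw [norm_smul, Complex.norm_real, Real.norm_of_nonneg (hψI i y).1]
    by_cases hy : ψ i y = 0
    · simp [hy]
    · exact mul_le_mul_of_nonneg_left
        (hψs i (subset_tsupport _ (Function.mem_support.2 hy))).2.le (hψI i y).1
  -- Where the partition does not sum to one, `g` itself is smaller than `ε`.
  have h3 : ‖((1 - ∑ i, ψ i y : ℝ) : ℂ) • g y‖ ≤ (1 - ∑ i, ψ i y) * ε := by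
    rw [norm_smul, Complex.norm_real, Real.norm_of_nonneg (by linarith [hs1 y])]
    by_cases hy : ε ≤ ‖g y‖
    · have := ψ.sum_eq_one (x := y) hy
      rw [finsum_eq_sum_of_fintype] at this
      rw [this]; simp
    · exact mul_le_mul_of_nonneg_left (not_le.1 hy).le (by linarith [hs1 y])
  rw [sub_apply, hsum, h1]
  calc _ ≤ ‖∑ i, (ψ i y : ℂ) • (k i y - g y)‖ + ‖((1 - ∑ i, ψ i y : ℝ) : ℂ) • g y‖ :=
        norm_sub_le _ _
    _ ≤ ∑ i, ψ i y * ε + (1 - ∑ i, ψ i y) * ε :=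
        add_le_add ((norm_sum_le _ _).trans (Finset.sum_le_sum fun i _ => h2 i)) h3
    _ = ε := by rw [← Finset.sum_mul]; ring

/-- A function that is locally approximated by a space of functions that is stable under
multiplication by bump functions is approximated globally. -/
theorem exists_mem_norm_sub_le [NormedSpace ℂ E] [T2Space X] [LocallyCompactSpace X]
    (J : AddSubmonoid C₀(X, E)) (g : C₀(X, E)) {ε : ℝ} (hε : 0 < ε)
    (h : ∀ x, ∃ (k : C(X, E)) (U : Set X), IsOpen U ∧ x ∈ U ∧ ‖k x - g x‖ < ε ∧
      ∀ (ψ : C(X, ℝ)) (hψ : HasCompactSupport ψ), (∀ y, ψ y ∈ Set.Icc (0 : ℝ) 1) →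
        tsupport ψ ⊆ U → bump ψ hψ k ∈ J) :
    ∃ k ∈ J, ‖k - g‖ ≤ ε := by
  choose k U hUo hxU hkx hJ using h
  obtain ⟨t, ψ, hψ, hψI, -, hψU, hk⟩ := exists_sum_bump_norm_sub_le g hε k hUo hxU hkx
  exact ⟨_, J.sum_mem fun i _ => hJ _ _ _ (hψI i) (hψU i), hk⟩

/-- A bump function at a point of an open set. -/
lemma exists_bump [T2Space X] [LocallyCompactSpace X] {U : Set X} (hU : IsOpen U) {x : X}
    (hx : x ∈ U) : ∃ ψ : C(X, ℝ), HasCompactSupport ψ ∧ ψ x = 1 ∧ (∀ y, ψ y ∈ Set.Icc (0 : ℝ) 1) ∧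
      ∀ y, y ∉ U → ψ y = 0 := by
  obtain ⟨ψ, h1, h2, h3, h4⟩ := exists_continuous_one_zero_of_isCompact
    (isCompact_singleton (x := x)) hU.isClosed_compl (by simpa using hx)
  exact ⟨ψ, h3, h1 rfl, h4, fun y hy => h2 hy⟩

lemma isClosedEmbedding_onePointMap {Z : Set X} [T2Space X] [LocallyCompactSpace X]
    (hZ : IsClosed Z) : IsClosedEmbedding (OnePoint.map (Subtype.val : Z → X)) := by
  have := hZ.isClosedEmbedding_subtypeVal
  have : LocallyCompactSpace Z := this.locallyCompactSpace
  refine Continuous.isClosedEmbedding ?_ ?_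
  · refine OnePoint.continuous_map continuous_subtype_val ?_
    rw [Filter.coclosedCompact_eq_cocompact, Filter.coclosedCompact_eq_cocompact]
    exact hZ.isClosedEmbedding_subtypeVal.tendsto_cocompact
  · exact Option.map_injective Subtype.val_injective

/-- The Tietze extension theorem for functions vanishing at infinity. -/
theorem exists_extension [T2Space X] [LocallyCompactSpace X] [NormedSpace ℂ E] [FiniteDimensional ℂ E]
    {Z : Set X} (hZ : IsClosed Z) (f : C₀(Z, E)) : ∃ F : C₀(X, E), ∀ z : Z, F z = f z := by
  have : LocallyCompactSpace Z := hZ.isClosedEmbedding_subtypeVal.locallyCompactSpace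
  -- Extending over the one-point compactification, with value `0` at infinity, makes the extension
  -- vanish at infinity.
  obtain ⟨G, hG⟩ := ContinuousMap.exists_extension (isClosedEmbedding_onePointMap hZ)
    (OnePoint.continuousMapMk f.toContinuousMap 0
      (by rw [Filter.coclosedCompact_eq_cocompact]; exact f.zero_at_infty'))
  have hinf : G OnePoint.infty = 0 := DFunLike.congr_fun hG OnePoint.infty
  refine ⟨⟨⟨fun x => G x, G.continuous.comp OnePoint.continuous_coe⟩, ?_⟩, fun z =>
    DFunLike.congr_fun hG (z : OnePoint Z)⟩
  have := (G.continuous.tendsto OnePoint.infty).comp (OnePoint.tendsto_coe_infty (X := X))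
  rw [hinf, Filter.coclosedCompact_eq_cocompact] at this
  exact this

/-- Functions on two closed sets that agree on the intersection have a common extension. -/
theorem exists_glue [T2Space X] [LocallyCompactSpace X] [NormedSpace ℂ E] [FiniteDimensional ℂ E]
    {Z₁ Z₂ : Set X} (hZ₁ : IsClosed Z₁) (hZ₂ : IsClosed Z₂) (f₁ : C₀(Z₁, E)) (f₂ : C₀(Z₂, E))
    (h : ∀ x (h₁ : x ∈ Z₁) (h₂ : x ∈ Z₂), f₁ ⟨x, h₁⟩ = f₂ ⟨x, h₂⟩) :
    ∃ F : C₀(X, E), (∀ z : Z₁, F z = f₁ z) ∧ ∀ z : Z₂, F z = f₂ z := by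
  classical
  let f : X → E := fun x => if h₁ : x ∈ Z₁ then f₁ ⟨x, h₁⟩ else
    if h₂ : x ∈ Z₂ then f₂ ⟨x, h₂⟩ else 0
  have hf₁ : ∀ x (hx : x ∈ Z₁), f x = f₁ ⟨x, hx⟩ := fun x hx => dif_pos hx
  have hf₂ : ∀ x (hx : x ∈ Z₂), f x = f₂ ⟨x, hx⟩ := fun x hx => by
    by_cases h₁ : x ∈ Z₁
    · rw [hf₁ x h₁, h x h₁ hx]
    · simp [f, h₁, hx]
  have hc₁ : ContinuousOn f Z₁ := by
    rw [continuousOn_iff_continuous_domRestrict]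
    convert map_continuous f₁ using 1
    ext z; exact hf₁ z z.2
  have hc₂ : ContinuousOn f Z₂ := by
    rw [continuousOn_iff_continuous_domRestrict]
    convert map_continuous f₂ using 1
    ext z; exact hf₂ z z.2
  have hc := hc₁.union_of_isClosed hc₂ hZ₁ hZ₂
  rw [continuousOn_iff_continuous_domRestrict] at hc
  have ht : Tendsto ((Z₁ ∪ Z₂).domRestrict f) (cocompact _) (𝓝 0) := by
    refine tendsto_cocompact_zero fun ε hε => ?_
    refine ⟨Set.inclusion Set.subset_union_left '' {x | ε ≤ ‖f₁ x‖} ∪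
      Set.inclusion Set.subset_union_right '' {x | ε ≤ ‖f₂ x‖},
      ((isCompact_le_norm f₁ hε).image (continuous_inclusion _)).union
        ((isCompact_le_norm f₂ hε).image (continuous_inclusion _)), ?_⟩
    rintro ⟨x, hx | hx⟩ hxK
    · by_contra hlt
      exact hxK (Or.inl ⟨⟨x, hx⟩, by simpa [hf₁ x hx] using hlt, rfl⟩)
    · by_contra hlt
      exact hxK (Or.inr ⟨⟨x, hx⟩, by simpa [hf₂ x hx] using hlt, rfl⟩)
  obtain ⟨F, hF⟩ := exists_extension (hZ₁.union hZ₂) ⟨⟨_, hc⟩, ht⟩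
  refine ⟨F, fun z => ?_, fun z => ?_⟩
  · rw [← hf₁ z z.2]; exact hF ⟨z, Or.inl z.2⟩
  · rw [← hf₂ z z.2]; exact hF ⟨z, Or.inr z.2⟩

end General

/-! ### Restriction, evaluation and change of coefficients. -/

section Restrict

variable {X Y E : Type*} [TopologicalSpace X] [TopologicalSpace Y] [NonUnitalCStarAlgebra E]

/-- Composition with a closed embedding. -/
def restr (j : Y → X) (hj : IsClosedEmbedding j) : C₀(X, E) →⋆ₙₐ[ℂ] C₀(Y, E) where
  toFun f := ⟨⟨f ∘ j, (map_continuous f).comp hj.continuous⟩,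
    f.zero_at_infty'.comp hj.tendsto_cocompact⟩
  map_smul' _ _ := rfl
  map_zero' := rfl
  map_add' _ _ := rfl
  map_mul' _ _ := rfl
  map_star' _ := rfl

/-- Evaluation at a point. -/
def evalHom (x : X) : C₀(X, E) →⋆ₙₐ[ℂ] E where
  toFun f := f x
  map_smul' _ _ := rfl
  map_zero' := rfl
  map_add' _ _ := rfl
  map_mul' _ _ := rfl
  map_star' _ := rfl

@[simp] lemma evalHom_apply (x : X) (f : C₀(X, E)) : evalHom x f = f x := rfl

/-- Composition with a *-homomorphism of the coefficients. -/
def mapHom {F : Type*} [NonUnitalCStarAlgebra F] (θ : E →⋆ₙₐ[ℂ] F) :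
    C₀(X, E) →⋆ₙₐ[ℂ] C₀(X, F) where
  toFun f := ⟨⟨θ ∘ f, θ.continuous_of_cstar.comp (map_continuous f)⟩, by
    have := (θ.continuous_of_cstar.tendsto 0).comp f.zero_at_infty'
    rwa [map_zero] at this⟩
  map_smul' c f := by ext x; exact map_smul θ c (f x)
  map_zero' := by ext x; exact map_zero θ
  map_add' f g := by ext x; exact map_add θ (f x) (g x)
  map_mul' f g := by ext x; exact map_mul θ (f x) (g x)
  map_star' f := by ext x; exact map_star θ (f x)

end Restrict

end ZeroAtInftyContinuousMap

/-! ### Matrices -/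

instance Mat.finiteDimensional (n : ℕ) : FiniteDimensional ℂ (Mat n) :=
  inferInstanceAs (FiniteDimensional ℂ (Matrix (Fin n) (Fin n) ℂ))

lemma Matrix.exists_sum_mul_mul_eq_one {n : ℕ} {c : Matrix (Fin n) (Fin n) ℂ} (hc : c ≠ 0) :
    ∃ a b : Fin n → Matrix (Fin n) (Fin n) ℂ, ∑ i, a i * c * b i = 1 := by
  obtain ⟨p, q, hpq⟩ : ∃ p q, c p q ≠ 0 := by
    by_contra! h
    exact hc (Matrix.ext h)
  refine ⟨fun i => Matrix.single i p (c p q)⁻¹, fun i => Matrix.single q i 1, ?_⟩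
  simp only [Matrix.single_mul_mul_single, mul_one, inv_mul_cancel₀ hpq]
  exact Matrix.sum_single_one

/-- `Mₙ` is simple. -/
lemma Mat.exists_sum_mul_mul_eq_one {n : ℕ} {c : Mat n} (hc : c ≠ 0) :
    ∃ a b : Fin n → Mat n, ∑ i, a i * c * b i = 1 :=
  Matrix.exists_sum_mul_mul_eq_one hc

/-! ### Extensions by algebras of matrix-valued functions -/


/-- The algebra `A`, with `φ : A → C₀(X, Mₙ)` and `q : A → P`, is a pullback of `P` and
`C₀(X, Mₙ)` over `C₀(X₀, Mₙ)`: the map `q` is surjective, and `φ` restricts to an isomorphism of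
its kernel onto the functions that vanish on `X₀`. -/
structure IsStep {A P X : Type*} [NonUnitalCStarAlgebra A] [NonUnitalCStarAlgebra P]
    [TopologicalSpace X] {n : ℕ} (X₀ : Set X) (φ : A →⋆ₙₐ[ℂ] C₀(X, Mat n)) (q : A →⋆ₙₐ[ℂ] P) :
    Prop where
  isClosed : IsClosed X₀
  surjective : Function.Surjective q
  map_eq_zero : ∀ a, q a = 0 → ∀ x ∈ X₀, φ a x = 0
  eq_zero : ∀ a, q a = 0 → φ a = 0 → a = 0
  lift : ∀ f : C₀(X, Mat n), (∀ x ∈ X₀, f x = 0) → ∃ a, q a = 0 ∧ φ a = f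

/-- The common zeros of the functions in an ideal. -/
def zeroSet {A X E : Type*} [NonUnitalCStarAlgebra A] [TopologicalSpace X]
    [NonUnitalCStarAlgebra E] (φ : A →⋆ₙₐ[ℂ] C₀(X, E)) (I : TwoSidedIdeal A) : Set X :=
  {x | ∀ j ∈ I, φ j x = 0}

lemma isClosed_zeroSet {A X E : Type*} [NonUnitalCStarAlgebra A] [TopologicalSpace X]
    [NonUnitalCStarAlgebra E] (φ : A →⋆ₙₐ[ℂ] C₀(X, E)) (I : TwoSidedIdeal A) :
    IsClosed (zeroSet φ I) := by
  have : zeroSet φ I = ⋂ j ∈ I, {x | φ j x = 0} := by ext; simp [zeroSet]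
  rw [this]
  exact isClosed_biInter fun j _ => isClosed_eq (map_continuous (φ j)) continuous_const

namespace IsStep

variable {A P X : Type*} [NonUnitalCStarAlgebra A] [NonUnitalCStarAlgebra P]
  [TopologicalSpace X] {n : ℕ} {X₀ : Set X} {φ : A →⋆ₙₐ[ℂ] C₀(X, Mat n)} {q : A →⋆ₙₐ[ℂ] P}

/-- The pair `(φ, q)` is injective, hence isometric. -/
lemma norm_eq (h : IsStep X₀ φ q) {a : A} (ha : q a = 0) : ‖a‖ = ‖φ a‖ := by
  have hinj : Function.Injective (φ.prod q) := by
    rw [injective_iff_map_eq_zero]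
    intro b hb
    exact h.eq_zero b (congrArg Prod.snd hb) (congrArg Prod.fst hb)
  rw [← NonUnitalStarAlgHom.norm_map (φ.prod q) hinj a]
  simp [Prod.norm_def, ha]

lemma exists_lift_bump (h : IsStep X₀ φ q) (ψ : C(X, ℝ)) (hψ : HasCompactSupport ψ)
    (hψ₀ : ∀ x ∈ X₀, ψ x = 0) (c : Mat n) :
    ∃ a, q a = 0 ∧ ∀ x, φ a x = (ψ x : ℂ) • c := by
  obtain ⟨a, ha, hφ⟩ := h.lift (bump ψ hψ (.const X c)) fun x hx => by simp [hψ₀ x hx]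
  exact ⟨a, ha, fun x => by rw [hφ]; rfl⟩

variable [T2Space X] [LocallyCompactSpace X]

lemma surjective_eval (h : IsStep X₀ φ q) {x : X} (hx : x ∉ X₀) :
    Function.Surjective ((evalHom x).comp φ) := by
  intro m
  obtain ⟨χ, hχc, hχx, -, hχ₀⟩ := exists_bump h.isClosed.isOpen_compl hx
  obtain ⟨a, -, ha⟩ := h.exists_lift_bump χ hχc (fun y hy => hχ₀ y (by simpa using hy)) m
  exact ⟨a, by simp [ha, hχx]⟩

/-- The value of an element of an ideal at a point outside `X₀` can be prescribed. -/
lemma exists_mem_apply_eq (h : IsStep X₀ φ q) (I : TwoSidedIdeal A) {x : X} (hx : x ∉ X₀)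
    (hxI : x ∉ zeroSet φ I) (m : Mat n) : ∃ i ∈ I, q i = 0 ∧ φ i x = m := by
  obtain ⟨j, hj, hjx⟩ : ∃ j ∈ I, φ j x ≠ 0 := by simpa [zeroSet] using hxI
  obtain ⟨a, b, hab⟩ := Mat.exists_sum_mul_mul_eq_one hjx
  obtain ⟨χ, hχc, hχx, -, hχ₀⟩ := exists_bump h.isClosed.isOpen_compl hx
  have hχ : ∀ y ∈ X₀, χ y = 0 := fun y hy => hχ₀ y (by simpa using hy)
  -- The coefficients realizing `∑ aᵢ c bᵢ = 1` are multiplied by a bump function supported off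
  -- `X₀`, so that they lift to `ker q`.
  choose α hα hφα using fun i => h.exists_lift_bump χ hχc hχ (a i)
  choose β _ hφβ using fun i => h.exists_lift_bump χ hχc hχ (b i * m)
  refine ⟨∑ i, α i * j * β i, sum_mem fun i _ => I.mul_mem_right _ _ (I.mul_mem_left _ _ hj),
    by simp [map_sum, hα], ?_⟩
  have : φ (∑ i, α i * j * β i) x = ∑ i, a i * φ j x * (b i * m) := by
    rw [map_sum, ← evalAddHom_apply, map_sum]
    simp [hφα, hφβ, hχx]
  rw [this]
  simp_rw [← mul_assoc, ← Finset.sum_mul]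
  rw [hab, one_mul]

/-- On `X₀` and on the zero set the function `φ a` vanishes and is approximated locally by `0`. At
any other point an element of `I ∩ ker q` takes the same value as `a`. A partition of unity patches
these local approximants inside `I`, because multiplication by a bump function off `X₀` is
multiplication by an element of `A`. -/
lemma mem_of_map_eq_zero (h : IsStep X₀ φ q) {I : TwoSidedIdeal A} (hI : IsClosed (I : Set A))
    {a : A} (ha : q a = 0) (haZ : ∀ x ∈ zeroSet φ I, φ a x = 0) : a ∈ I := by
  refine TwoSidedIdeal.mem_of_forall_norm_sub_le hI fun ε hε => ?_
  let J : AddSubmonoid C₀(X, Mat n) :=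
    { carrier := {k | ∃ i ∈ I, q i = 0 ∧ φ i = k}
      zero_mem' := ⟨0, I.zero_mem, map_zero _, map_zero _⟩
      add_mem' := by
        rintro _ _ ⟨i, hi, hqi, rfl⟩ ⟨j, hj, hqj, rfl⟩
        exact ⟨i + j, I.add_mem hi hj, by rw [map_add, hqi, hqj, add_zero], map_add _ _ _⟩ }
  obtain ⟨_, ⟨i, hi, hqi, rfl⟩, hk⟩ := exists_mem_norm_sub_le J (φ a) hε fun x => by
    by_cases hx : x ∈ X₀ ∨ x ∈ zeroSet φ I
    · refine ⟨0, Set.univ, isOpen_univ, trivial, ?_, fun ψ hψ _ _ => ?_⟩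
      · have : φ a x = 0 := hx.elim (h.map_eq_zero a ha x) (haZ x)
        simpa [this] using hε
      · convert J.zero_mem
        ext y
        simp
    · push Not at hx
      obtain ⟨i, hi, hqi, hix⟩ := h.exists_mem_apply_eq I hx.1 hx.2 (φ a x)
      refine ⟨(φ i).toContinuousMap, X₀ᶜ, h.isClosed.isOpen_compl, hx.1, ?_, fun ψ hψ _ hs => ?_⟩
      · change ‖φ i x - _‖ < ε
        rw [hix]; simpa using hε
      · obtain ⟨γ, hγ, hφγ⟩ := h.exists_lift_bump ψ hψ (fun y hy =>
          image_eq_zero_of_notMem_tsupport fun hy' => hs hy' hy) 1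
        refine ⟨γ * i, I.mul_mem_left _ _ hi, by rw [map_mul, hγ, zero_mul], ?_⟩
        ext1 y
        rw [map_mul, mul_apply, hφγ, smul_mul_assoc, one_mul]
        rfl
  refine ⟨i, hi, ?_⟩
  rw [h.norm_eq (by rw [map_sub, ha, hqi, sub_zero]), map_sub]
  exact (norm_sub_rev _ _).trans_le hk

/-- The description of the closed ideals of a pullback. -/
lemma mem_ideal_iff (h : IsStep X₀ φ q) {I : TwoSidedIdeal A} (hI : IsClosed (I : Set A)) (a : A) :
    a ∈ I ↔ (∀ x ∈ zeroSet φ I, φ a x = 0) ∧ q a ∈ I.image q h.surjective := by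
  constructor
  · exact fun ha => ⟨fun x hx => hx a ha, (I.mem_image q _ _).2 ⟨a, ha, rfl⟩⟩
  · rintro ⟨ha, hq⟩
    obtain ⟨j, hj, hqj⟩ := (I.mem_image q _ _).1 hq
    have : a - j ∈ I := h.mem_of_map_eq_zero hI (by rw [map_sub, hqj, sub_self]) fun x hx => by
      rw [map_sub, ZeroAtInftyContinuousMap.sub_apply, ha x hx, hx j hj, sub_zero]
    simpa using I.add_mem this hj

/-- Values on two closed sets, one of them containing `X₀`, can be prescribed: if `a` vanishes
on `X₀ ∩ Z`, then there is a lift of a function on `Z` that agrees with `a` there. -/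
lemma exists_lift_eqOn (h : IsStep X₀ φ q) {Z : Set X} (hZ : IsClosed Z) (f : C₀(Z, Mat n))
    (hf : ∀ x (hx : x ∈ Z), x ∈ X₀ → f ⟨x, hx⟩ = 0) :
    ∃ a, q a = 0 ∧ ∀ z : Z, φ a z = f z := by
  obtain ⟨F, hF, hF₀⟩ := exists_glue hZ h.isClosed f 0 (fun x h₁ h₂ => hf x h₁ h₂)
  obtain ⟨a, ha, hφ⟩ := h.lift F (fun x hx => hF₀ ⟨x, hx⟩)
  exact ⟨a, ha, fun z => by rw [hφ, hF]⟩

end IsStep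

/-! ### Covering dimension -/

lemma HasCoveringDimLE.of_isClosedEmbedding {X Y : Type*} [TopologicalSpace X] [TopologicalSpace Y]
    {d : WithBot ℕ∞} (h : HasCoveringDimLE X d) {f : Y → X} (hf : IsClosedEmbedding f) :
    HasCoveringDimLE Y d := by
  intro 𝒰 hfin ho hcov
  have hex : ∀ U : Set Y, ∃ V : Set X, U ∈ 𝒰 → IsOpen V ∧ f ⁻¹' V = U := fun U => by
    by_cases hU : U ∈ 𝒰
    · obtain ⟨V, hV, hVU⟩ := hf.isInducing.isOpen_iff.1 (ho U hU)
      exact ⟨V, fun _ => ⟨hV, hVU⟩⟩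
    · exact ⟨∅, fun h => absurd h hU⟩
  choose g hg using hex
  obtain ⟨𝒱, hfin', ho', hcov', href, hord⟩ := h (insert (Set.range f)ᶜ (g '' 𝒰))
    ((hfin.image g).insert _)
    (by
      rintro _ (rfl | ⟨U, hU, rfl⟩)
      · exact hf.isClosed_range.isOpen_compl
      · exact (hg U hU).1)
    (by
      refine Set.eq_univ_of_forall fun x => ?_
      by_cases hx : x ∈ Set.range f
      · obtain ⟨y, rfl⟩ := hx
        obtain ⟨U, hU, hy⟩ := (Set.ext_iff.1 hcov y).2 trivial
        refine ⟨g U, Or.inr ⟨U, hU, rfl⟩, ?_⟩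
        rw [← (hg U hU).2] at hy
        exact hy
      · exact ⟨_, Or.inl rfl, hx⟩)
  -- Members of `𝒱` inside the complement of the range pull back to `∅`, which need not lie in any
  -- member of `𝒰`, for instance if `𝒰` is empty.
  refine ⟨(f ⁻¹' ·) '' 𝒱 \ {∅}, (hfin'.image _).sdiff, ?_, ?_, ?_, fun y => ?_⟩
  · rintro _ ⟨⟨V, hV, rfl⟩, -⟩
    exact (ho' V hV).preimage hf.continuous
  · refine Set.eq_univ_of_forall fun y => ?_
    obtain ⟨V, hV, hy⟩ := (Set.ext_iff.1 hcov' (f y)).2 trivial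
    exact ⟨f ⁻¹' V, ⟨⟨V, hV, rfl⟩, fun h => by
      rw [Set.mem_singleton_iff] at h; exact (h ▸ (show y ∈ f ⁻¹' V from hy) : y ∈ (∅ : Set Y))⟩, hy⟩
  · rintro _ ⟨⟨V, hV, rfl⟩, hne⟩
    obtain ⟨W, hW | ⟨U, hU, rfl⟩, hVW⟩ := href V hV
    · exfalso
      refine hne (Set.eq_empty_of_forall_notMem fun y hy => ?_)
      exact (hW ▸ hVW hy : f y ∈ (Set.range f)ᶜ) ⟨y, rfl⟩
    · exact ⟨U, hU, fun y hy => by rw [← (hg U hU).2]; exact hVW hy⟩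
  · refine le_trans ?_ (hord (f y))
    rw [WithBot.coe_le_coe]
    refine le_trans (Set.encard_le_encard ?_) (Set.encard_image_le (f ⁻¹' ·) _)
    rintro _ ⟨⟨⟨V, hV, rfl⟩, -⟩, hy⟩
    exact ⟨V, ⟨hV, hy⟩, rfl⟩

lemma HasCoveringDimLE.of_isEmpty {X : Type*} [TopologicalSpace X] [IsEmpty X] (d : WithBot ℕ∞) :
    HasCoveringDimLE X d := fun _ _ _ _ =>
  ⟨∅, Set.finite_empty, by simp, Subsingleton.elim _ _, by simp, fun x => isEmptyElim x⟩

lemma HasCoveringDimLE.sum {X Y : Type*} [TopologicalSpace X] [TopologicalSpace Y]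
    {d : WithBot ℕ∞} (hX : HasCoveringDimLE X d) (hY : HasCoveringDimLE Y d) :
    HasCoveringDimLE (X ⊕ Y) d := by
  intro 𝒰 hfin ho hcov
  obtain ⟨𝒱, hf₁, ho₁, hc₁, hr₁, hd₁⟩ := hX ((Sum.inl ⁻¹' ·) '' 𝒰) (hfin.image _)
    (by rintro _ ⟨U, hU, rfl⟩; exact (ho U hU).preimage continuous_inl)
    (by
      refine Set.eq_univ_of_forall fun x => ?_
      obtain ⟨U, hU, hx⟩ := (Set.ext_iff.1 hcov (Sum.inl x)).2 trivial
      exact ⟨_, ⟨U, hU, rfl⟩, hx⟩)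
  obtain ⟨𝒲, hf₂, ho₂, hc₂, hr₂, hd₂⟩ := hY ((Sum.inr ⁻¹' ·) '' 𝒰) (hfin.image _)
    (by rintro _ ⟨U, hU, rfl⟩; exact (ho U hU).preimage continuous_inr)
    (by
      refine Set.eq_univ_of_forall fun x => ?_
      obtain ⟨U, hU, hx⟩ := (Set.ext_iff.1 hcov (Sum.inr x)).2 trivial
      exact ⟨_, ⟨U, hU, rfl⟩, hx⟩)
  refine ⟨(Sum.inl '' ·) '' 𝒱 ∪ (Sum.inr '' ·) '' 𝒲, (hf₁.image _).union (hf₂.image _), ?_, ?_, ?_,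
    ?_⟩
  · rintro _ (⟨V, hV, rfl⟩ | ⟨V, hV, rfl⟩)
    · exact isOpenMap_inl _ (ho₁ V hV)
    · exact isOpenMap_inr _ (ho₂ V hV)
  · refine Set.eq_univ_of_forall fun z => ?_
    rcases z with x | y
    · obtain ⟨V, hV, hx⟩ := (Set.ext_iff.1 hc₁ x).2 trivial
      exact ⟨_, Or.inl ⟨V, hV, rfl⟩, ⟨x, hx, rfl⟩⟩
    · obtain ⟨V, hV, hy⟩ := (Set.ext_iff.1 hc₂ y).2 trivial
      exact ⟨_, Or.inr ⟨V, hV, rfl⟩, ⟨y, hy, rfl⟩⟩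
  · rintro _ (⟨V, hV, rfl⟩ | ⟨V, hV, rfl⟩)
    · obtain ⟨_, ⟨U, hU, rfl⟩, hVU⟩ := hr₁ V hV
      exact ⟨U, hU, Set.image_subset_iff.2 hVU⟩
    · obtain ⟨_, ⟨U, hU, rfl⟩, hVU⟩ := hr₂ V hV
      exact ⟨U, hU, Set.image_subset_iff.2 hVU⟩
  · rintro (x | y)
    · refine le_trans ?_ (hd₁ x)
      rw [WithBot.coe_le_coe]
      refine le_trans (Set.encard_le_encard ?_) (Set.encard_image_le (Sum.inl '' ·) _)
      rintro _ ⟨⟨V, hV, rfl⟩ | ⟨V, hV, rfl⟩, hx⟩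
      · exact ⟨V, ⟨hV, by simpa using hx⟩, rfl⟩
      · simp at hx
    · refine le_trans ?_ (hd₂ y)
      rw [WithBot.coe_le_coe]
      refine le_trans (Set.encard_le_encard ?_) (Set.encard_image_le (Sum.inr '' ·) _)
      rintro _ ⟨⟨V, hV, rfl⟩ | ⟨V, hV, rfl⟩, hy⟩
      · simp at hy
      · exact ⟨V, ⟨hV, by simpa using hy⟩, rfl⟩

lemma hasCoveringDimLE_top (X : Type*) [TopologicalSpace X] : HasCoveringDimLE X ⊤ :=
  fun 𝒰 hf ho hc => ⟨𝒰, hf, ho, hc, fun V hV => ⟨V, hV, subset_rfl⟩, fun _ => le_top⟩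

namespace RSHZeroDecomposition

/-- All the base spaces have covering dimension at most `d`. -/
def DimLE (d : WithBot ℕ∞) :
    {A : Type u} → [NonUnitalCStarAlgebra A] → RSHZeroDecomposition A → Prop
  | _, _, base X .. => HasCoveringDimLE X d
  | _, _, step D X .. => D.DimLE d ∧ HasCoveringDimLE X d

/-- Each base space is closed in the disjoint union, and dimension bounds pass to closed subspaces
and to sums. The recursive form suits the inductions. -/
lemma dimLE_iff (d : WithBot ℕ∞) {A : Type u} [NonUnitalCStarAlgebra A]
    (D : RSHZeroDecomposition A) : D.DimLE d ↔ HasCoveringDimLE D.totalSpace d := by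
  induction D with
  | base X n hn e => exact Iff.rfl
  | step D X X₀ hX₀ n hn ρ e ih =>
    change D.DimLE d ∧ HasCoveringDimLE X d ↔ HasCoveringDimLE (D.totalSpace ⊕ X) d
    rw [ih]
    exact ⟨fun h => h.1.sum h.2, fun h => ⟨h.of_isClosedEmbedding .inl, h.of_isClosedEmbedding .inr⟩⟩

/-- The infimum defining the dimension is attained, since `WithBot ℕ∞` is well ordered. -/
lemma dimLE_topDim {A : Type u} [NonUnitalCStarAlgebra A] (D : RSHZeroDecomposition A) :
    D.DimLE D.topDim := by
  rw [dimLE_iff]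
  exact csInf_mem (s := {d | HasCoveringDimLE D.totalSpace d}) ⟨⊤, hasCoveringDimLE_top _⟩

lemma topDim_le {A : Type u} [NonUnitalCStarAlgebra A] {D : RSHZeroDecomposition A}
    {d : WithBot ℕ∞} (h : D.DimLE d) : D.topDim ≤ d :=
  sInf_le ((dimLE_iff d D).1 h)

end RSHZeroDecomposition

/-! ### Recursive subhomogeneous algebras, without the gluing maps -/

/-- `A` is an iterated pullback with base spaces of covering dimension at most `d`. -/
inductive RSHDim (d : WithBot ℕ∞) : (A : Type u) → [NonUnitalCStarAlgebra A] → Prop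
  | zero (A : Type u) [NonUnitalCStarAlgebra A] (h : Subsingleton A) : RSHDim d A
  | step {A P X : Type u} [NonUnitalCStarAlgebra A] [NonUnitalCStarAlgebra P]
      [TopologicalSpace X] [T2Space X] [LocallyCompactSpace X] {n : ℕ} (hn : 0 < n) {X₀ : Set X}
      {φ : A →⋆ₙₐ[ℂ] C₀(X, Mat n)} {q : A →⋆ₙₐ[ℂ] P} (hX : HasCoveringDimLE X d)
      (hs : IsStep X₀ φ q) (hP : RSHDim d P) : RSHDim d A

/-- This turns the base case of a decomposition into a step over the zero algebra, so that
inductions start there. -/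
lemma isStep_zero {A P X : Type*} [NonUnitalCStarAlgebra A] [NonUnitalCStarAlgebra P]
    [Subsingleton P] [TopologicalSpace X] {n : ℕ} (e : A ≃⋆ₐ[ℂ] C₀(X, Mat n)) :
    IsStep ∅ (e : A →⋆ₙₐ[ℂ] C₀(X, Mat n)) (0 : A →⋆ₙₐ[ℂ] P) where
  isClosed := isClosed_empty
  surjective p := ⟨0, Subsingleton.elim _ _⟩
  map_eq_zero := by simp
  eq_zero a _ ha := e.injective (by rw [map_zero]; exact ha)
  lift f _ := ⟨e.symm f, rfl, e.apply_symm_apply f⟩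

/-- The first component of a restriction pullback. -/
def pullbackFst {A P X : Type u} [NonUnitalCStarAlgebra A] [NonUnitalCStarAlgebra P]
    [TopologicalSpace X] {X₀ : Set X} {n : ℕ} {ρ : P →⋆ₙₐ[ℂ] C₀(X₀, Mat n)}
    (e : A ≃⋆ₐ[ℂ] restrictionPullback X₀ n ρ) : A →⋆ₙₐ[ℂ] C₀(X, Mat n) :=
  ((NonUnitalStarAlgHom.fst ℂ C₀(X, Mat n) P).comp
    (NonUnitalStarSubalgebraClass.subtype (restrictionPullback X₀ n ρ))).comp
      (e : A →⋆ₙₐ[ℂ] restrictionPullback X₀ n ρ)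

/-- The second component of a restriction pullback. -/
def pullbackSnd {A P X : Type u} [NonUnitalCStarAlgebra A] [NonUnitalCStarAlgebra P]
    [TopologicalSpace X] {X₀ : Set X} {n : ℕ} {ρ : P →⋆ₙₐ[ℂ] C₀(X₀, Mat n)}
    (e : A ≃⋆ₐ[ℂ] restrictionPullback X₀ n ρ) : A →⋆ₙₐ[ℂ] P :=
  ((NonUnitalStarAlgHom.snd ℂ C₀(X, Mat n) P).comp
    (NonUnitalStarSubalgebraClass.subtype (restrictionPullback X₀ n ρ))).comp
      (e : A →⋆ₙₐ[ℂ] restrictionPullback X₀ n ρ)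

/-! ### Correspondence between pullbacks and `IsStep`. -/

section Pullback

variable {A P X : Type u} [NonUnitalCStarAlgebra A] [NonUnitalCStarAlgebra P]
  [TopologicalSpace X] {X₀ : Set X} {n : ℕ} {ρ : P →⋆ₙₐ[ℂ] C₀(X₀, Mat n)}
  (e : A ≃⋆ₐ[ℂ] restrictionPullback X₀ n ρ)

lemma pullbackFst_apply (a : A) : pullbackFst e a = (e a).1.1 := rfl

lemma pullbackSnd_apply (a : A) : pullbackSnd e a = (e a).1.2 := rfl

lemma pullback_compat (a : A) (x : X₀) : pullbackFst e a x = ρ (pullbackSnd e a) x := (e a).2 x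

lemma exists_pullback_eq {f : C₀(X, Mat n)} {p : P} (h : ∀ x : X₀, f x = ρ p x) :
    ∃ a, pullbackFst e a = f ∧ pullbackSnd e a = p :=
  ⟨e.symm ⟨(f, p), h⟩, by rw [pullbackFst_apply, e.apply_symm_apply],
    by rw [pullbackSnd_apply, e.apply_symm_apply]⟩

lemma isStep_pullback [T2Space X] [LocallyCompactSpace X] (hX₀ : IsClosed X₀) :
    IsStep X₀ (pullbackFst e) (pullbackSnd e) where
  isClosed := hX₀
  surjective p := by
    obtain ⟨F, hF⟩ := exists_extension hX₀ (ρ p)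
    obtain ⟨a, -, ha⟩ := exists_pullback_eq e hF
    exact ⟨a, ha⟩
  map_eq_zero a ha x hx := by
    have := pullback_compat e a ⟨x, hx⟩
    rwa [ha, map_zero] at this
  eq_zero a ha ha' := e.injective (Subtype.ext (Prod.ext (by
    rw [map_zero]; exact ha') (by rw [map_zero]; exact ha)))
  lift f hf := by
    obtain ⟨a, ha, hq⟩ := exists_pullback_eq e (f := f) (p := 0) fun x => by
      rw [map_zero]; exact hf x x.2
    exact ⟨a, hq, ha⟩

end Pullback

/-- The restriction of `φ a` to `X₀` depends only on `q a`, which defines the gluing map. To hit a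
pair `(g, p)`, lift `p` to `a` and add the element of `ker q` that corresponds to `g - φ a`. -/
lemma IsStep.exists_pullback {A P X : Type u} [NonUnitalCStarAlgebra A] [NonUnitalCStarAlgebra P]
    [TopologicalSpace X] {n : ℕ} {X₀ : Set X} {φ : A →⋆ₙₐ[ℂ] C₀(X, Mat n)} {q : A →⋆ₙₐ[ℂ] P}
    (h : IsStep X₀ φ q) :
    ∃ (ρ : P →⋆ₙₐ[ℂ] C₀(X₀, Mat n)) (e : A ≃⋆ₐ[ℂ] restrictionPullback X₀ n ρ),
      pullbackFst e = φ ∧ pullbackSnd e = q := by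
  obtain ⟨ρ, hρ⟩ := NonUnitalStarAlgHom.exists_factor q h.surjective
    ((restr _ h.isClosed.isClosedEmbedding_subtypeVal).comp φ)
    (fun a ha => by ext1 x; exact h.map_eq_zero a ha x x.2)
  have hρ' : ∀ a (x : X₀), ρ (q a) x = φ a x := fun a x => by rw [hρ]; rfl
  let f : A →⋆ₙₐ[ℂ] restrictionPullback X₀ n ρ :=
    NonUnitalStarAlgHom.codRestrict (φ.prod q) (restrictionPullback X₀ n ρ)
      fun a x => (hρ' a x).symm
  have hf : Function.Bijective f := by
    constructor
    · rw [injective_iff_map_eq_zero]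
      intro a ha
      have := congrArg Subtype.val ha
      exact h.eq_zero a (congrArg Prod.snd this) (congrArg Prod.fst this)
    · rintro ⟨⟨g, p⟩, hgp⟩
      obtain ⟨a, rfl⟩ := h.surjective p
      obtain ⟨b, hb, hφb⟩ := h.lift (g - φ a) fun x hx => by
        have : g x = ρ (q a) ⟨x, hx⟩ := hgp ⟨x, hx⟩
        rw [ZeroAtInftyContinuousMap.sub_apply, this, hρ', sub_self]
      refine ⟨a + b, Subtype.ext (Prod.ext ?_ ?_)⟩
      · change φ (a + b) = g
        rw [map_add, hφb, add_sub_cancel]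
      · change q (a + b) = q a
        rw [map_add, hb, add_zero]
  exact ⟨ρ, StarAlgEquiv.ofBijective f hf, rfl, rfl⟩

lemma nonempty_starAlgEquiv_of_subsingleton (A B : Type*) [NonUnitalCStarAlgebra A]
    [NonUnitalCStarAlgebra B] [Subsingleton A] [Subsingleton B] : Nonempty (A ≃⋆ₐ[ℂ] B) :=
  ⟨StarAlgEquiv.ofBijective (0 : A →⋆ₙₐ[ℂ] B)
    ⟨fun _ _ _ => Subsingleton.elim _ _, fun _ => ⟨0, Subsingleton.elim _ _⟩⟩⟩

/-- The base space of the zero algebra. -/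
instance subsingleton_zeroAlgebra (n : ℕ) : Subsingleton C₀(PEmpty.{u + 1}, Mat n) :=
  ⟨fun f g => ZeroAtInftyContinuousMap.eq_of_empty f g⟩

namespace RSHDim

variable {d : WithBot ℕ∞}

lemma of_decomposition {A : Type u} [NonUnitalCStarAlgebra A] (D : RSHZeroDecomposition A)
    (h : D.DimLE d) : RSHDim d A := by
  induction D with
  | base X n hn e =>
    exact .step hn h (isStep_zero (P := C₀(PEmpty.{u + 1}, Mat 1)) e) (.zero _ inferInstance)
  | step D X X₀ hX₀ n hn ρ e ih => exact .step hn h.2 (isStep_pullback e hX₀) (ih h.1)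

lemma exists_decomposition {A : Type u} [NonUnitalCStarAlgebra A] (h : RSHDim d A) :
    ∃ D : RSHZeroDecomposition A, D.DimLE d := by
  induction h with
  | zero A h =>
    obtain ⟨e⟩ := nonempty_starAlgEquiv_of_subsingleton A C₀(PEmpty.{u + 1}, Mat 1)
    exact ⟨.base PEmpty.{u + 1} 1 one_pos e, HasCoveringDimLE.of_isEmpty d⟩
  | step hn hX hs _ ih =>
    obtain ⟨D, hD⟩ := ih
    obtain ⟨ρ, e, -, -⟩ := hs.exists_pullback
    exact ⟨.step D _ _ hs.isClosed _ hn ρ e, hD, hX⟩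

end RSHDim

/-- The image factorization of a *-homomorphism. -/
lemma NonUnitalStarAlgHom.exists_image {A : Type*} {D : Type u} [NonUnitalCStarAlgebra A]
    [NonUnitalCStarAlgebra D] (Θ : A →⋆ₙₐ[ℂ] D) :
    ∃ (R : Type u) (_ : NonUnitalCStarAlgebra R) (π : A →⋆ₙₐ[ℂ] R) (ι : R →⋆ₙₐ[ℂ] D),
      Function.Surjective π ∧ Function.Injective ι ∧ ∀ a, ι (π a) = Θ a := by
  have hR : IsClosed (NonUnitalStarAlgHom.range Θ : Set D) := by
    convert Θ.isClosed_range
    exact NonUnitalStarAlgHom.coe_range Θ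
  refine ⟨NonUnitalStarAlgHom.range Θ, inferInstance, NonUnitalStarAlgHom.rangeRestrict Θ,
    NonUnitalStarSubalgebraClass.subtype _, ?_, Subtype.val_injective, fun a => rfl⟩
  rintro ⟨_, a, rfl⟩
  exact ⟨a, rfl⟩

/-- The image of a pair of *-homomorphisms. -/
lemma NonUnitalStarAlgHom.exists_image_prod {A B C : Type u} [NonUnitalCStarAlgebra A]
    [NonUnitalCStarAlgebra B] [NonUnitalCStarAlgebra C] (f : A →⋆ₙₐ[ℂ] B) (g : A →⋆ₙₐ[ℂ] C) :
    ∃ (R : Type u) (_ : NonUnitalCStarAlgebra R) (π : A →⋆ₙₐ[ℂ] R) (β : R →⋆ₙₐ[ℂ] B)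
      (γ : R →⋆ₙₐ[ℂ] C), Function.Surjective π ∧ (∀ a, β (π a) = f a) ∧ (∀ a, γ (π a) = g a) ∧
        ∀ a, f a = 0 → g a = 0 → π a = 0 := by
  obtain ⟨R, _, π, ι, hπ, hι, h⟩ := NonUnitalStarAlgHom.exists_image (D := B × C) (f.prod g)
  refine ⟨R, inferInstance, π, (NonUnitalStarAlgHom.fst ℂ B C).comp ι,
    (NonUnitalStarAlgHom.snd ℂ B C).comp ι, hπ, fun a => congrArg Prod.fst (h a),
    fun a => congrArg Prod.snd (h a), fun a hf hg => hι ?_⟩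
  rw [h, map_zero]
  exact Prod.ext hf hg

/-! ### Ideals, quotients and finite-dimensional representations. -/

namespace RSHDim

variable {d : WithBot ℕ∞}

/-- `I` is an extension of `q(I)`, and `I ∩ ker q` consists of the functions vanishing on `X₀ ∪
zeroSet φ I`. The base space is unchanged. -/
lemma ideal {A : Type u} [NonUnitalCStarAlgebra A] (h : RSHDim d A) (I : TwoSidedIdeal A)
    (hI : IsClosed (I : Set A)) [hJ : IsClosed (I.toStarSubalgebra hI : Set A)] :
    RSHDim d (I.toStarSubalgebra hI) := by
  induction h with
  | zero A h => exact .zero _ ⟨fun a b => Subtype.ext (h.elim _ _)⟩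
  | @step A P X _ _ _ _ _ n hn X₀ φ q hX hs hP ih =>
    have hI' := I.isClosed_image hI q hs.surjective
    have : IsClosed ((I.image q hs.surjective).toStarSubalgebra hI' : Set P) := hI'
    let ι := NonUnitalStarSubalgebraClass.subtype (I.toStarSubalgebra hI)
    let q' : I.toStarSubalgebra hI →⋆ₙₐ[ℂ] (I.image q hs.surjective).toStarSubalgebra hI' :=
      NonUnitalStarAlgHom.codRestrict (q.comp ι) _
        fun a => (I.mem_image q _ _).2 ⟨a, a.2, rfl⟩
    have hq' : ∀ a, q' a = 0 → q a = 0 := fun a ha => congrArg Subtype.val ha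
    refine .step hn (X₀ := X₀ ∪ zeroSet φ I) (φ := φ.comp ι) (q := q') hX ⟨hs.isClosed.union
      (isClosed_zeroSet φ I), ?_, ?_, ?_, ?_⟩ (ih _ hI')
    · rintro ⟨p, hp⟩
      obtain ⟨a, ha, hqa⟩ := (I.mem_image q _ _).1 hp
      exact ⟨⟨a, ha⟩, Subtype.ext hqa⟩
    · rintro a ha x (hx | hx)
      · exact hs.map_eq_zero a (hq' a ha) x hx
      · exact hx a a.2
    · exact fun a ha hφ => Subtype.ext (hs.eq_zero a (hq' a ha) hφ)
    · intro f hf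
      obtain ⟨a, ha, hφ⟩ := hs.lift f fun x hx => hf x (Or.inl hx)
      have haI : a ∈ I := hs.mem_of_map_eq_zero hI ha fun x hx => by
        rw [hφ]; exact hf x (Or.inr hx)
      exact ⟨⟨a, haI⟩, Subtype.ext ha, hφ⟩

/-- With `Z = zeroSet φ I`, the quotient is realized as the image of `A` in `C₀(Z, Mₙ) × P/q(I)`; by
`IsStep.mem_ideal_iff` the kernel is exactly `I`. -/
lemma exists_quotient {A : Type u} [NonUnitalCStarAlgebra A] (h : RSHDim d A)
    (I : TwoSidedIdeal A) (hI : IsClosed (I : Set A)) :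
    ∃ (B : Type u) (_ : NonUnitalCStarAlgebra B) (π : A →⋆ₙₐ[ℂ] B),
      Function.Surjective π ∧ (∀ a : A, π a = 0 ↔ a ∈ I) ∧ RSHDim d B := by
  induction h with
  | zero A h =>
    refine ⟨A, inferInstance, NonUnitalStarAlgHom.id ℂ A, fun a => ⟨a, rfl⟩, fun a => ?_,
      .zero _ h⟩
    exact ⟨fun _ => h.elim 0 a ▸ I.zero_mem, fun _ => h.elim _ _⟩
  | @step A P X _ _ _ _ _ n hn X₀ φ q hX hs hP ih =>
    obtain ⟨B, _, π, hπ, hπI, hB⟩ := ih _ (I.isClosed_image hI q hs.surjective)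
    let Z := zeroSet φ I
    have hZ : IsClosed Z := isClosed_zeroSet φ I
    have hj := hZ.isClosedEmbedding_subtypeVal
    have : LocallyCompactSpace Z := hj.locallyCompactSpace
    obtain ⟨R, _, r, β, γ, hr, hβ, hγ, hr₀⟩ := NonUnitalStarAlgHom.exists_image_prod
      ((restr Subtype.val hj).comp φ) (π.comp q)
    have hβ' : ∀ a (x : Z), β (r a) x = φ a x := fun a x => by rw [hβ]; rfl
    have hγ' : ∀ a, γ (r a) = π (q a) := hγ
    refine ⟨R, inferInstance, r, hr, fun a => ?_, .step hn (X := Z) (X₀ := Subtype.val ⁻¹' X₀)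
      (φ := β) (q := γ) (hX.of_isClosedEmbedding hj)
      ⟨hs.isClosed.preimage continuous_subtype_val, ?_, ?_, ?_, ?_⟩ hB⟩
    · rw [hs.mem_ideal_iff hI, ← hπI]
      constructor
      · intro h
        refine ⟨fun x hx => ?_, ?_⟩
        · rw [← hβ' a ⟨x, hx⟩, h, map_zero]; rfl
        · rw [← hγ', h, map_zero]
      · exact fun h => hr₀ a (ZeroAtInftyContinuousMap.ext fun x => h.1 x x.2) h.2
    · intro b
      obtain ⟨p, rfl⟩ := hπ b
      obtain ⟨a, rfl⟩ := hs.surjective p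
      exact ⟨r a, hγ' a⟩
    · intro b ha x hx
      obtain ⟨a, rfl⟩ := hr b
      rw [hγ', hπI] at ha
      obtain ⟨j, hj, hja⟩ := (I.mem_image q _ _).1 ha
      rw [hβ']
      have := hs.map_eq_zero (a - j) (by rw [map_sub, hja, sub_self]) x hx
      rwa [map_sub, ZeroAtInftyContinuousMap.sub_apply, x.2 j hj, sub_zero] at this
    · intro b hb hf
      obtain ⟨a, rfl⟩ := hr b
      exact hr₀ a (by rw [← hβ, hf]) (by rw [← hγ, hb])
    · intro f hf
      obtain ⟨a, ha, hφ⟩ := hs.exists_lift_eqOn hZ f fun x hx hx₀ => hf ⟨x, hx⟩ hx₀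
      refine ⟨r a, by rw [hγ', ha, map_zero], ZeroAtInftyContinuousMap.ext fun x => ?_⟩
      rw [hβ', hφ]

/-- The finite-dimensional irreducible representations of an RSH₀-algebra separate the closed
ideals from the points outside. -/
lemma exists_rep_of_notMem {A : Type u} [NonUnitalCStarAlgebra A] (h : RSHDim d A)
    (I : TwoSidedIdeal A) (hI : IsClosed (I : Set A)) {a : A} (ha : a ∉ I) :
    ∃ n, 0 < n ∧ ∃ τ : A →⋆ₙₐ[ℂ] Mat n, Function.Surjective τ ∧ (∀ j ∈ I, τ j = 0) ∧ τ a ≠ 0 := by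
  induction h with
  | zero A h => exact absurd (h.elim 0 a ▸ I.zero_mem) ha
  | @step A P X _ _ _ _ _ n hn X₀ φ q hX hs hP ih =>
    have hcase : q a ∉ I.image q hs.surjective → ∃ n, 0 < n ∧ ∃ τ : A →⋆ₙₐ[ℂ] Mat n,
        Function.Surjective τ ∧ (∀ j ∈ I, τ j = 0) ∧ τ a ≠ 0 := fun hqa => by
      obtain ⟨m, hm, τ, hτ, hτI, hτa⟩ := ih _ (I.isClosed_image hI q hs.surjective) hqa
      exact ⟨m, hm, τ.comp q, hτ.comp hs.surjective,
        fun j hj => hτI _ ((I.mem_image q _ _).2 ⟨j, hj, rfl⟩), hτa⟩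
    rw [hs.mem_ideal_iff hI, not_and_or] at ha
    rcases ha with ha | ha
    · push Not at ha
      obtain ⟨x, hxZ, hx⟩ := ha
      by_cases hx₀ : x ∈ X₀
      -- At a point of `X₀` the value of `a` depends only on `q a`; if `q a` were in `q(I)`, then
      -- `a` would take there the value of an element of `I`, namely zero.
      · refine hcase fun hqa => hx ?_
        obtain ⟨j, hj, hja⟩ := (I.mem_image q _ _).1 hqa
        have := hs.map_eq_zero (a - j) (by rw [map_sub, hja, sub_self]) x hx₀
        rwa [map_sub, ZeroAtInftyContinuousMap.sub_apply, hxZ j hj, sub_zero] at this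
      · exact ⟨n, hn, (evalHom x).comp φ, hs.surjective_eval hx₀, fun j hj => hxZ j hj, hx⟩
    · exact hcase ha

end RSHDim

/-! ### Compactness of the spectrum -/

/-- `Mₙ` acts irreducibly on an `n`-dimensional Hilbert space. -/
lemma exists_surjective_hom_continuousLinearMap (n : ℕ) :
    ∃ θ : Mat n →⋆ₙₐ[ℂ] (EuclideanSpace ℂ (ULift.{u} (Fin n)) →L[ℂ]
      EuclideanSpace ℂ (ULift.{u} (Fin n))), Function.Bijective θ := by
  let e := ((CStarMatrix.reindexₐ ℂ ℂ (Equiv.ulift.{u, 0} (α := Fin n)).symm).trans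
    CStarMatrix.ofMatrixStarAlgEquiv.symm).trans
    ((Matrix.toEuclideanCLM (n := ULift.{u} (Fin n)) (𝕜 := ℂ)))
  exact ⟨(e : _ →⋆ₙₐ[ℂ] _), e.bijective⟩

/-- Compose with the action of `Mₙ` on `ℂⁿ`: rank-one operators move a nonzero vector to any other.
Norms are preserved because this action is faithful. -/
lemma exists_irreducibleRep {A : Type u} [NonUnitalCStarAlgebra A] {n : ℕ} (hn : 0 < n)
    (τ : A →⋆ₙₐ[ℂ] Mat n) (hτ : Function.Surjective τ) :
    ∃ σ : IrreducibleRep A, ∀ a, ‖σ.π a‖ = ‖τ a‖ := by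
  obtain ⟨θ, hθ⟩ := exists_surjective_hom_continuousLinearMap.{u} n
  have hsurj : Function.Surjective (θ.comp τ) := hθ.2.comp hτ
  have : NeZero n := ⟨hn.ne'⟩
  let v : EuclideanSpace ℂ (ULift.{u} (Fin n)) := EuclideanSpace.single ⟨0⟩ 1
  have hv : v ≠ 0 := by simp [v]
  refine ⟨⟨EuclideanSpace ℂ (ULift.{u} (Fin n)), θ.comp τ, ?_, ?_⟩, fun a => NonUnitalStarAlgHom.norm_map θ hθ.1 (τ a)⟩
  · intro h
    obtain ⟨a, ha⟩ := hsurj 1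
    rw [h] at ha
    have := congrArg (fun T => T v) ha
    exact hv this.symm
  · intro K _ hK
    by_cases hK0 : K = ⊥
    · exact Or.inl hK0
    · right
      obtain ⟨x, hx, hx0⟩ := K.ne_bot_iff.1 hK0
      refine (Submodule.eq_top_iff').2 fun y => ?_
      obtain ⟨a, ha⟩ := hsurj ((innerSL ℂ x).smulRight ((inner ℂ x x)⁻¹ • y))
      have hne : inner ℂ x x ≠ (0 : ℂ) := inner_self_ne_zero.2 hx0
      have e : (innerSL ℂ x).smulRight ((inner ℂ x x)⁻¹ • y) x = y := by
        rw [ContinuousLinearMap.smulRight_apply, innerSL_apply_apply, smul_smul,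
          mul_inv_cancel₀ hne, one_smul]
      have := hK a x hx
      rwa [ha, e] at this

/-- The function `t ↦ max (|t| - 1) 0` detects elements of norm more than `1`. -/
lemma cfcₙ_max_abs_sub_one_eq_zero_iff {A : Type*} [NonUnitalCStarAlgebra A] {b : A}
    (hb : IsSelfAdjoint b) : cfcₙ (fun t : ℝ => max (|t| - 1) 0) b = 0 ↔ ‖b‖ ≤ 1 := by
  have h0 : max (|(0 : ℝ)| - 1) 0 = 0 := by simp
  constructor
  · intro h
    rw [← cfcₙ_id ℝ b]
    refine norm_cfcₙ_le fun t ht => ?_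
    have := norm_apply_le_norm_cfcₙ (fun t : ℝ => max (|t| - 1) 0) b ht (by fun_prop) h0
    rw [h, norm_zero, Real.norm_eq_abs, abs_of_nonneg (le_max_right _ _)] at this
    have := (le_max_left _ _).trans this
    simpa using this
  · intro h
    rw [← norm_le_zero_iff]
    refine norm_cfcₙ_le fun t ht => ?_
    have h1 := norm_apply_le_norm_cfcₙ (id : ℝ → ℝ) b ht
    rw [cfcₙ_id ℝ b] at h1
    have : |t| ≤ 1 := h1.trans h
    simp [this]

/-- The open set of irreducible representations that do not vanish at `c`. -/
lemma IrreducibleRep.isOpen_ne_zero {A : Type u} [NonUnitalCStarAlgebra A] (c : A) :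
    IsOpen {σ : IrreducibleRep A | σ.π c ≠ 0} := by
  refine TopologicalSpace.isOpen_generateFrom_of_mem ?_
  refine ⟨.mk' {a | ∀ σ : IrreducibleRep A, σ.π c = 0 → σ.π a = 0} (fun σ _ => map_zero _)
    (fun hx hy σ hσ => by rw [map_add, hx σ hσ, hy σ hσ, add_zero])
    (fun hx σ hσ => by rw [map_neg, hx σ hσ, neg_zero])
    (fun hy σ hσ => by rw [map_mul, hy σ hσ, mul_zero])
    (fun hx σ hσ => by rw [map_mul, hx σ hσ, zero_mul]), ?_, ?_⟩
  · rw [TwoSidedIdeal.coe_mk']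
    simp only [Set.ofPred_forall]
    refine isClosed_iInter fun σ => isClosed_iInter fun _ => isClosed_eq ?_ continuous_const
    exact σ.π.continuous_of_cstar
  · ext σ
    simp only [Set.mem_ofPred_eq, TwoSidedIdeal.mem_mk']
    constructor
    · exact fun h => ⟨c, fun _ h' => h', h⟩
    · rintro ⟨a, ha, hσ⟩ h
      exact hσ (ha σ h)

/-- The open subset of the spectrum where `c` does not vanish. -/
def CStarSpectrum.nonvanishing {A : Type u} [NonUnitalCStarAlgebra A] (c : A) :
    Set (CStarSpectrum A) :=
  {x | Quotient.liftOn (s := IrreducibleRep.setoid A) x (fun σ => σ.π c ≠ 0) (by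
    rintro σ τ ⟨U, hU⟩
    simp only [ne_eq, eq_iff_iff, not_iff_not, ContinuousLinearMap.ext_iff]
    constructor
    · intro h y
      obtain ⟨x, rfl⟩ := U.surjective y
      rw [← hU, h]; simp
    · intro h x
      apply U.injective
      rw [hU, h]; simp)}

lemma CStarSpectrum.isOpen_nonvanishing {A : Type u} [NonUnitalCStarAlgebra A] (c : A) :
    IsOpen (CStarSpectrum.nonvanishing c) :=
  (isQuotientMap_quotient_mk' (s := IrreducibleRep.setoid A)).isOpen_preimage.1
    (IrreducibleRep.isOpen_ne_zero c)

/-- For selfadjoint `b`, the set where `‖σ b‖ > 1` is open, being the set where `max (|t| - 1) 0`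
applied to `b` does not vanish. These sets cover the spectrum, and a finite subcover supplies the
finite set. -/
lemma HasCompactSpectrum.exists_finite {A : Type u} [NonUnitalCStarAlgebra A]
    (h : HasCompactSpectrum A) :
    ∃ S : Set A, S.Finite ∧ ∀ n, 0 < n → ∀ τ : A →⋆ₙₐ[ℂ] Mat n, Function.Surjective τ →
      ∃ a ∈ S, 1 ≤ ‖τ a‖ := by
  have : CompactSpace (CStarSpectrum A) := h
  let g : ℝ → ℝ := fun t => max (|t| - 1) 0
  have hg : Continuous g := by fun_prop
  have hg0 : g 0 = 0 := by simp [g]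
  let V : {b : A // IsSelfAdjoint b} → Set (CStarSpectrum A) := fun b =>
    CStarSpectrum.nonvanishing (cfcₙ g b.1)
  have hmap : ∀ {B : Type u} [NonUnitalCStarAlgebra B] (τ : A →⋆ₙₐ[ℂ] B) {b : A},
      IsSelfAdjoint b → (τ (cfcₙ g b) ≠ 0 ↔ 1 < ‖τ b‖) := fun τ b hb => by
    rw [NonUnitalStarAlgHom.map_cfcₙ τ g b hg.continuousOn hg0 τ.continuous_of_cstar hb (hb.map τ),
      ← not_le, ← cfcₙ_max_abs_sub_one_eq_zero_iff (hb.map τ)]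
  obtain ⟨t, ht⟩ := isCompact_univ.elim_finite_subcover V
    (fun b => CStarSpectrum.isOpen_nonvanishing _) (by
      intro x _
      induction x using Quotient.inductionOn with | _ σ => ?_
      obtain ⟨a, ha⟩ : ∃ a, σ.π a ≠ 0 := by
        by_contra! hall
        exact σ.ne_zero (NonUnitalStarAlgHom.ext hall)
      have hne : ‖σ.π (star a * a)‖ ≠ 0 := by
        rw [map_mul, map_star, CStarRing.norm_star_mul_self]
        simpa using ha
      refine Set.mem_iUnion.2 ⟨⟨(2 * ‖σ.π (star a * a)‖⁻¹ : ℝ) • (star a * a),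
        IsSelfAdjoint.smul (.all _) (.star_mul_self a)⟩, ?_⟩
      refine (hmap σ.π (IsSelfAdjoint.smul (.all _) (.star_mul_self a))).2 ?_
      rw [← Complex.coe_smul, map_smul, norm_smul, Complex.norm_real, norm_mul, norm_inv,
        norm_norm, mul_assoc, inv_mul_cancel₀ hne]
      norm_num)
  refine ⟨Subtype.val '' (t : Set {b : A // IsSelfAdjoint b}), t.finite_toSet.image _,
    fun n hn τ hτ => ?_⟩
  obtain ⟨σ, hσ⟩ := exists_irreducibleRep hn τ hτ
  obtain ⟨b, hb⟩ := Set.mem_iUnion.1 (ht (Set.mem_univ (Quotient.mk _ σ)))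
  obtain ⟨hbt, hb⟩ := Set.mem_iUnion.1 hb
  refine ⟨b, ⟨b, hbt, rfl⟩, ?_⟩
  rw [← hσ]
  exact ((hmap σ.π b.2).1 hb).le

/-- There is a finite set such that each proper closed ideal is contained in the kernel of a
finite-dimensional irreducible representation at which this set is bounded from below. -/
def HasBoundedReps (A : Type u) [NonUnitalCStarAlgebra A] : Prop :=
  ∃ S : Set A, S.Finite ∧ ∀ J : TwoSidedIdeal A, IsClosed (J : Set A) → (∃ a, a ∉ J) →
    ∃ n, 0 < n ∧ ∃ τ : A →⋆ₙₐ[ℂ] Mat n, Function.Surjective τ ∧ (∀ j ∈ J, τ j = 0) ∧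
      ∃ a ∈ S, 1 ≤ ‖τ a‖

/-- The ideals of a cover have dense sum, for otherwise some matrix representation would kill them
all. Approximate each `a ∈ S` within distance `1` by `b a` in the sum, which involves finitely many
ideals. A representation `σ` vanishing on those ideals would kill every `b a`, and a `τ` vanishing
on `ker σ` would satisfy `1 ≤ ‖τ a‖ ≤ ‖a - b a‖ < 1` for some `a`. -/
lemma HasBoundedReps.hasCompactSpectrum {A : Type u} [NonUnitalCStarAlgebra A]
    (h : HasBoundedReps A) : HasCompactSpectrum A := by
  suffices CompactSpace (IrreducibleRep A) from Quotient.compactSpace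
  obtain ⟨S, hS, hrep⟩ := h
  -- By Alexander's subbase theorem, covers by sets of the generating family suffice.
  refine compactSpace_generateFrom' rfl fun ι U hU => ?_
  choose I hI hIU using fun i => (U i).2
  -- The algebraic sum of the ideals; each member comes with a finite subfamily whose sum contains
  -- it.
  let J₀ : TwoSidedIdeal A := .mk' {b | ∃ F : Finset ι, ∀ K : TwoSidedIdeal A,
      (∀ i ∈ F, I i ≤ K) → b ∈ K} ⟨∅, fun K _ => K.zero_mem⟩
    (by
      classical
      rintro x y ⟨F, hF⟩ ⟨G, hG⟩
      exact ⟨F ∪ G, fun K hK => K.add_mem (hF K fun i hi => hK i (Finset.mem_union_left _ hi))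
        (hG K fun i hi => hK i (Finset.mem_union_right _ hi))⟩)
    (by rintro x ⟨F, hF⟩; exact ⟨F, fun K hK => K.neg_mem (hF K hK)⟩)
    (by rintro x y ⟨F, hF⟩; exact ⟨F, fun K hK => K.mul_mem_left _ _ (hF K hK)⟩)
    (by rintro x y ⟨F, hF⟩; exact ⟨F, fun K hK => K.mul_mem_right _ _ (hF K hK)⟩)
  have hIJ : ∀ i, I i ≤ J₀ := fun i b hb => by
    rw [TwoSidedIdeal.mem_mk']
    exact ⟨{i}, fun K hK => hK i (Finset.mem_singleton_self i) hb⟩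
  have htop : ∀ a, a ∈ J₀.closedHull := by
    by_contra! hne
    obtain ⟨n, hn, τ, hτ, hτJ, -⟩ := hrep _ J₀.isClosed_closedHull hne
    obtain ⟨σ, hσ⟩ := exists_irreducibleRep hn τ hτ
    obtain ⟨i, hi⟩ := Set.mem_iUnion.1 ((Set.ext_iff.1 hU σ).2 trivial)
    rw [hIU] at hi
    obtain ⟨a, ha, hne⟩ := hi
    rw [← norm_ne_zero_iff, hσ, hτJ a (J₀.le_closedHull (hIJ i ha)), norm_zero] at hne
    exact hne rfl
  have happrox : ∀ a : A, ∃ b ∈ J₀, ‖a - b‖ < 1 := fun a => by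
    have := htop a
    rw [← SetLike.mem_coe, TwoSidedIdeal.coe_closedHull, Metric.mem_closure_iff] at this
    obtain ⟨b, hb, hab⟩ := this 1 one_pos
    exact ⟨b, hb, by rwa [← dist_eq_norm]⟩
  choose b hb hab using happrox
  choose F hF using fun a => (TwoSidedIdeal.mem_mk' ..).1 (hb a)
  refine ⟨⋃ a ∈ S, (F a : Set ι), hS.biUnion fun a _ => (F a).finite_toSet, ?_⟩
  refine Set.eq_univ_of_forall fun σ => ?_
  by_contra hσ
  have hσI : ∀ a ∈ S, ∀ i ∈ F a, I i ≤ σ.π.kerIdeal := by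
    intro a ha i hi x hx
    rw [NonUnitalStarAlgHom.mem_kerIdeal]
    by_contra hne
    refine hσ (Set.mem_iUnion₂.2 ⟨i, Set.mem_iUnion₂.2 ⟨a, ha, hi⟩, ?_⟩)
    rw [hIU]
    exact ⟨x, hx, hne⟩
  obtain ⟨n, hn, τ, hτ, hτJ, a, haS, ha⟩ := hrep _ σ.π.isClosed_kerIdeal (by
    by_contra! hall
    exact σ.ne_zero (NonUnitalStarAlgHom.ext fun a =>
      (NonUnitalStarAlgHom.mem_kerIdeal _ _).1 (hall a)))
  have h0 := hτJ (b a) (hF a _ (hσI a haS))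
  have : ‖τ a‖ ≤ ‖a - b a‖ := by
    rw [← sub_zero (τ a), ← h0, ← map_sub]
    exact NonUnitalStarAlgHom.norm_apply_le τ _
  linarith [hab a]

/-! ### Standard decompositions -/

lemma Mat.one_ne_zero {n : ℕ} (hn : 0 < n) : (1 : Mat n) ≠ 0 := fun h => by
  have := congrFun (congrFun h ⟨0, hn⟩) ⟨0, hn⟩
  simp at this

lemma exists_eq_closedIdealGenerated {A : Type*} [NonUnitalCStarAlgebra A] (S : Set A) :
    ∃ I : TwoSidedIdeal A, IsClosed (I : Set A) ∧ (I : Set A) = closedIdealGenerated S ∧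
      S ⊆ I ∧ ∀ K : TwoSidedIdeal A, IsClosed (K : Set A) → S ⊆ K → I ≤ K :=
  ⟨(TwoSidedIdeal.span S).closedHull, TwoSidedIdeal.isClosed_closedHull _,
    TwoSidedIdeal.coe_closedHull _,
    TwoSidedIdeal.subset_span.trans (TwoSidedIdeal.le_closedHull _), fun K hK hSK => by
      rw [← SetLike.coe_subset_coe, TwoSidedIdeal.coe_closedHull]
      exact closure_minimal (TwoSidedIdeal.span_le.2 hSK) hK⟩

lemma isStep_of_bijective {A P X : Type*} [NonUnitalCStarAlgebra A] [NonUnitalCStarAlgebra P]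
    [Subsingleton P] [TopologicalSpace X] {n : ℕ} (φ : A →⋆ₙₐ[ℂ] C₀(X, Mat n))
    (hφ : Function.Bijective φ) : IsStep ∅ φ (0 : A →⋆ₙₐ[ℂ] P) where
  isClosed := isClosed_empty
  surjective p := ⟨0, Subsingleton.elim _ _⟩
  map_eq_zero := by simp
  eq_zero a _ ha := hφ.1 (by rw [map_zero]; exact ha)
  lift f _ := (hφ.2 f).imp fun a ha => ⟨rfl, ha⟩

/-- A set of matrix-valued functions generates everything as a closed ideal if and only if it has
no common zero. -/
lemma closedIdealGenerated_eq_univ_iff {X : Type u} [TopologicalSpace X] [T2Space X]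
    [LocallyCompactSpace X] {n : ℕ} (hn : 0 < n) (S : Set C₀(X, Mat n)) :
    closedIdealGenerated S = Set.univ ↔ ∀ x, ∃ f ∈ S, f x ≠ 0 := by
  obtain ⟨I, hI, hIS, hSI, hle⟩ := exists_eq_closedIdealGenerated S
  rw [← hIS]
  constructor
  · intro h x
    by_contra! hx
    have hle' := hle (evalHom (E := Mat n) x).kerIdeal (evalHom (E := Mat n) x).isClosed_kerIdeal
      fun f hf => (NonUnitalStarAlgHom.mem_kerIdeal _ _).2 (hx f hf)
    obtain ⟨χ, hχc, hχx, -, -⟩ := exists_bump isOpen_univ (Set.mem_univ x)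
    have hmem : bump χ hχc (.const X (1 : Mat n)) ∈ (I : Set C₀(X, Mat n)) := h ▸ trivial
    have := (NonUnitalStarAlgHom.mem_kerIdeal _ _).1 (hle' hmem)
    simp [hχx, Mat.one_ne_zero hn] at this
  · intro h
    have hs := isStep_of_bijective (A := C₀(X, Mat n)) (P := C₀(PEmpty.{u + 1}, Mat 1))
      (X := X) (n := n) (NonUnitalStarAlgHom.id ℂ C₀(X, Mat n))
      ⟨fun _ _ h => h, fun f => ⟨f, rfl⟩⟩
    refine Set.eq_univ_of_forall fun f => ?_
    refine hs.mem_of_map_eq_zero hI (a := f) rfl fun x hx => ?_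
    obtain ⟨g, hg, hgx⟩ := h x
    exact absurd (hx g (hSI hg)) hgx

/-- A continuous function without zeros on a compact space. -/
lemma exists_finite_one_le_norm {A X : Type*} [NonUnitalCStarAlgebra A] [TopologicalSpace X]
    [CompactSpace X] {n : ℕ} (φ : A →⋆ₙₐ[ℂ] C₀(X, Mat n)) (h : ∀ x, ∃ a, φ a x ≠ 0) :
    ∃ S : Set A, S.Finite ∧ ∀ x, ∃ a ∈ S, 1 ≤ ‖φ a x‖ := by
  choose a ha using h
  let b : X → A := fun x => ((2 * ‖φ (a x) x‖⁻¹ : ℝ) : ℂ) • a x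
  have hb : ∀ x, 1 < ‖φ (b x) x‖ := fun x => by
    have : ‖φ (a x) x‖ ≠ 0 := norm_ne_zero_iff.2 (ha x)
    rw [map_smul, ZeroAtInftyContinuousMap.smul_apply, norm_smul, Complex.norm_real, norm_mul,
      norm_inv, norm_norm, mul_assoc, inv_mul_cancel₀ this]
    norm_num
  obtain ⟨t, ht⟩ := isCompact_univ.elim_finite_subcover (fun x => {y | 1 < ‖φ (b x) y‖})
    (fun x => isOpen_lt continuous_const (map_continuous (φ (b x))).norm)
    fun x _ => Set.mem_iUnion.2 ⟨x, hb x⟩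
  refine ⟨b '' t, t.finite_toSet.image _, fun x => ?_⟩
  obtain ⟨y, hy, hxy⟩ := Set.mem_iUnion₂.1 (ht (Set.mem_univ x))
  exact ⟨b y, ⟨y, hy, rfl⟩, le_of_lt hxy⟩

lemma HasBoundedReps.of_subsingleton {A : Type u} [NonUnitalCStarAlgebra A] [Subsingleton A] :
    HasBoundedReps A :=
  ⟨∅, Set.finite_empty, fun J _ ⟨a, ha⟩ => absurd (Subsingleton.elim 0 a ▸ J.zero_mem) ha⟩

/-- If the zero set of a proper `J` meets the complement of `X₀`, evaluation there is the required
representation, bounded below by compactness of `X`. Otherwise `q(J)` is proper, and a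
representation of `P` is used; the finite set for `P` is lifted to `A`. -/
lemma HasBoundedReps.step {A P X : Type u} [NonUnitalCStarAlgebra A] [NonUnitalCStarAlgebra P]
    [TopologicalSpace X] [T2Space X] [CompactSpace X] {n : ℕ} (hn : 0 < n) {X₀ : Set X}
    {φ : A →⋆ₙₐ[ℂ] C₀(X, Mat n)} {q : A →⋆ₙₐ[ℂ] P} (hs : IsStep X₀ φ q)
    (hφ : ∀ x ∈ X₀, ∃ a, φ a x ≠ 0) (hP : HasBoundedReps P) : HasBoundedReps A := by
  obtain ⟨S, hS, hrep⟩ := hP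
  obtain ⟨T, hT, hTφ⟩ := exists_finite_one_le_norm φ fun x => by
    by_cases hx : x ∈ X₀
    · exact hφ x hx
    · obtain ⟨a, ha⟩ := hs.surjective_eval hx 1
      refine ⟨a, ?_⟩
      change φ a x = 1 at ha
      rw [ha]
      exact Mat.one_ne_zero hn
  choose r hr using hs.surjective
  refine ⟨T ∪ r '' S, hT.union (hS.image r), fun J hJ hne => ?_⟩
  by_cases hZ : zeroSet φ J ⊆ X₀
  · obtain ⟨a, ha⟩ := hne
    have himage : ∃ p, p ∉ J.image q hs.surjective := ⟨q a, fun hqa => ha <|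
      (hs.mem_ideal_iff hJ a).2 ⟨fun x hx => by
        obtain ⟨j, hj, hja⟩ := (J.mem_image q _ _).1 hqa
        have := hs.map_eq_zero (a - j) (by rw [map_sub, hja, sub_self]) x (hZ hx)
        rwa [map_sub, ZeroAtInftyContinuousMap.sub_apply, hx j hj, sub_zero] at this, hqa⟩⟩
    obtain ⟨m, hm, τ, hτ, hτJ, s, hsS, hs1⟩ := hrep _ (J.isClosed_image hJ q hs.surjective) himage
    refine ⟨m, hm, τ.comp q, hτ.comp hs.surjective,
      fun j hj => hτJ _ ((J.mem_image q _ _).2 ⟨j, hj, rfl⟩), r s, Or.inr ⟨s, hsS, rfl⟩, ?_⟩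
    change 1 ≤ ‖τ (q (r s))‖
    rwa [hr]
  · obtain ⟨x, hxZ, hx⟩ := Set.not_subset.1 hZ
    obtain ⟨a, ha, hax⟩ := hTφ x
    exact ⟨n, hn, (evalHom x).comp φ, hs.surjective_eval hx, fun j hj => hxZ j hj, a, Or.inl ha, hax⟩

namespace RSHZeroDecomposition

lemma hasBoundedReps {A : Type u} [NonUnitalCStarAlgebra A] (D : RSHZeroDecomposition A)
    (hc : D.AllCompact) (hf : D.AllFull) : HasBoundedReps A := by
  induction D with
  | base X n hn e =>
    have : CompactSpace X := hc
    exact .step hn (isStep_zero (P := C₀(PEmpty.{u + 1}, Mat 1)) e)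
      (by simp) .of_subsingleton
  | step D X X₀ hX₀ n hn ρ e ih =>
    obtain ⟨hcD, hcX, -⟩ := hc
    have hs := isStep_pullback e hX₀
    have : LocallyCompactSpace X₀ := hX₀.isClosedEmbedding_subtypeVal.locallyCompactSpace
    refine .step hn hs (fun x hx => ?_) (ih hcD hf.1)
    obtain ⟨_, ⟨p, rfl⟩, hp⟩ := (closedIdealGenerated_eq_univ_iff hn _).1 hf.2 ⟨x, hx⟩
    obtain ⟨a, rfl⟩ := hs.surjective p
    exact ⟨a, by rwa [← pullback_compat e a ⟨x, hx⟩] at hp⟩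

lemma stage_length {A : Type u} [NonUnitalCStarAlgebra A] (D : RSHZeroDecomposition A) :
    D.stage D.length = ⟨A, D⟩ := by
  cases D with
  | base X n hn e => rfl
  | step D X X₀ hX₀ n hn ρ e =>
    rw [length, stage, if_neg (by omega)]

section

variable {A P : Type u} [NonUnitalCStarAlgebra A] [NonUnitalCStarAlgebra P]
  (D : RSHZeroDecomposition P) (X : Type u) [TopologicalSpace X] [T2Space X]
  [LocallyCompactSpace X] (X₀ : Set X) (hX₀ : IsClosed X₀) (n : ℕ) (hn : 0 < n)
  (ρ : P →⋆ₙₐ[ℂ] C₀(X₀, Mat n)) (e : A ≃⋆ₐ[ℂ] restrictionPullback X₀ n ρ)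

lemma stage_step_of_le {i : ℕ} (hi : i ≤ D.length) :
    (step D X X₀ hX₀ n hn ρ e).stage i = D.stage i := by
  rw [stage, if_pos hi]

end

end RSHZeroDecomposition

lemma IsIdentityElement.eq_one {B : Type*} [MulOneClass B] {e : B} (he : IsIdentityElement e) :
    e = 1 := by
  rw [← (he 1).1, mul_one]

lemma IsIdentityElement.map {A B F : Type*} [Mul A] [Mul B] [FunLike F A B] [MulHomClass F A B]
    {e : A} (he : IsIdentityElement e) {f : F} (hf : Function.Surjective f) :
    IsIdentityElement (f e) := fun b => by
  obtain ⟨a, rfl⟩ := hf b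
  rw [← map_mul, ← map_mul, (he a).1, (he a).2]
  exact ⟨rfl, rfl⟩

/-- Restriction of a pullback to the closure of the complement of `X₀`. -/
lemma IsStep.restrict_closure_compl {A P X : Type u} [NonUnitalCStarAlgebra A]
    [NonUnitalCStarAlgebra P] [TopologicalSpace X] [T2Space X] [LocallyCompactSpace X] {n : ℕ}
    {X₀ : Set X} {φ : A →⋆ₙₐ[ℂ] C₀(X, Mat n)} {q : A →⋆ₙₐ[ℂ] P} (hs : IsStep X₀ φ q) :
    IsStep (X := closure X₀ᶜ) (Subtype.val ⁻¹' X₀)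
      ((restr _ (isClosed_closure (s := X₀ᶜ)).isClosedEmbedding_subtypeVal).comp φ) q where
  isClosed := hs.isClosed.preimage continuous_subtype_val
  surjective := hs.surjective
  map_eq_zero a ha x hx := hs.map_eq_zero a ha x hx
  eq_zero a ha ha' := hs.eq_zero a ha <| ZeroAtInftyContinuousMap.ext fun x => by
    by_cases hx : x ∈ X₀
    · exact hs.map_eq_zero a ha x hx
    · exact DFunLike.congr_fun ha' ⟨x, subset_closure hx⟩
  lift f hf := by
    obtain ⟨a, ha, hφ⟩ := hs.exists_lift_eqOn isClosed_closure f fun x hx hx₀ => hf ⟨x, hx⟩ hx₀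
    exact ⟨a, ha, ZeroAtInftyContinuousMap.ext hφ⟩

open RSHZeroDecomposition in
-- The base space is cut down to the closure of `X \ X₀`, where a finite set of functions is
-- uniformly bounded below. The clause `l = E.length` for unital algebras is needed in the
-- induction: it says that the decomposition of a unital `P` is unital throughout, so that it can be
-- prolonged when `A` is unital.
lemma RSHDim.exists_isStandard {d : WithBot ℕ∞} {A : Type u} [NonUnitalCStarAlgebra A]
    (h : RSHDim d A) {S : Set A} (hS : S.Finite)
    (hrep : ∀ n, 0 < n → ∀ τ : A →⋆ₙₐ[ℂ] Mat n, Function.Surjective τ → ∃ a ∈ S, 1 ≤ ‖τ a‖) :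
    ∃ (E : RSHZeroDecomposition A) (l : ℕ), E.IsStandard l ∧
      (IsUnitalAlgebra A → l = E.length) ∧ E.DimLE d := by
  induction h with
  | zero A h =>
    obtain ⟨e⟩ := nonempty_starAlgEquiv_of_subsingleton A C₀(PEmpty.{u + 1}, Mat 1)
    have hu : IsUnitalAlgebra A := ⟨0, fun a => ⟨h.elim _ _, h.elim _ _⟩⟩
    have hc : CompactSpace PEmpty.{u + 1} := inferInstance
    exact ⟨.base PEmpty.{u + 1} 1 one_pos e, 0, ⟨hc, trivial, le_rfl, hu,
      fun h => absurd h (lt_irrefl 0), hc, hu⟩, fun _ => rfl, HasCoveringDimLE.of_isEmpty d⟩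
  | @step A P X _ _ _ _ _ n hn X₀ φ q hX hs hP ih =>
    obtain ⟨E, l, hE, hEl, hEd⟩ := ih (hS.image q) fun m hm τ hτ => by
      obtain ⟨a, ha, h1⟩ := hrep m hm (τ.comp q) (hτ.comp hs.surjective)
      exact ⟨q a, ⟨a, ha, rfl⟩, h1⟩
    have hj := (isClosed_closure (s := X₀ᶜ)).isClosedEmbedding_subtypeVal
    -- The right-hand side is a finite union of compact sets, which gives compactness of the
    -- closure; the bound at its points in `X₀` gives fullness.
    have hsub : closure X₀ᶜ ⊆ ⋃ a ∈ S, {x | 1 ≤ ‖φ a x‖} := by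
      refine closure_minimal (fun x hx => ?_) ?_
      · obtain ⟨a, ha, h1⟩ := hrep n hn _ (hs.surjective_eval hx)
        exact Set.mem_iUnion₂.2 ⟨a, ha, h1⟩
      · exact hS.isClosed_biUnion fun a _ =>
          isClosed_le continuous_const (map_continuous (φ a)).norm
    have hcomp : CompactSpace (closure X₀ᶜ) := isCompact_iff_compactSpace.1 <|
      (hS.isCompact_biUnion fun a _ => isCompact_le_norm (φ a) one_pos).of_isClosed_subset
        isClosed_closure hsub
    have hs' := hs.restrict_closure_compl
    have hcomp₀ : CompactSpace (Subtype.val ⁻¹' X₀ : Set (closure X₀ᶜ)) :=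
      isCompact_iff_compactSpace.1 hs'.isClosed.isCompact
    obtain ⟨ρ, e, hφ, hq⟩ := hs'.exists_pullback
    have hρ : ∀ a (x : (Subtype.val ⁻¹' X₀ : Set (closure X₀ᶜ))), ρ (q a) x = φ a x := fun a x => by
      rw [← hq, ← pullback_compat e a x, hφ]; rfl
    let E' : RSHZeroDecomposition A := RSHZeroDecomposition.step E _ _ hs'.isClosed n hn ρ e
    have hc : E'.AllCompact := ⟨hE.compact, hcomp, hcomp₀⟩
    have hf : E'.AllFull := by
      refine ⟨hE.full, (closedIdealGenerated_eq_univ_iff hn _).2 fun x => ?_⟩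
      obtain ⟨a, -, h1⟩ := Set.mem_iUnion₂.1 (hsub x.1.2)
      refine ⟨_, ⟨q a, rfl⟩, fun h0 => ?_⟩
      rw [hρ] at h0
      change 1 ≤ ‖φ a x‖ at h1
      rw [h0, norm_zero] at h1
      exact not_le.2 one_pos h1
    have hd : E'.DimLE d := ⟨hEd, hX.of_isClosedEmbedding hj⟩
    have hstage : E'.stage (E.length + 1) = ⟨A, E'⟩ := E'.stage_length
    by_cases hu : IsUnitalAlgebra A
    · obtain ⟨u, hu'⟩ := id hu
      have hl : l = E.length := hEl ⟨q u, hu'.map hs.surjective⟩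
      -- Off `X₀` evaluation is onto `Mₙ`, so it preserves the unit; the equation extends to the
      -- closure.
      have hone : ∀ x ∈ closure X₀ᶜ, φ u x = 1 := by
        refine closure_minimal (fun x hx => ?_)
          (isClosed_eq (map_continuous (φ u)) continuous_const)
        exact (hu'.map (hs.surjective_eval hx)).eq_one
      have hEu : E.IsUnital := by
        have := hE.isUnital
        rwa [hl, stage_length] at this
      refine ⟨E', E.length + 1, ⟨hc, hf, le_rfl, by rw [hstage]; exact hu,
        fun h => absurd h (lt_irrefl _), ?_⟩, fun _ => rfl, hd⟩
      rw [hstage]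
      refine ⟨hEu, hcomp, hu, q u, hu'.map hs.surjective, fun f => ?_⟩
      constructor <;> ext1 x <;> rw [ZeroAtInftyContinuousMap.mul_apply, hρ, hone x x.1.2]
      · exact one_mul _
      · exact mul_one _
    · have hst : E'.stage l = E.stage l := stage_step_of_le _ _ _ _ _ _ _ _ hE.le_length
      refine ⟨E', l, ⟨hc, hf, hE.le_length.trans (Nat.le_succ _), by rw [hst]; exact hE.unital,
        fun _ => ?_, by rw [hst]; exact hE.isUnital⟩, fun h => absurd h hu, hd⟩
      -- The stage after `l` is `A` itself if `l` exhausts the decomposition of `P`, and a stage of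
      -- that decomposition otherwise.
      rcases hE.le_length.eq_or_lt with hl | hl
      · rw [hl, hstage]; exact hu
      · rw [show E'.stage (l + 1) = E.stage (l + 1) from stage_step_of_le _ _ _ _ _ _ _ _ hl]
        exact hE.not_unital hl

/-! ### The unitization -/

/-- The unital extension of a *-homomorphism to matrix-valued functions on a compact space. -/
def unitizationHom {A X : Type*} [NonUnitalCStarAlgebra A] [TopologicalSpace X] [CompactSpace X]
    {n : ℕ} (φ : A →⋆ₙₐ[ℂ] C₀(X, Mat n)) : Unitization ℂ A →⋆ₙₐ[ℂ] C₀(X, Mat n) where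
  toFun z :=
    { toFun := fun x => z.fst • (1 : Mat n) + φ z.snd x
      continuous_toFun := continuous_const.add (map_continuous (φ z.snd))
      zero_at_infty' := by simp }
  map_smul' c z := by
    ext1 x
    change (c • z).fst • (1 : Mat n) + φ (c • z).snd x = c • (z.fst • (1 : Mat n) + φ z.snd x)
    rw [Unitization.fst_smul, Unitization.snd_smul, map_smul, ZeroAtInftyContinuousMap.smul_apply,
      smul_add, smul_smul, smul_eq_mul]
  map_zero' := by
    ext1 x
    change (0 : ℂ) • (1 : Mat n) + φ (0 : A) x = 0
    rw [map_zero, zero_smul, ZeroAtInftyContinuousMap.zero_apply, add_zero]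
  map_add' z w := by
    ext1 x
    change (z + w).fst • (1 : Mat n) + φ (z + w).snd x =
      z.fst • (1 : Mat n) + φ z.snd x + (w.fst • (1 : Mat n) + φ w.snd x)
    rw [Unitization.fst_add, Unitization.snd_add, map_add, ZeroAtInftyContinuousMap.add_apply,
      add_smul]
    abel
  map_mul' z w := by
    ext1 x
    change (z * w).fst • (1 : Mat n) + φ (z * w).snd x =
      (z.fst • (1 : Mat n) + φ z.snd x) * (w.fst • (1 : Mat n) + φ w.snd x)
    rw [Unitization.fst_mul, Unitization.snd_mul, map_add, map_add, map_smul, map_smul, map_mul,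
      ZeroAtInftyContinuousMap.add_apply, ZeroAtInftyContinuousMap.add_apply,
      ZeroAtInftyContinuousMap.mul_apply, ZeroAtInftyContinuousMap.smul_apply,
      ZeroAtInftyContinuousMap.smul_apply, add_mul, mul_add, mul_add, smul_mul_smul_comm,
      smul_one_mul, mul_smul_comm, mul_one, mul_one]
    abel
  map_star' z := by
    ext1 x
    change (star z).fst • (1 : Mat n) + φ (star z).snd x =
      star (z.fst • (1 : Mat n) + φ z.snd x)
    rw [Unitization.fst_star, Unitization.snd_star, map_star, ZeroAtInftyContinuousMap.star_apply,
      star_add, star_smul, star_one]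

lemma unitizationHom_apply {A X : Type*} [NonUnitalCStarAlgebra A] [TopologicalSpace X]
    [CompactSpace X] {n : ℕ} (φ : A →⋆ₙₐ[ℂ] C₀(X, Mat n)) (z : Unitization ℂ A) (x : X) :
    unitizationHom φ z x = z.fst • (1 : Mat n) + φ z.snd x := rfl

/-- The canonical map from the unitization of a unital algebra to the algebra. -/
def unitizationRetract {A : Type*} [NonUnitalCStarAlgebra A] {u : A} (hu : IsIdentityElement u) :
    Unitization ℂ A →⋆ₙₐ[ℂ] A where
  toFun z := z.fst • u + z.snd
  map_smul' c z := by simp [smul_smul]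
  map_zero' := by simp
  map_add' z w := by
    simp only [Unitization.fst_add, Unitization.snd_add, add_smul]
    abel
  map_mul' z w := by
    simp only [Unitization.fst_mul, Unitization.snd_mul, add_mul, mul_add, smul_mul_assoc,
      mul_smul_comm, (hu _).1, (hu _).2, smul_add, smul_smul, mul_comm w.fst]
    abel
  map_star' z := by
    have : star u = u := by
      have h := congrArg star (hu (star u)).2
      rw [star_mul, star_star, (hu (star u)).2] at h
      exact h
    simp [this]

/-- The functoriality of the unitization. -/
def unitizationMap {A P : Type*} [NonUnitalCStarAlgebra A] [NonUnitalCStarAlgebra P]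
    (q : A →⋆ₙₐ[ℂ] P) : Unitization ℂ A →⋆ₙₐ[ℂ] Unitization ℂ P where
  toFun z := Unitization.mk (z.fst, q z.snd)
  map_smul' c z := Unitization.ext rfl (map_smul q c z.snd)
  map_zero' := Unitization.ext rfl (map_zero q)
  map_add' z w := Unitization.ext rfl (map_add q z.snd w.snd)
  map_mul' z w := Unitization.ext rfl (by simp)
  map_star' z := Unitization.ext rfl (map_star q z.snd)

namespace RSHZeroDecomposition

/-- If `u` is the unit of `A`, then `(c, a) ↦ (c, c u + a)` is an isomorphism of the unitization
with `ℂ ⊕ A`, and `ℂ` is the algebra of functions on a point, glued along `∅`. -/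
lemma exists_isUnitizationOf_length {A : Type u} [NonUnitalCStarAlgebra A]
    (D : RSHZeroDecomposition A) (hA : IsUnitalAlgebra A) (hD : D.IsUnital) :
    ∃ E : RSHZeroDecomposition (Unitization ℂ A), E.IsUnital ∧ IsUnitizationOf D.length D E := by
  obtain ⟨u, hu⟩ := hA
  have hzero : ∀ (B : Type u) [NonUnitalCStarAlgebra B], ∃ f : A →⋆ₙₐ[ℂ] B, ∀ a, f a = 0 :=
    fun B _ => ⟨0, fun _ => rfl⟩
  obtain ⟨μ, -⟩ := hzero C₀((∅ : Set PUnit.{u + 1}), Mat 1)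
  -- The unital extension of the zero map is the character `z ↦ z.fst`.
  obtain ⟨φ, hφ⟩ := hzero C₀(PUnit.{u + 1}, Mat 1)
  let f : Unitization ℂ A →⋆ₙₐ[ℂ] restrictionPullback (∅ : Set PUnit.{u + 1}) 1 μ :=
    NonUnitalStarAlgHom.codRestrict ((unitizationHom φ).prod (unitizationRetract hu))
      (restrictionPullback (∅ : Set PUnit.{u + 1}) 1 μ) fun z x => absurd x.2 (Set.notMem_empty _)
  have hf₁ : ∀ z x, (f z).1.1 x = z.fst • (1 : Mat 1) := fun z x => by
    change z.fst • (1 : Mat 1) + φ z.snd x = _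
    rw [hφ, ZeroAtInftyContinuousMap.zero_apply, add_zero]
  have hf₂ : ∀ z, (f z).1.2 = z.fst • u + z.snd := fun z => rfl
  have hf : Function.Bijective f := by
    constructor
    · rw [injective_iff_map_eq_zero]
      intro z hz
      have h₁ := hf₁ z PUnit.unit
      have h₂ := hf₂ z
      rw [hz] at h₁ h₂
      have h0 : z.fst = 0 := (smul_eq_zero.1 h₁.symm).resolve_right (Mat.one_ne_zero one_pos)
      rw [h0, zero_smul, zero_add] at h₂
      exact Unitization.ext h0 h₂.symm
    · rintro ⟨⟨g, a⟩, hga⟩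
      let c : ℂ := g PUnit.unit 0 0
      refine ⟨Unitization.mk (c, a - c • u), Subtype.ext (Prod.ext ?_ ?_)⟩
      · ext1 x
        rw [hf₁]
        ext i j
        have hi := Subsingleton.elim i 0
        have hj := Subsingleton.elim j 0
        subst hi hj
        change c • (1 : Mat 1) 0 0 = c
        simp
      · rw [hf₂]
        exact add_sub_cancel _ _
  let e := StarAlgEquiv.ofBijective f hf
  have hpt : CompactSpace PUnit.{u + 1} := inferInstance
  refine ⟨.step D PUnit.{u + 1} ∅ isClosed_empty 1 one_pos μ e,
    ⟨hD, hpt, ⟨1, fun a => ⟨one_mul a, mul_one a⟩⟩, u, hu, fun g => ?_⟩, .top D μ e fun a => ?_⟩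
  · constructor <;> ext1 x <;> exact absurd x.2 (Set.notMem_empty _)
  · refine Prod.ext ?_ ?_
    · ext1 x
      exact (hf₁ _ x).trans (by simp)
    · exact (hf₂ _).trans (by simp)

lemma exists_isUnitizationOf {A : Type u} [NonUnitalCStarAlgebra A]
    (D : RSHZeroDecomposition A) (l : ℕ) (hc : D.AllCompact) (hl : l ≤ D.length)
    (hA : IsUnitalAlgebra (D.stage l).carrier) (hD : (D.stage l).decomposition.IsUnital) :
    ∃ E : RSHZeroDecomposition (Unitization ℂ A), E.IsUnital ∧ IsUnitizationOf l D E := by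
  induction D with
  | base X n hn e =>
    obtain rfl : l = 0 := Nat.le_zero.1 hl
    exact exists_isUnitizationOf_length (base X n hn e) hA hD
  | @step A P _ _ D X _ _ _ X₀ hX₀ n hn ρ e ih =>
    by_cases hlD : l ≤ D.length
    · rw [stage_step_of_le _ _ _ _ _ _ _ _ hlD] at hA hD
      obtain ⟨hcD, hcX, hcX₀⟩ := hc
      obtain ⟨E, hE, hDE⟩ := ih hcD hlD hA hD
      let f : Unitization ℂ A →⋆ₙₐ[ℂ] restrictionPullback X₀ n (unitizationHom ρ) :=
        NonUnitalStarAlgHom.codRestrict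
          ((unitizationHom (pullbackFst e)).prod (unitizationMap (pullbackSnd e)))
          (restrictionPullback X₀ n (unitizationHom ρ)) fun z x => by
            change z.fst • (1 : Mat n) + pullbackFst e z.snd x =
              z.fst • (1 : Mat n) + ρ (pullbackSnd e z.snd) x
            rw [pullback_compat]
      have hf₁ : ∀ z x, (f z).1.1 x = z.fst • (1 : Mat n) + pullbackFst e z.snd x :=
        fun z x => rfl
      have hf₂ : ∀ z, (f z).1.2 = Unitization.mk (z.fst, pullbackSnd e z.snd) := fun z => rfl
      have hf : Function.Bijective f := by
        constructor
        · rw [injective_iff_map_eq_zero]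
          intro z hz
          have h₂ := hf₂ z
          rw [hz] at h₂
          have h0 : z.fst = 0 := (congrArg (fun w : Unitization ℂ P => w.fst) h₂).symm
          refine Unitization.ext h0 ((isStep_pullback e hX₀).eq_zero _
            (congrArg (fun w : Unitization ℂ P => w.snd) h₂).symm ?_)
          ext1 x
          have h₁ := hf₁ z x
          rw [hz, h0, zero_smul, zero_add] at h₁
          exact h₁.symm
        · rintro ⟨⟨g, w⟩, hgw⟩
          have hgw' : ∀ x : X₀, g x = w.fst • (1 : Mat n) + ρ w.snd x := hgw
          have hc := unitizationHom_apply (pullbackFst e) (Unitization.mk (w.fst, (0 : A)))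
          -- The scalar part of `w` is subtracted from `g` as a constant function; the difference is
          -- compatible with `w.snd` and lifts to `A`.
          obtain ⟨a, ha, hq⟩ := exists_pullback_eq e
            (f := g - unitizationHom (pullbackFst e) (Unitization.mk (w.fst, (0 : A))))
            (p := w.snd) fun x => by
              rw [ZeroAtInftyContinuousMap.sub_apply, hgw', hc]
              change _ - (w.fst • (1 : Mat n) + pullbackFst e 0 x) = _
              rw [map_zero, ZeroAtInftyContinuousMap.zero_apply, add_zero, add_sub_cancel_left]
          refine ⟨Unitization.mk (w.fst, a), Subtype.ext (Prod.ext ?_ ?_)⟩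
          · ext1 x
            rw [hf₁]
            change w.fst • (1 : Mat n) + pullbackFst e a x = g x
            rw [ha, ZeroAtInftyContinuousMap.sub_apply, hc]
            change _ + (g x - (w.fst • (1 : Mat n) + pullbackFst e 0 x)) = _
            rw [map_zero, ZeroAtInftyContinuousMap.zero_apply, add_zero, add_sub_cancel]
          · rw [hf₂]
            exact Unitization.ext rfl hq
      refine ⟨step E X X₀ hX₀ n hn (unitizationHom ρ) (StarAlgEquiv.ofBijective f hf),
        ⟨hE, hcX, ⟨1, fun a => ⟨one_mul a, mul_one a⟩⟩, 1, fun a => ⟨one_mul a, mul_one a⟩,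
          fun g => ?_⟩, .step l D E hDE X X₀ hX₀ n hn ρ e _ (fun _ _ => rfl) _ fun a => ?_⟩
      · have h1 : ∀ x, unitizationHom ρ 1 x = 1 := fun x => by
          rw [unitizationHom_apply, Unitization.fst_one, Unitization.snd_one, map_zero, one_smul,
            ZeroAtInftyContinuousMap.zero_apply, add_zero]
        constructor <;> ext1 x <;> rw [ZeroAtInftyContinuousMap.mul_apply, h1]
        · exact one_mul _
        · exact mul_one _
      · refine Prod.ext ?_ rfl
        ext1 x
        exact (hf₁ _ x).trans (by simp [pullbackFst_apply])
    · obtain rfl : l = D.length + 1 := le_antisymm hl (by omega)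
      have hst := (step D X X₀ hX₀ n hn ρ e).stage_length
      change (step D X X₀ hX₀ n hn ρ e).stage (D.length + 1) = _ at hst
      rw [hst] at hA hD
      exact exists_isUnitizationOf_length (step D X X₀ hX₀ n hn ρ e) hA hD

end RSHZeroDecomposition

/-! ### C*-tensor products with commutative algebras -/

lemma CStarAlgebra.exists_eq_star_mul_self {A : Type*} [NonUnitalCStarAlgebra A] [PartialOrder A]
    [StarOrderedRing A] {a : A} (ha : 0 ≤ a) : ∃ b, a = star b * b := by
  refine ⟨CFC.sqrt a, ?_⟩
  rw [(IsSelfAdjoint.of_nonneg (CFC.sqrt_nonneg a)).star_eq, CFC.sqrt_mul_sqrt_self a ha]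

lemma CStarAlgebra.mul_self_le_self {A : Type*} [NonUnitalCStarAlgebra A] [PartialOrder A]
    [StarOrderedRing A] {a : A} (ha : 0 ≤ a) (h1 : ‖a‖ ≤ 1) : a * a ≤ a := by
  obtain ⟨s, hs, hss⟩ : ∃ s, star s = s ∧ s * s = a :=
    ⟨_, (IsSelfAdjoint.of_nonneg (CFC.sqrt_nonneg a)).star_eq, CFC.sqrt_mul_sqrt_self a⟩
  calc a * a = (s * s) * (s * s) := by rw [hss]
    _ = s * (s * s) * s := by simp only [mul_assoc]
    _ = star s * a * s := by rw [hss, hs]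
    _ ≤ ‖a‖ • (star s * s) :=
        CStarAlgebra.star_left_conjugate_le_norm_smul (IsSelfAdjoint.of_nonneg ha)
    _ = ‖a‖ • a := by rw [hs, hss]
    _ ≤ a := by
        rw [← sub_nonneg]
        have : a - ‖a‖ • a = (1 - ‖a‖) • a := by rw [sub_smul, one_smul]
        rw [this]
        exact smul_nonneg (sub_nonneg.2 h1) ha

namespace ZeroAtInftyContinuousMap

lemma exists_eq_star_mul_self {X : Type*} [TopologicalSpace X] {f : C₀(X, ℂ)}
    (hf : ∀ x, 0 ≤ f x) : ∃ g : C₀(X, ℂ), f = star g * g := by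
  have hc : Continuous fun x => ((Real.sqrt (f x).re : ℝ) : ℂ) := by fun_prop
  refine ⟨⟨⟨_, hc⟩, ?_⟩, ?_⟩
  · have h : Continuous fun z : ℂ => ((Real.sqrt z.re : ℝ) : ℂ) := by fun_prop
    have := (h.tendsto 0).comp f.zero_at_infty'
    simp only [Complex.zero_re, Real.sqrt_zero, Complex.ofReal_zero] at this
    exact this
  · ext1 x
    change f x = star ((Real.sqrt (f x).re : ℝ) : ℂ) * ((Real.sqrt (f x).re : ℝ) : ℂ)
    have h := hf x
    rw [Complex.star_def, Complex.conj_ofReal, ← Complex.ofReal_mul,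
      Real.mul_self_sqrt (Complex.nonneg_iff.1 h).1]
    exact Complex.ext rfl (Complex.nonneg_iff.1 h).2.symm

end ZeroAtInftyContinuousMap

namespace IsCStarTensorProduct

variable {X A T : Type*} [TopologicalSpace X] [NonUnitalCStarAlgebra A] [NonUnitalCStarAlgebra T]
  {β : C₀(X, ℂ) →ₗ[ℂ] A →ₗ[ℂ] T}

/-! ### Norm estimates from positivity. -/

section Order

variable [PartialOrder A] [StarOrderedRing A] [PartialOrder T] [StarOrderedRing T]

lemma nonneg (h : IsCStarTensorProduct β) {f : C₀(X, ℂ)} (hf : ∀ x, 0 ≤ f x) {a : A} (ha : 0 ≤ a) : 0 ≤ β f a := by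
  obtain ⟨g, rfl⟩ := exists_eq_star_mul_self hf
  obtain ⟨b, rfl⟩ := CStarAlgebra.exists_eq_star_mul_self ha
  rw [← h.mul_apply, ← h.star_apply]
  exact star_mul_self_nonneg _

/-- The positive element `z = f ⊗ a` satisfies `z² ≤ z`, because `z - z² = (f - f²) ⊗ a + f² ⊗ (a -
a²)`; hence `‖z‖² ≤ ‖z‖`. -/
lemma norm_le_one_of_nonneg (h : IsCStarTensorProduct β) {f : C₀(X, ℂ)} (hf : ∀ x, 0 ≤ f x) (hf1 : ∀ x, f x ≤ 1) {a : A}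
    (ha : 0 ≤ a) (ha1 : ‖a‖ ≤ 1) : ‖β f a‖ ≤ 1 := by
  have h0 := h.nonneg hf ha
  have hle : star (β f a) * β f a ≤ β f a := by
    rw [(IsSelfAdjoint.of_nonneg h0).star_eq, h.mul_apply, ← sub_nonneg]
    have : β f a - β (f * f) (a * a) = β (f - f * f) a + β (f * f) (a - a * a) := by
      rw [map_sub, map_sub, LinearMap.sub_apply]
      abel
    rw [this]
    refine add_nonneg (h.nonneg (fun x => ?_) ha) (h.nonneg (fun x => mul_nonneg (hf x) (hf x))
      (sub_nonneg.2 (CStarAlgebra.mul_self_le_self ha ha1)))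
    change 0 ≤ f x - f x * f x
    rw [sub_nonneg]
    exact mul_le_of_le_one_left (hf x) (hf1 x)
  have := CStarAlgebra.norm_le_norm_of_nonneg_of_le (star_mul_self_nonneg _) hle
  rw [CStarRing.norm_star_mul_self] at this
  by_contra! hlt
  nlinarith

lemma norm_le_one (h : IsCStarTensorProduct β) {f : C₀(X, ℂ)} (hf : ‖f‖ ≤ 1) {a : A} (ha : ‖a‖ ≤ 1) : ‖β f a‖ ≤ 1 := by
  have h1 : ‖β (star f * f) (star a * a)‖ ≤ 1 := by
    refine h.norm_le_one_of_nonneg (fun x => star_mul_self_nonneg (f x)) (fun x => ?_)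
      (star_mul_self_nonneg a) ?_
    · change star (f x) * f x ≤ 1
      rw [Complex.star_def, ← Complex.normSq_eq_conj_mul_self, Complex.normSq_eq_norm_sq,
        ← Complex.ofReal_one, Complex.real_le_real]
      exact pow_le_one₀ (norm_nonneg _) ((f.norm_apply_le x).trans hf)
    · rw [CStarRing.norm_star_mul_self]
      exact mul_le_one₀ ha (norm_nonneg _) ha
  rw [← h.mul_apply, ← h.star_apply, CStarRing.norm_star_mul_self] at h1
  by_contra! hlt
  nlinarith

/-- The Cauchy-Schwarz inequality. -/
lemma star_sum_mul_sum_le (h : IsCStarTensorProduct β) {ι : Type*} [Fintype ι] {ψ : ι → C₀(X, ℂ)} (hψ : ∀ i x, 0 ≤ ψ i x)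
    (b : ι → A) : star (∑ i, β (ψ i) (b i)) * ∑ i, β (ψ i) (b i) ≤
      ∑ i, β (ψ i * ∑ k, ψ k) (star (b i) * b i) := by
  have hstar : ∀ i, star (ψ i) = ψ i := fun i => by
    ext1 x
    exact (IsSelfAdjoint.of_nonneg (hψ i x)).star_eq
  have e1 : star (∑ i, β (ψ i) (b i)) * ∑ i, β (ψ i) (b i) =
      ∑ i, ∑ k, β (ψ i * ψ k) (star (b i) * b k) := by
    simp only [star_sum, Finset.sum_mul_sum, h.star_apply, h.mul_apply, hstar]
  have e2 : ∑ i, β (ψ i * ∑ k, ψ k) (star (b i) * b i) =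
      ∑ i, ∑ k, β (ψ i * ψ k) (star (b i) * b i) := by
    simp only [Finset.mul_sum, map_sum, LinearMap.sum_apply]
  have e1' : ∑ i, ∑ k, β (ψ i * ψ k) (star (b i) * b k) =
      ∑ i, ∑ k, β (ψ i * ψ k) (star (b k) * b i) := by
    rw [Finset.sum_comm]
    exact Finset.sum_congr rfl fun i _ => Finset.sum_congr rfl fun k _ => by rw [mul_comm (ψ k)]
  have e2' : ∑ i, ∑ k, β (ψ i * ψ k) (star (b i) * b i) =
      ∑ i, ∑ k, β (ψ i * ψ k) (star (b k) * b k) := by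
    rw [Finset.sum_comm]
    exact Finset.sum_congr rfl fun i _ => Finset.sum_congr rfl fun k _ => by rw [mul_comm (ψ k)]
  -- Expanded and symmetrized in `i` and `k`, this sum is twice the difference of the two sides.
  have hpos : 0 ≤ ∑ i, ∑ k, β (ψ i * ψ k) (star (b i - b k) * (b i - b k)) :=
    Finset.sum_nonneg fun i _ => Finset.sum_nonneg fun k _ =>
      h.nonneg (fun x => mul_nonneg (hψ i x) (hψ k x)) (star_mul_self_nonneg _)
  have hexp : ∑ i, ∑ k, β (ψ i * ψ k) (star (b i - b k) * (b i - b k)) =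
      (∑ i, ∑ k, β (ψ i * ψ k) (star (b i) * b i) - ∑ i, ∑ k, β (ψ i * ψ k) (star (b i) * b k)) +
      (∑ i, ∑ k, β (ψ i * ψ k) (star (b k) * b k) -
        ∑ i, ∑ k, β (ψ i * ψ k) (star (b k) * b i)) := by
    simp only [← Finset.sum_sub_distrib, ← Finset.sum_add_distrib]
    refine Finset.sum_congr rfl fun i _ => Finset.sum_congr rfl fun k _ => ?_
    rw [star_sub, sub_mul, mul_sub, mul_sub, map_sub, map_sub, map_sub]
    abel
  rw [hexp, ← e1', ← e2', ← two_smul ℝ] at hpos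
  rw [e1, e2, ← sub_nonneg]
  have := smul_nonneg (show (0 : ℝ) ≤ 2⁻¹ by norm_num) hpos
  rwa [smul_smul, inv_mul_cancel₀ two_ne_zero, one_smul] at this

/-- By Cauchy-Schwarz, the squared norm of such a sum is at most the norm of another sum of the same
kind. The supremum `s` over all of them is finite, by the crude bound `card ι`, and satisfies `s ≤
√s`, so `s ≤ 1`. -/
lemma norm_sum_le_one (h : IsCStarTensorProduct β) {ι : Type*} [Fintype ι] {ψ : ι → C₀(X, ℂ)} (hψ : ∀ i x, 0 ≤ ψ i x)
    (hψ1 : ∀ x, ∑ i, ψ i x ≤ 1) {b : ι → A} (hb : ∀ i, ‖b i‖ ≤ 1) :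
    ‖∑ i, β (ψ i) (b i)‖ ≤ 1 := by
  let S : Set ℝ := {r | ∃ (ψ : ι → C₀(X, ℂ)) (b : ι → A), (∀ i x, 0 ≤ ψ i x) ∧
    (∀ x, ∑ i, ψ i x ≤ 1) ∧ (∀ i, ‖b i‖ ≤ 1) ∧ r = ‖∑ i, β (ψ i) (b i)‖}
  have hsum : ∀ (ψ : ι → C₀(X, ℂ)) x, (∑ i, ψ i) x = ∑ i, ψ i x := fun ψ x => by
    rw [← evalAddHom_apply, map_sum]; rfl
  have hle1 : ∀ {ψ : ι → C₀(X, ℂ)}, (∀ i x, 0 ≤ ψ i x) → (∀ x, ∑ i, ψ i x ≤ 1) →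
      ∀ i x, ψ i x ≤ 1 := fun hψ hψ1 i x =>
    (Finset.single_le_sum (fun k _ => hψ k x) (Finset.mem_univ i)).trans (hψ1 x)
  have hbdd : BddAbove S := by
    refine ⟨Fintype.card ι, ?_⟩
    rintro _ ⟨ψ, b, hψ, hψ1, hb, rfl⟩
    refine (norm_sum_le _ _).trans ((Finset.sum_le_sum fun i _ => h.norm_le_one
      (norm_le_of_forall zero_le_one fun x => ?_) (hb i)).trans (by simp))
    have := hle1 hψ hψ1 i x
    rw [Complex.le_def] at this
    have h0 := Complex.nonneg_iff.1 (hψ i x)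
    rw [Complex.eq_coe_norm_of_nonneg (hψ i x)] at this
    simpa using this.1
  have hne : S.Nonempty := ⟨_, ψ, b, hψ, hψ1, hb, rfl⟩
  have hsq : ∀ r ∈ S, r ≤ √(sSup S) := by
    rintro _ ⟨ψ, b, hψ, hψ1, hb, rfl⟩
    refine Real.le_sqrt_of_sq_le ?_
    have := CStarAlgebra.norm_le_norm_of_nonneg_of_le (star_mul_self_nonneg _)
      (h.star_sum_mul_sum_le hψ b)
    rw [CStarRing.norm_star_mul_self, ← sq] at this
    refine this.trans (le_csSup hbdd ⟨_, _, fun i x => ?_, fun x => ?_, fun i => ?_, rfl⟩)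
    · change 0 ≤ ψ i x * (∑ k, ψ k) x
      rw [hsum]
      exact mul_nonneg (hψ i x) (Finset.sum_nonneg fun k _ => hψ k x)
    · change ∑ i, ψ i x * (∑ k, ψ k) x ≤ 1
      rw [← Finset.sum_mul, hsum]
      exact mul_le_one₀ (hψ1 x) (Finset.sum_nonneg fun k _ => hψ k x) (hψ1 x)
    · rw [CStarRing.norm_star_mul_self]
      exact mul_le_one₀ (hb i) (norm_nonneg _) (hb i)
  have h1 : sSup S ≤ √(sSup S) := csSup_le hne hsq
  refine (le_csSup hbdd ⟨ψ, b, hψ, hψ1, hb, rfl⟩).trans ?_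
  by_contra! hlt
  have := Real.sq_sqrt (zero_le_one.trans hlt.le)
  nlinarith [Real.sqrt_nonneg (sSup S)]

end Order

lemma norm_apply_le (h : IsCStarTensorProduct β) (f : C₀(X, ℂ)) (a : A) : ‖β f a‖ ≤ ‖f‖ * ‖a‖ := by
  let _ := CStarAlgebra.spectralOrder A
  have := CStarAlgebra.spectralOrderedRing A
  let _ := CStarAlgebra.spectralOrder T
  have := CStarAlgebra.spectralOrderedRing T
  by_cases hf : f = 0
  · simp [hf]
  by_cases ha : a = 0
  · simp [ha]
  have hf' : ‖f‖ ≠ 0 := norm_ne_zero_iff.2 hf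
  have ha' : ‖a‖ ≠ 0 := norm_ne_zero_iff.2 ha
  have h1 := h.norm_le_one (f := ((‖f‖⁻¹ : ℝ) : ℂ) • f) (a := ((‖a‖⁻¹ : ℝ) : ℂ) • a)
    (by rw [norm_smul, Complex.norm_real, norm_inv, norm_norm, inv_mul_cancel₀ hf'])
    (by rw [norm_smul, Complex.norm_real, norm_inv, norm_norm, inv_mul_cancel₀ ha'])
  rw [map_smul, map_smul, LinearMap.smul_apply, norm_smul, norm_smul, Complex.norm_real,
    Complex.norm_real, norm_inv, norm_inv, norm_norm, norm_norm] at h1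
  have hf0 : 0 < ‖f‖ := norm_pos_iff.2 hf
  have ha0 : 0 < ‖a‖ := norm_pos_iff.2 ha
  calc ‖β f a‖ = ‖f‖ * ‖a‖ * (‖a‖⁻¹ * (‖f‖⁻¹ * ‖β f a‖)) := by field_simp
    _ ≤ ‖f‖ * ‖a‖ * 1 := mul_le_mul_of_nonneg_left h1 (by positivity)
    _ = ‖f‖ * ‖a‖ := mul_one _

lemma norm_sum_le (h : IsCStarTensorProduct β) {ι : Type*} [Fintype ι] {ψ : ι → C₀(X, ℂ)} (hψ : ∀ i x, 0 ≤ ψ i x)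
    (hψ1 : ∀ x, ∑ i, ψ i x ≤ 1) {b : ι → A} {R : ℝ} (hR : 0 ≤ R) (hb : ∀ i, ‖b i‖ ≤ R) :
    ‖∑ i, β (ψ i) (b i)‖ ≤ R := by
  let _ := CStarAlgebra.spectralOrder A
  have := CStarAlgebra.spectralOrderedRing A
  let _ := CStarAlgebra.spectralOrder T
  have := CStarAlgebra.spectralOrderedRing T
  refine le_of_forall_gt_imp_ge_of_dense fun R' hR' => ?_
  have hR0 : 0 < R' := hR.trans_lt hR'
  have h1 := h.norm_sum_le_one hψ hψ1 (b := fun i => ((R'⁻¹ : ℝ) : ℂ) • b i) fun i => by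
    rw [norm_smul, Complex.norm_real, Real.norm_of_nonneg (inv_nonneg.2 hR0.le),
      inv_mul_le_one₀ hR0]
    exact (hb i).trans hR'.le
  simp only [map_smul] at h1
  rwa [← Finset.smul_sum, norm_smul, Complex.norm_real,
    Real.norm_of_nonneg (inv_nonneg.2 hR0.le), inv_mul_le_one₀ hR0] at h1

variable (X A) in
/-- The canonical bilinear map `C₀(X) × A → C₀(X, A)`. -/
def _root_.ZeroAtInftyContinuousMap.smulConst : C₀(X, ℂ) →ₗ[ℂ] A →ₗ[ℂ] C₀(X, A) :=
  LinearMap.mk₂ ℂ (fun f a =>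
    { toFun := fun x => f x • a
      continuous_toFun := (map_continuous f).smul continuous_const
      zero_at_infty' := by simpa using f.zero_at_infty'.smul_const a })
    (fun f g a => ZeroAtInftyContinuousMap.ext fun x => add_smul (f x) (g x) a)
    (fun c f a => ZeroAtInftyContinuousMap.ext fun x => smul_assoc c (f x) a)
    (fun f a b => ZeroAtInftyContinuousMap.ext fun x => smul_add (f x) a b)
    (fun c f a => ZeroAtInftyContinuousMap.ext fun x => smul_comm (f x) c a)

lemma _root_.ZeroAtInftyContinuousMap.smulConst_apply (f : C₀(X, ℂ)) (a : A) (x : X) :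
    smulConst X A f a x = f x • a := rfl

/-- The norm of a C*-tensor product is dominated by the supremum norm. -/
lemma norm_lift_le [T2Space X] [LocallyCompactSpace X] (h : IsCStarTensorProduct β)
    (t : C₀(X, ℂ) ⊗[ℂ] A) : ‖TensorProduct.lift β t‖ ≤ ‖TensorProduct.lift (smulConst X A) t‖ := by
  obtain ⟨S, rfl⟩ := TensorProduct.exists_finset t
  simp only [map_sum, TensorProduct.lift.tmul]
  rw [← Finset.sum_coe_sort, ← Finset.sum_coe_sort S]
  set M := ∑ i : S, smulConst X A i.1.1 i.1.2 with hM
  have hMx : ∀ x, M x = ∑ i : S, i.1.1 x • i.1.2 := fun x => by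
    rw [hM, ← evalAddHom_apply, map_sum]; rfl
  -- All coefficient functions are bundled into one, so that a single partition of unity
  -- approximates them simultaneously.
  let F : C₀(X, S → ℂ) :=
    { toFun := fun x i => i.1.1 x
      continuous_toFun := continuous_pi fun i => map_continuous i.1.1
      zero_at_infty' := tendsto_pi_nhds.2 fun i => i.1.1.zero_at_infty' }
  refine le_of_forall_pos_le_add fun δ hδ => ?_
  obtain ⟨ε, hε, hεδ⟩ : ∃ ε > 0, ε * ∑ i : S, ‖i.1.2‖ ≤ δ := by
    have : 0 < 1 + ∑ i : S, ‖i.1.2‖ := by positivity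
    refine ⟨δ / (1 + ∑ i : S, ‖i.1.2‖), by positivity, ?_⟩
    rw [div_mul_eq_mul_div, div_le_iff₀ this]
    nlinarith
  obtain ⟨t, ψ, hψc, hψ, hψ1, -, hF⟩ := exists_sum_bump_norm_sub_le F hε
    (fun x => .const X (F x)) (U := fun _ => Set.univ) (fun _ => isOpen_univ) (fun _ => trivial)
    (fun x => by simpa using hε)
  let θ : t → C₀(X, ℂ) := fun j => bump (ψ j) (hψc j) (.const X 1)
  have hθ : ∀ j x, θ j x = ψ j x := fun j x => by simp [θ]
  have happ : ∀ i : S, ‖i.1.1 - ∑ j : t, i.1.1 j • θ j‖ ≤ ε := fun i => by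
    refine norm_le_of_forall hε.le fun y => ?_
    have h1 := (norm_le_pi_norm _ i).trans ((ZeroAtInftyContinuousMap.norm_apply_le _ y).trans hF)
    refine le_trans (le_of_eq ?_) h1
    rw [← norm_neg, ZeroAtInftyContinuousMap.sub_apply, ZeroAtInftyContinuousMap.sub_apply,
      ← evalAddHom_apply y (∑ j, _), ← evalAddHom_apply y (∑ j, _), map_sum, map_sum, neg_sub,
      Pi.sub_apply, Finset.sum_apply]
    congr 2
    refine Finset.sum_congr rfl fun j _ => ?_
    change i.1.1 j * θ j y = (ψ j y : ℂ) * i.1.1 j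
    rw [hθ, mul_comm]
  -- The main part is `∑ θⱼ ⊗ M(j)` with `M` the function represented by the tensor; `norm_sum_le`
  -- bounds it by `‖M‖`. The rest is small.
  have hsum : ∑ i : S, β i.1.1 i.1.2 = ∑ i : S, β (i.1.1 - ∑ j : t, i.1.1 j • θ j) i.1.2 +
      ∑ j, β (θ j) (M j) := by
    have : ∑ j, β (θ j) (M j) = ∑ i : S, β (∑ j : t, i.1.1 j • θ j) i.1.2 := by
      simp only [hMx, map_sum, map_smul, LinearMap.sum_apply, LinearMap.smul_apply]
      exact Finset.sum_comm
    rw [this, ← Finset.sum_add_distrib]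
    exact Finset.sum_congr rfl fun i _ => by
      rw [map_sub, LinearMap.sub_apply, sub_add_cancel]
  rw [hsum, add_comm]
  refine (norm_add_le _ _).trans (add_le_add ?_ ?_)
  · refine h.norm_sum_le (fun j x => ?_) (fun x => ?_) (norm_nonneg _) fun j =>
      ZeroAtInftyContinuousMap.norm_apply_le M j
    · rw [hθ]
      exact Complex.zero_le_real.2 (hψ j x).1
    · simp only [hθ, ← Complex.ofReal_sum]
      exact_mod_cast hψ1 x
  · refine (_root_.norm_sum_le _ _).trans (le_trans ?_ hεδ)
    rw [Finset.mul_sum]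
    exact Finset.sum_le_sum fun i _ => (h.norm_apply_le _ _).trans
      (mul_le_mul_of_nonneg_right (happ i) (norm_nonneg _))

end IsCStarTensorProduct

lemma map_cfcₙ_max_abs_sub_one_eq_zero_iff {A B : Type*} [NonUnitalCStarAlgebra A]
    [NonUnitalCStarAlgebra B] (τ : A →⋆ₙₐ[ℂ] B) {b : A} (hb : IsSelfAdjoint b) :
    τ (cfcₙ (fun t : ℝ => max (|t| - 1) 0) b) = 0 ↔ ‖τ b‖ ≤ 1 := by
  rw [NonUnitalStarAlgHom.map_cfcₙ τ _ b (by fun_prop) (by simp) τ.continuous_of_cstar hb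
    (hb.map τ), cfcₙ_max_abs_sub_one_eq_zero_iff (hb.map τ)]

/-- The extension by continuity of a contractive *-homomorphism defined on a dense subalgebra. -/
lemma exists_starAlgHom_of_norm_le {C T V : Type*} [NonUnitalCStarAlgebra C]
    [NonUnitalCStarAlgebra T] [AddCommGroup V] [Module ℂ V] (M : V →ₗ[ℂ] C) (L : V →ₗ[ℂ] T)
    (hmul : ∀ s t, ∃ r, M r = M s * M t ∧ L r = L s * L t)
    (hstar : ∀ s, ∃ r, M r = star (M s) ∧ L r = star (L s)) (hle : ∀ v, ‖L v‖ ≤ ‖M v‖)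
    (hM : DenseRange M) : ∃ Θ : C →⋆ₙₐ[ℂ] T, ∀ v, Θ (M v) = L v := by
  -- The closure of this graph projects onto `C`, having closed and dense range there, and by the
  -- norm bound its second coordinate vanishes with the first. Hence it is the graph of a
  -- *-homomorphism.
  let R : NonUnitalStarSubalgebra ℂ (C × T) :=
    { carrier := {z | ∃ v, z = (M v, L v)}
      zero_mem' := ⟨0, by simp only [map_zero]; rfl⟩
      add_mem' := by
        rintro _ _ ⟨v, rfl⟩ ⟨w, rfl⟩
        exact ⟨v + w, by simp⟩
      mul_mem' := by
        rintro _ _ ⟨v, rfl⟩ ⟨w, rfl⟩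
        obtain ⟨r, h₁, h₂⟩ := hmul v w
        exact ⟨r, by rw [h₁, h₂]; rfl⟩
      smul_mem' := by
        rintro c _ ⟨v, rfl⟩
        exact ⟨c • v, by simp⟩
      star_mem' := by
        rintro _ ⟨v, rfl⟩
        obtain ⟨r, h₁, h₂⟩ := hstar v
        exact ⟨r, by rw [h₁, h₂]; rfl⟩ }
  have hG : IsClosed (R.topologicalClosure : Set (C × T)) := R.isClosed_topologicalClosure
  have hbound : ∀ z ∈ R.topologicalClosure, ‖z.2‖ ≤ ‖z.1‖ := fun z hz =>
    closure_minimal (s := (R : Set (C × T))) (t := {z | ‖z.2‖ ≤ ‖z.1‖})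
      (by rintro _ ⟨v, rfl⟩; exact hle v)
      (isClosed_le continuous_snd.norm continuous_fst.norm) hz
  let p := (NonUnitalStarAlgHom.fst ℂ C T).comp
    (NonUnitalStarSubalgebraClass.subtype R.topologicalClosure)
  let r := (NonUnitalStarAlgHom.snd ℂ C T).comp
    (NonUnitalStarSubalgebraClass.subtype R.topologicalClosure)
  have hmem : ∀ v, (M v, L v) ∈ R.topologicalClosure := fun v =>
    R.le_topologicalClosure ⟨v, rfl⟩
  have hp : Function.Surjective p := by
    rw [← Set.range_eq_univ, ← p.isClosed_range.closure_eq]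
    refine Dense.closure_eq (hM.mono ?_)
    rintro _ ⟨v, rfl⟩
    exact ⟨⟨_, hmem v⟩, rfl⟩
  obtain ⟨Θ, hΘ⟩ := NonUnitalStarAlgHom.exists_factor p hp r fun z hz => by
    have h0 : z.1.1 = 0 := hz
    have := hbound z z.2
    rw [h0, norm_zero] at this
    exact norm_le_zero_iff.1 this
  exact ⟨Θ, fun v => hΘ ⟨_, hmem v⟩⟩

lemma IsCStarTensorProduct.exists_starAlgHom {X A T : Type*} [TopologicalSpace X] [T2Space X]
    [LocallyCompactSpace X] [NonUnitalCStarAlgebra A] [NonUnitalCStarAlgebra T]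
    {β : C₀(X, ℂ) →ₗ[ℂ] A →ₗ[ℂ] T} (h : IsCStarTensorProduct β) :
    ∃ Θ : C₀(X, A) →⋆ₙₐ[ℂ] T, ∀ f a, Θ (smulConst X A f a) = β f a := by
  suffices ∃ Θ : C₀(X, A) →⋆ₙₐ[ℂ] T, ∀ t,
      Θ (TensorProduct.lift (smulConst X A) t) = TensorProduct.lift β t from
    this.imp fun Θ hΘ f a => by simpa using hΘ (f ⊗ₜ a)
  refine exists_starAlgHom_of_norm_le (TensorProduct.lift (smulConst X A))
    (TensorProduct.lift β) (fun s t => ?_) (fun s => ?_) (fun t => h.norm_lift_le t) ?_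
  · induction s with
    | zero => exact ⟨0, by simp⟩
    | add s₁ s₂ h₁ h₂ =>
      obtain ⟨r₁, h₁, h₁'⟩ := h₁
      obtain ⟨r₂, h₂, h₂'⟩ := h₂
      exact ⟨r₁ + r₂, by rw [map_add, map_add, add_mul, h₁, h₂],
        by rw [map_add, map_add, add_mul, h₁', h₂']⟩
    | tmul f a =>
      induction t with
      | zero => exact ⟨0, by simp⟩
      | add s₁ s₂ h₁ h₂ =>
        obtain ⟨r₁, h₁, h₁'⟩ := h₁
        obtain ⟨r₂, h₂, h₂'⟩ := h₂
        exact ⟨r₁ + r₂, by rw [map_add, map_add, mul_add, h₁, h₂],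
          by rw [map_add, map_add, mul_add, h₁', h₂']⟩
      | tmul g b =>
        refine ⟨(f * g) ⊗ₜ (a * b), ?_, ?_⟩
        · rw [TensorProduct.lift.tmul, TensorProduct.lift.tmul, TensorProduct.lift.tmul]
          ext1 x
          exact (smul_mul_smul_comm (f x) a (g x) b).symm
        · rw [TensorProduct.lift.tmul, TensorProduct.lift.tmul, TensorProduct.lift.tmul,
            h.mul_apply]
  · induction s with
    | zero => exact ⟨0, by simp⟩
    | add s₁ s₂ h₁ h₂ =>
      obtain ⟨r₁, h₁, h₁'⟩ := h₁
      obtain ⟨r₂, h₂, h₂'⟩ := h₂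
      exact ⟨r₁ + r₂, by rw [map_add, map_add, star_add, h₁, h₂],
        by rw [map_add, map_add, star_add, h₁', h₂']⟩
    | tmul f a =>
      refine ⟨star f ⊗ₜ star a, ?_, ?_⟩
      · rw [TensorProduct.lift.tmul, TensorProduct.lift.tmul]
        ext1 x
        exact (star_smul (f x) a).symm
      · rw [TensorProduct.lift.tmul, TensorProduct.lift.tmul, h.star_apply]
  · intro g
    rw [Metric.mem_closure_iff]
    intro ε hε
    obtain ⟨_, ⟨t, rfl⟩, ht⟩ := exists_mem_norm_sub_le
      (AddMonoidHom.mrange (TensorProduct.lift (smulConst X A)).toAddMonoidHom) g (half_pos hε)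
      fun x => ⟨.const X (g x), Set.univ, isOpen_univ, trivial, by simpa using hε,
        fun ψ hψ _ _ => ⟨bump ψ hψ (.const X 1) ⊗ₜ g x, by
          ext1 y
          change ((ψ y : ℂ) • (1 : ℂ)) • g x = (ψ y : ℂ) • g x
          rw [smul_eq_mul, mul_one]⟩⟩
    refine ⟨_, ⟨t, rfl⟩, ?_⟩
    rw [dist_comm, dist_eq_norm]
    exact ht.trans_lt (half_lt_self hε)

/-! ### The algebra of functions with values in an RSH₀-algebra -/

section Functions

variable {C A X : Type u} [NonUnitalCStarAlgebra C] [NonUnitalCStarAlgebra A] [TopologicalSpace X]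
  {Φ : C →⋆ₙₐ[ℂ] C₀(X, A)}

variable [T2Space X] [LocallyCompactSpace X]

lemma surjective_evalHom_comp (hΦ : Function.Surjective Φ) (x : X) :
    Function.Surjective ((evalHom x).comp Φ) := fun a => by
  obtain ⟨ψ, hψ, hx, -, -⟩ := exists_bump isOpen_univ (Set.mem_univ x)
  obtain ⟨c, hc⟩ := hΦ (bump ψ hψ (.const X a))
  exact ⟨c, by simp [hc, hx]⟩

/-- A closed ideal in an algebra of continuous functions is determined by its values. -/
lemma mem_of_forall_apply_mem (hΦ : Function.Bijective Φ) {I : TwoSidedIdeal C}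
    (hI : IsClosed (I : Set C)) {w : C} (hw : ∀ x, ∃ k ∈ I, Φ k x = Φ w x) : w ∈ I := by
  refine TwoSidedIdeal.mem_of_forall_norm_sub_le hI fun ε hε => ?_
  let J : AddSubmonoid C₀(X, A) :=
    { carrier := {k | ∃ i ∈ I, Φ i = k}
      zero_mem' := ⟨0, I.zero_mem, map_zero _⟩
      add_mem' := by
        rintro _ _ ⟨i, hi, rfl⟩ ⟨j, hj, rfl⟩
        exact ⟨i + j, I.add_mem hi hj, map_add _ _ _⟩ }
  obtain ⟨_, ⟨i, hi, rfl⟩, hk⟩ := exists_mem_norm_sub_le J (Φ w) hε fun x => by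
    obtain ⟨k, hk, hkx⟩ := hw x
    refine ⟨(Φ k).toContinuousMap, Set.univ, isOpen_univ, trivial, ?_, fun ψ hψ _ _ => ?_⟩
    · change ‖Φ k x - _‖ < ε
      rw [hkx]; simpa using hε
    · obtain ⟨v, hv⟩ := hΦ.2 (bump ψ hψ (Φ k).toContinuousMap)
      obtain ⟨y, hy⟩ := hΦ.2 (bump ψ hψ (Φ (star v)).toContinuousMap)
      -- The bump function need not come from an element of `C`. But `v* v = y k`, where `y`
      -- corresponds to the bump function times `v*`.
      refine ⟨v, TwoSidedIdeal.mem_of_star_mul_self_mem hI ?_, hv⟩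
      have : star v * v = y * k := by
        apply hΦ.1
        rw [map_mul, map_mul]
        ext1 z
        have h₁ : Φ v z = (ψ z : ℂ) • Φ k z := by rw [hv]; rfl
        have h₂ : Φ y z = (ψ z : ℂ) • Φ (star v) z := by rw [hy]; rfl
        rw [ZeroAtInftyContinuousMap.mul_apply, ZeroAtInftyContinuousMap.mul_apply, h₁, h₂,
          mul_smul_comm, smul_mul_assoc]
      rw [this]
      exact I.mul_mem_left _ _ hk
  refine ⟨i, hi, ?_⟩
  rw [← NonUnitalStarAlgHom.norm_map Φ hΦ.1, map_sub]
  exact (norm_sub_rev _ _).trans_le hk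

/-- A nonzero closed ideal in an algebra of continuous functions contains an elementary tensor. -/
lemma exists_smulConst_mem (hΦ : Function.Bijective Φ) {d : WithBot ℕ∞} (hA : RSHDim d A)
    {I : TwoSidedIdeal C} (hI : IsClosed (I : Set C)) {g : C} (hg : g ∈ I) (hg0 : g ≠ 0) :
    ∃ f ≠ 0, ∃ a ≠ 0, ∃ w ∈ I, Φ w = smulConst X A f a := by
  obtain ⟨x₀, hx₀⟩ : ∃ x, Φ g x ≠ 0 := by
    by_contra! h
    exact hg0 (hΦ.1 (by rw [map_zero]; exact ZeroAtInftyContinuousMap.ext h))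
  have hne : ‖Φ (star g * g) x₀‖ ≠ 0 := by
    rw [map_mul, map_star, ZeroAtInftyContinuousMap.mul_apply,
      ZeroAtInftyContinuousMap.star_apply, CStarRing.norm_star_mul_self]
    simpa using hx₀
  -- With this scaling `‖c‖ = 2`, so cutting off at `1` leaves `G(c) ≠ 0`, while perturbations of
  -- size less than `1` are absorbed by the cutoff.
  let r : ℝ := 2 * ‖Φ (star g * g) x₀‖⁻¹
  let h : C := (r : ℂ) • (star g * g)
  have hhI : h ∈ I := TwoSidedIdeal.smul_mem_of_isClosed hI _ (I.mul_mem_left _ _ hg)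
  set c : A := Φ h x₀ with hc
  have hcsa : IsSelfAdjoint c := by
    have : IsSelfAdjoint h := by
      simp only [h, Complex.coe_smul]
      exact IsSelfAdjoint.smul (.all _) (.star_mul_self g)
    exact this.map ((evalHom x₀).comp Φ)
  have hcn : ‖c‖ = 2 := by
    have : c = (r : ℂ) • Φ (star g * g) x₀ := by rw [hc, map_smul]; rfl
    rw [this, norm_smul, Complex.norm_real, norm_mul, norm_inv, norm_norm, mul_assoc,
      inv_mul_cancel₀ hne]
    norm_num
  let G : ℝ → ℝ := fun t => max (|t| - 1) 0
  have ha : cfcₙ G c ≠ 0 := fun h0 => by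
    have := (cfcₙ_max_abs_sub_one_eq_zero_iff hcsa).1 h0
    norm_num [hcn] at this
  obtain ⟨ψ, hψ, hψ₀, -, hψU⟩ := exists_bump (U := {x | ‖Φ h x - c‖ < 1}) (x := x₀)
    (isOpen_lt ((map_continuous (Φ h)).sub continuous_const).norm continuous_const)
    (by simp [hc])
  obtain ⟨w, hw⟩ := hΦ.2 (smulConst X A (bump ψ hψ (.const X 1)) (cfcₙ G c))
  have hwx : ∀ x, Φ w x = (ψ x : ℂ) • cfcₙ G c := fun x => by
    rw [hw, smulConst_apply]; simp
  refine ⟨_, fun h0 => ?_, _, ha, w, mem_of_forall_apply_mem hΦ hI fun x => ?_, hw⟩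
  · have := DFunLike.congr_fun h0 x₀
    simp [hψ₀] at this
  · by_cases hx : ‖Φ h x - c‖ < 1
    · have hsurj := surjective_evalHom_comp hΦ.2 x
      -- A representation `τ` killing the values of `I` at `x` satisfies `‖τ c‖ ≤ ‖c - Φ h x‖ < 1`,
      -- so it kills `G(c)`; such representations detect non-membership in a closed ideal.
      have hmem : cfcₙ G c ∈ I.image _ hsurj := by
        by_contra hnot
        obtain ⟨n, -, τ, -, hτI, hτ⟩ := hA.exists_rep_of_notMem _ (I.isClosed_image hI _ hsurj) hnot
        refine hτ ?_
        rw [map_cfcₙ_max_abs_sub_one_eq_zero_iff τ hcsa]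
        have h0 : τ (Φ h x) = 0 := hτI _ ((I.mem_image _ _ _).2 ⟨h, hhI, rfl⟩)
        have : τ c = τ (c - Φ h x) := by rw [map_sub, h0, sub_zero]
        rw [this]
        exact (NonUnitalStarAlgHom.norm_apply_le τ _).trans ((norm_sub_rev _ _).trans_le hx.le)
      obtain ⟨k, hk, hkx⟩ := (I.mem_image _ _ _).1 hmem
      refine ⟨(ψ x : ℂ) • k, TwoSidedIdeal.smul_mem_of_isClosed hI _ hk, ?_⟩
      rw [hwx, map_smul, ZeroAtInftyContinuousMap.smul_apply, ← hkx]
      rfl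
    · refine ⟨0, I.zero_mem, ?_⟩
      rw [hwx, hψU x hx, map_zero, Complex.ofReal_zero, zero_smul,
        ZeroAtInftyContinuousMap.zero_apply]

/-- A proper closed ideal has a proper image at some point `x`, and representations of `A` are
composed with evaluation at `x`. As `X` is compact, the finite set can be taken among the constant
functions. -/
lemma HasBoundedReps.functions [CompactSpace X] (hΦ : Function.Bijective Φ)
    (hA : HasBoundedReps A) : HasBoundedReps C := by
  obtain ⟨S, hS, hrep⟩ := hA
  have hconst : ∀ a : A, ∃ c, ∀ x, Φ c x = a := fun a => by
    obtain ⟨c, hc⟩ := hΦ.2 ⟨.const X a, by simp⟩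
    exact ⟨c, fun x => by rw [hc]; rfl⟩
  choose k hk using hconst
  refine ⟨k '' S, hS.image k, fun J hJ ⟨w, hw⟩ => ?_⟩
  obtain ⟨x, hx⟩ : ∃ x, Φ w x ∉ J.image _ (surjective_evalHom_comp hΦ.2 x) := by
    by_contra! hall
    exact hw (mem_of_forall_apply_mem hΦ hJ fun x => (J.mem_image _ _ _).1 (hall x))
  obtain ⟨n, hn, τ, hτ, hτJ, a, ha, h1⟩ := hrep _ (J.isClosed_image hJ _ _) ⟨_, hx⟩
  refine ⟨n, hn, τ.comp ((evalHom x).comp Φ), hτ.comp (surjective_evalHom_comp hΦ.2 x),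
    fun j hj => hτJ _ ((J.mem_image _ _ _).2 ⟨j, hj, rfl⟩), k a, ⟨a, ha, rfl⟩, ?_⟩
  change 1 ≤ ‖τ (Φ (k a) x)‖
  rwa [hk]

end Functions

/-! ### Surjectivity on functions; functions of two variables. -/

namespace ZeroAtInftyContinuousMap

variable {X Y E : Type*} [TopologicalSpace X] [TopologicalSpace Y] [NonUnitalCStarAlgebra E]

lemma mapHom_surjective [T2Space X] [LocallyCompactSpace X] {F : Type*} [NonUnitalCStarAlgebra F]
    {θ : E →⋆ₙₐ[ℂ] F} (hθ : Function.Surjective θ) :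
    Function.Surjective (mapHom (X := X) θ) := by
  intro g
  have hmem : g ∈ closure (Set.range (mapHom (X := X) θ)) := by
    rw [Metric.mem_closure_iff]
    intro ε hε
    obtain ⟨_, ⟨k, rfl⟩, hk⟩ := exists_mem_norm_sub_le
      (AddMonoidHom.mrange (mapHom (X := X) θ : C₀(X, E) →+ C₀(X, F))) g (half_pos hε) fun x => by
        obtain ⟨e, he⟩ := hθ (g x)
        refine ⟨.const X (g x), Set.univ, isOpen_univ, trivial, by simpa using hε,
          fun ψ hψ _ _ => ⟨bump ψ hψ (.const X e), ?_⟩⟩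
        ext1 y
        change θ ((ψ y : ℂ) • e) = (ψ y : ℂ) • g x
        rw [map_smul, he]
    refine ⟨_, ⟨k, rfl⟩, ?_⟩
    rw [dist_comm, dist_eq_norm]
    exact hk.trans_lt (half_lt_self hε)
  rwa [(mapHom (X := X) θ).isClosed_range.closure_eq] at hmem

/-- Functions with values in an algebra of functions, as functions of two variables. -/
def uncurryHom : C₀(X, C₀(Y, E)) →⋆ₙₐ[ℂ] C₀(X × Y, E) where
  toFun G :=
    { toFun := fun z => G z.1 z.2
      continuous_toFun := by
        refine continuous_iff_continuousAt.2 fun z => ?_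
        rw [ContinuousAt, tendsto_iff_norm_sub_tendsto_zero]
        have h₁ : Filter.Tendsto (fun w : X × Y => ‖G w.1 - G z.1‖ + ‖G z.1 w.2 - G z.1 z.2‖)
            (𝓝 z) (𝓝 (‖G z.1 - G z.1‖ + ‖G z.1 z.2 - G z.1 z.2‖)) := by
          refine Continuous.tendsto ?_ z
          exact (((map_continuous G).comp continuous_fst).sub continuous_const).norm.add
            (((map_continuous (G z.1)).comp continuous_snd).sub continuous_const).norm
        rw [sub_self, sub_self, norm_zero, norm_zero, add_zero] at h₁
        refine squeeze_zero (fun w => norm_nonneg _) (fun w => ?_) h₁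
        have : G w.1 w.2 - G z.1 z.2 = (G w.1 - G z.1) w.2 + (G z.1 w.2 - G z.1 z.2) := by
          rw [ZeroAtInftyContinuousMap.sub_apply, sub_add_sub_cancel]
        rw [this]
        exact (norm_add_le _ _).trans (add_le_add_left (norm_apply_le _ _) _)
      zero_at_infty' := by
        refine tendsto_cocompact_zero fun ε hε => ?_
        obtain ⟨t, ht⟩ := (isCompact_le_norm G hε).elim_finite_subcover
          (fun x => {y | ‖G y - G x‖ < ε / 2})
          (fun x => isOpen_lt ((map_continuous G).sub continuous_const).norm continuous_const)
          (fun x _ => Set.mem_iUnion.2 ⟨x, by simpa using hε⟩)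
        refine ⟨{x | ε ≤ ‖G x‖} ×ˢ ⋃ x ∈ t, {y | ε / 2 ≤ ‖G x y‖},
          (isCompact_le_norm G hε).prod (t.isCompact_biUnion fun x _ =>
            isCompact_le_norm (G x) (half_pos hε)), fun z hz => ?_⟩
        by_contra! hle
        have h1 : ε ≤ ‖G z.1‖ := hle.trans (norm_apply_le _ _)
        refine hz ⟨h1, ?_⟩
        obtain ⟨x, hx, hxz⟩ := Set.mem_iUnion₂.1 (ht h1)
        refine Set.mem_iUnion₂.2 ⟨x, hx, ?_⟩
        have h2 : ‖(G z.1 - G x) z.2‖ < ε / 2 := (norm_apply_le _ _).trans_lt hxz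
        rw [ZeroAtInftyContinuousMap.sub_apply] at h2
        have h3 := norm_sub_norm_le (G z.1 z.2) (G x z.2)
        change ε / 2 ≤ ‖G x z.2‖
        linarith }
  map_smul' _ _ := rfl
  map_zero' := rfl
  map_add' _ _ := rfl
  map_mul' _ _ := rfl
  map_star' _ := rfl

lemma exists_curry (F : C₀(X × Y, E)) : ∃ G : C₀(X, C₀(Y, E)), ∀ x y, G x y = F (x, y) := by
  let H : X → C₀(Y, E) := fun x =>
    { toFun := fun y => F (x, y)
      continuous_toFun := (map_continuous F).comp (by fun_prop)
      zero_at_infty' := tendsto_cocompact_zero fun ε hε =>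
        ⟨Prod.snd '' {z | ε ≤ ‖F z‖}, (isCompact_le_norm F hε).image continuous_snd, fun y hy => by
          by_contra! hle
          exact hy ⟨(x, y), hle, rfl⟩⟩ }
  refine ⟨⟨⟨H, ?_⟩, ?_⟩, fun x y => rfl⟩
  · refine continuous_iff_continuousAt.2 fun x₀ => Metric.tendsto_nhds.2 fun ε hε => ?_
    have hε4 : 0 < ε / 4 := by positivity
    have hK := (isCompact_le_norm F hε4).image continuous_snd
    -- Continuity in the supremum norm: uniform over a compact set of `y`, outside of which both
    -- values are below `ε / 4`.
    have hev := hK.eventually_forall_of_forall_eventually (x₀ := x₀)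
      (P := fun x y => ‖F (x, y) - F (x₀, y)‖ < ε / 2) fun y _ => by
        have hc : Continuous fun z : X × Y => ‖F (z.1, z.2) - F (x₀, z.2)‖ := by
          have := map_continuous F
          fun_prop
        refine (hc.tendsto (x₀, y)).eventually (gt_mem_nhds ?_)
        simpa using hε
    filter_upwards [hev] with x hx
    rw [dist_eq_norm]
    refine (norm_le_of_forall (half_pos hε).le fun y => ?_).trans_lt (half_lt_self hε)
    change ‖F (x, y) - F (x₀, y)‖ ≤ ε / 2
    by_cases hy : y ∈ Prod.snd '' {z | ε / 4 ≤ ‖F z‖}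
    · exact (hx y hy).le
    · have hlt : ∀ x', ‖F (x', y)‖ < ε / 4 := fun x' => by
        by_contra! hle
        exact hy ⟨(x', y), hle, rfl⟩
      linarith [norm_sub_le (F (x, y)) (F (x₀, y)), hlt x, hlt x₀]
  · refine tendsto_cocompact_zero fun ε hε => ⟨Prod.fst '' {z | ε / 2 ≤ ‖F z‖},
      (isCompact_le_norm F (half_pos hε)).image continuous_fst, fun x hx => ?_⟩
    refine (norm_le_of_forall (half_pos hε).le fun y => ?_).trans_lt (half_lt_self hε)
    by_contra! hlt
    exact hx ⟨(x, y), hlt.le, rfl⟩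

end ZeroAtInftyContinuousMap

/-- A step with base `Y` glued along `Y₀` becomes one with base `X × Y` glued along `X × Y₀`.
Pointwise lifts to `ker q` depend continuously on the point because `φ` is isometric on `ker q`. No
dimension bound is claimed, hence `⊤`. -/
lemma RSHDim.functions {A : Type u} [NonUnitalCStarAlgebra A] {d : WithBot ℕ∞} (hA : RSHDim d A)
    {X : Type u} [TopologicalSpace X] [T2Space X] [LocallyCompactSpace X] {C : Type u}
    [NonUnitalCStarAlgebra C] {Φ : C →⋆ₙₐ[ℂ] C₀(X, A)} (hΦ : Function.Bijective Φ) :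
    RSHDim ⊤ C := by
  induction hA generalizing C with
  | zero A h =>
    exact .zero _ ⟨fun a b => hΦ.1 (ZeroAtInftyContinuousMap.ext fun x => h.elim _ _)⟩
  | @step A P Y _ _ _ _ _ n hn Y₀ φ q hY hs hP ih =>
    refine .step hn (X := X × Y) (X₀ := Prod.snd ⁻¹' Y₀)
      (φ := uncurryHom.comp ((mapHom φ).comp Φ)) (q := (mapHom q).comp Φ)
      (hasCoveringDimLE_top _) ⟨hs.isClosed.preimage continuous_snd,
        (mapHom_surjective hs.surjective).comp hΦ.2, ?_, ?_, ?_⟩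
      (ih (Φ := NonUnitalStarAlgHom.id ℂ C₀(X, P)) ⟨fun _ _ h => h, fun f => ⟨f, rfl⟩⟩)
    · intro c hc z hz
      exact hs.map_eq_zero (Φ c z.1) (DFunLike.congr_fun hc z.1) _ hz
    · intro c hc hc'
      apply hΦ.1
      rw [map_zero]
      ext1 x
      refine hs.eq_zero _ (DFunLike.congr_fun hc x) (ZeroAtInftyContinuousMap.ext fun y => ?_)
      exact DFunLike.congr_fun hc' (x, y)
    · intro F hF
      obtain ⟨G, hG⟩ := exists_curry F
      choose s hqs hφs using fun x => hs.lift (G x) fun y hy => by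
        rw [hG]
        exact hF (x, y) hy
      have hnorm : ∀ x x', ‖s x - s x'‖ = ‖G x - G x'‖ := fun x x' => by
        rw [hs.norm_eq (by rw [map_sub, hqs, hqs, sub_zero]), map_sub, hφs, hφs]
      have hcont : Continuous s := by
        refine continuous_iff_continuousAt.2 fun x => ?_
        rw [ContinuousAt, tendsto_iff_norm_sub_tendsto_zero]
        simp_rw [hnorm]
        rw [← tendsto_iff_norm_sub_tendsto_zero]
        exact (map_continuous G).tendsto x
      obtain ⟨c, hc⟩ := hΦ.2 ⟨⟨s, hcont⟩, by
        have := G.zero_at_infty'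
        rw [tendsto_zero_iff_norm_tendsto_zero] at this ⊢
        refine this.congr fun x => ?_
        change ‖G x‖ = ‖s x‖
        rw [hs.norm_eq (hqs x), hφs]⟩
      have hcx : ∀ x, Φ c x = s x := fun x => by rw [hc]; rfl
      refine ⟨c, ?_, ?_⟩
      · ext1 x
        change q (Φ c x) = 0
        rw [hcx, hqs]
      · ext1 z
        change φ (Φ c z.1) z.2 = F z
        rw [hcx, hφs, hG]

/-- The canonical map `C₀(X, A) → T` has closed and dense range. A nonzero kernel would contain a
nonzero elementary tensor, contradicting that the algebraic tensor product embeds in `T`. -/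
lemma IsCStarTensorProduct.exists_bijective {X A T : Type u} [TopologicalSpace X] [T2Space X]
    [LocallyCompactSpace X] [NonUnitalCStarAlgebra A] [NonUnitalCStarAlgebra T]
    {β : C₀(X, ℂ) →ₗ[ℂ] A →ₗ[ℂ] T} (h : IsCStarTensorProduct β) {d : WithBot ℕ∞}
    (hA : RSHDim d A) : ∃ Φ : T →⋆ₙₐ[ℂ] C₀(X, A), Function.Bijective Φ := by
  obtain ⟨Θ, hΘ⟩ := h.exists_starAlgHom
  have hsurj : Function.Surjective Θ := by
    rw [← Set.range_eq_univ, ← Θ.isClosed_range.closure_eq]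
    refine Dense.closure_eq (h.dense.mono ?_)
    rintro _ ⟨t, rfl⟩
    induction t with
    | zero => exact ⟨0, by simp⟩
    | add s t hs ht =>
      obtain ⟨s', hs⟩ := hs
      obtain ⟨t', ht⟩ := ht
      exact ⟨s' + t', by rw [map_add, map_add, hs, ht]⟩
    | tmul f a => exact ⟨smulConst X A f a, by rw [hΘ, TensorProduct.lift.tmul]⟩
  have hinj : Function.Injective Θ := by
    rw [injective_iff_map_eq_zero]
    intro g hg
    by_contra hg0
    obtain ⟨f, hf, a, ha, w, hw, hwf⟩ := exists_smulConst_mem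
      (Φ := NonUnitalStarAlgHom.id ℂ C₀(X, A)) ⟨fun _ _ h => h, fun f => ⟨f, rfl⟩⟩ hA
      Θ.isClosed_kerIdeal ((NonUnitalStarAlgHom.mem_kerIdeal Θ g).2 hg) hg0
    have hw' : Θ (smulConst X A f a) = 0 := by
      rw [← hwf]
      exact (NonUnitalStarAlgHom.mem_kerIdeal Θ w).1 hw
    rw [hΘ] at hw'
    have h0 : f ⊗ₜ[ℂ] a = 0 := h.injective (by rw [TensorProduct.lift.tmul, hw', map_zero])
    have h1 : smulConst X A f a = 0 := by
      rw [← TensorProduct.lift.tmul, h0, map_zero]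
    refine hf (ZeroAtInftyContinuousMap.ext fun x => ?_)
    have h2 : f x • a = 0 := DFunLike.congr_fun h1 x
    exact (smul_eq_zero.1 h2).resolve_right ha
  let e := StarAlgEquiv.ofBijective Θ ⟨hinj, hsurj⟩
  exact ⟨(e.symm : T →⋆ₙₐ[ℂ] C₀(X, A)), e.symm.bijective⟩

/-! ### Close projections -/

/-- Projections at distance less than one are unitarily equivalent. -/
lemma IsStarProjection.exists_unitary_of_norm_sub_lt_one {B : Type*} [CStarAlgebra B] {p e : B}
    (hp : IsStarProjection p) (he : IsStarProjection e) (h : ‖p - e‖ < 1) :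
    ∃ w : B, star w * w = 1 ∧ w * star w = 1 ∧ w * e = p * w := by
  let _ := CStarAlgebra.spectralOrder B
  have := CStarAlgebra.spectralOrderedRing B
  have hpp : p * p = p := hp.isIdempotentElem
  have hee : e * e = e := he.isIdempotentElem
  have hps : star p = p := hp.isSelfAdjoint
  have hes : star e = e := he.isSelfAdjoint
  -- This element intertwines `e` and `p`, and `y* y = y y* = 1 - (p - e)²` is invertible; `w = y
  -- (y* y)^(-1/2)` is its polar part.
  obtain ⟨y, hy⟩ : ∃ y, y = p * e + (1 - p) * (1 - e) := ⟨_, rfl⟩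
  obtain ⟨a, ha⟩ : ∃ a, a = 1 - (p - e) * (p - e) := ⟨_, rfl⟩
  have hsy : star y = e * p + (1 - e) * (1 - p) := by
    rw [hy]; simp only [star_add, star_mul, star_sub, star_one, hps, hes]
  have h₁ : star y * y = a := by
    rw [hsy, hy, ha]
    have : (e * p + (1 - e) * (1 - p)) * (p * e + (1 - p) * (1 - e)) =
      e * (p * p) * e + e * (p - p * p) * (1 - e) + (1 - e) * (p - p * p) * e +
        (1 - e) * (1 - p - (p - p * p)) * (1 - e) := by noncomm_ring
    rw [this, hpp]
    have h2 : 1 - (p - e) * (p - e) = 1 - p * p - e * e + p * e + e * p := by noncomm_ring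
    rw [h2, hpp, hee]
    have h3 : e * p * e + e * (p - p) * (1 - e) + (1 - e) * (p - p) * e +
      (1 - e) * (1 - p - (p - p)) * (1 - e) = 1 - p - e - (e - e * e) + p * e + e * p := by
      noncomm_ring
    rw [h3, hee, sub_self, sub_zero]
  have h₂ : y * star y = a := by
    rw [hsy, hy, ha]
    have : (p * e + (1 - p) * (1 - e)) * (e * p + (1 - e) * (1 - p)) =
      p * (e * e) * p + p * (e - e * e) * (1 - p) + (1 - p) * (e - e * e) * p +
        (1 - p) * (1 - e - (e - e * e)) * (1 - p) := by noncomm_ring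
    rw [this, hee]
    have h2 : 1 - (p - e) * (p - e) = 1 - p * p - e * e + p * e + e * p := by noncomm_ring
    rw [h2, hpp, hee]
    have h3 : p * e * p + p * (e - e) * (1 - p) + (1 - p) * (e - e) * p +
      (1 - p) * (1 - e - (e - e)) * (1 - p) = 1 - e - p - (p - p * p) + p * e + e * p := by
      noncomm_ring
    rw [h3, hpp, sub_self, sub_zero, sub_right_comm]
  have hye : y * e = p * y := by
    rw [hy]
    have h1 : (p * e + (1 - p) * (1 - e)) * e = p * (e * e) + (1 - p) * (e - e * e) := by
      noncomm_ring
    have h2 : p * (p * e + (1 - p) * (1 - e)) = (p * p) * e + (p - p * p) * (1 - e) := by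
      noncomm_ring
    rw [h1, h2, hpp, hee]
    simp
  have hae : Commute a e := by
    have : star y * p = e * star y := by
      have := congrArg star hye
      rw [star_mul, star_mul, hps, hes] at this
      exact this.symm
    rw [commute_iff_eq, ← h₁, mul_assoc, hye, ← mul_assoc, this, mul_assoc]
  have hay : Commute a y := by
    rw [commute_iff_eq, ← h₂, mul_assoc, h₁, h₂]
  have ha0 : 0 ≤ a := h₁ ▸ star_mul_self_nonneg y
  have hau : IsUnit a := by
    rw [ha]
    refine isUnit_one_sub_of_norm_lt_one ?_
    calc ‖(p - e) * (p - e)‖ ≤ ‖p - e‖ * ‖p - e‖ := norm_mul_le _ _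
      _ < 1 := mul_lt_one_of_nonneg_of_lt_one_left (norm_nonneg _) h h.le
  obtain ⟨k, hk⟩ : ∃ k, k = a ^ (-(1 / 2) : ℝ) := ⟨_, rfl⟩
  have hks : star k = k := hk ▸ (IsSelfAdjoint.of_nonneg CFC.rpow_nonneg).star_eq
  have hkc : ∀ b, Commute a b → k * b = b * k := fun b hb => by
    rw [hk, CFC.rpow_def]
    exact hb.cfc_nnreal _
  have hkk : k * k * a = 1 := by
    calc k * k * a = a ^ (-(1 / 2) : ℝ) * a ^ (-(1 / 2) : ℝ) * a ^ (1 : ℝ) := by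
          rw [hk, CFC.rpow_one a ha0]
      _ = 1 := by
          rw [← CFC.rpow_add hau, ← CFC.rpow_add hau]
          norm_num [CFC.rpow_zero a ha0]
  have hka : k * a = a * k := hkc a (Commute.refl a)
  refine ⟨y * k, ?_, ?_, ?_⟩
  · rw [star_mul, hks, mul_assoc, ← mul_assoc (star y), h₁, ← hka, ← mul_assoc, hkk]
  · calc y * k * star (y * k) = y * k * (k * star y) := by rw [star_mul, hks]
      _ = k * y * (k * star y) := by rw [← hkc y hay]
      _ = k * (y * k) * star y := by simp only [mul_assoc]
      _ = k * (k * y) * star y := by rw [← hkc y hay]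
      _ = k * k * (y * star y) := by simp only [mul_assoc]
      _ = 1 := by rw [h₂, hkk]
  · rw [mul_assoc, hkc e hae, ← mul_assoc, hye, mul_assoc]

/-- Every projection matrix is of the form `V V*` with an isometry `V`. -/
lemma Matrix.exists_mul_conjTranspose_eq {n : ℕ} {p : Matrix (Fin n) (Fin n) ℂ}
    (hp : p.IsHermitian) (hpp : p * p = p) :
    ∃ (r : ℕ) (V : Matrix (Fin n) (Fin r) ℂ), V.conjTranspose * V = 1 ∧ V * V.conjTranspose = p := by
  let U : Matrix (Fin n) (Fin n) ℂ := hp.eigenvectorUnitary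
  have hU : U.conjTranspose * U = 1 := by
    have := Unitary.coe_star_mul_self hp.eigenvectorUnitary
    exact this
  let D : Matrix (Fin n) (Fin n) ℂ := Matrix.diagonal fun i => (hp.eigenvalues i : ℂ)
  have hpU : p = U * D * U.conjTranspose := hp.spectral_theorem
  have hD : D = U.conjTranspose * p * U := by
    rw [hpU]
    simp only [Matrix.mul_assoc, hU, Matrix.mul_one]
    rw [← Matrix.mul_assoc, hU, Matrix.one_mul]
  have hDD : D * D = D := by
    have hU' : U * U.conjTranspose = 1 := mul_eq_one_comm.1 hU
    calc D * D = U.conjTranspose * p * (U * U.conjTranspose) * p * U := by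
          rw [hD]; simp only [Matrix.mul_assoc]
      _ = U.conjTranspose * (p * p) * U := by rw [hU', Matrix.mul_one, Matrix.mul_assoc _ p p]
      _ = D := by rw [hpp, hD]
  have hev : ∀ i, (hp.eigenvalues i : ℂ) * hp.eigenvalues i = hp.eigenvalues i := fun i => by
    have := congrFun (congrFun hDD i) i
    simpa [D] using this
  -- The columns of `V` are the eigenvectors with nonzero eigenvalue; by `hev` such an eigenvalue is
  -- `1`.
  let e := (Fintype.equivFin {i // (hp.eigenvalues i : ℂ) ≠ 0}).symm
  refine ⟨Fintype.card {i // (hp.eigenvalues i : ℂ) ≠ 0}, U.submatrix id (fun j => (e j).1), ?_, ?_⟩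
  · rw [Matrix.conjTranspose_submatrix, ← Matrix.submatrix_mul _ _ _ id _ Function.bijective_id, hU]
    ext i j
    rw [Matrix.submatrix_apply, Matrix.one_apply, Matrix.one_apply]
    simp only [Subtype.val_injective.eq_iff, e.injective.eq_iff]
  · ext i j
    refine Eq.trans ?_ (congrFun (congrFun hpU i) j).symm
    rw [Matrix.mul_apply, Matrix.mul_apply]
    simp only [D, Matrix.mul_diagonal, Matrix.conjTranspose_apply, Matrix.submatrix_apply, id]
    rw [e.sum_comp (fun s => U i s.1 * star (U j s.1)), ← Finset.sum_subtype
      (Finset.univ.filter fun k => (hp.eigenvalues k : ℂ) ≠ 0) (by simp)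
      (fun k => U i k * star (U j k)), Finset.sum_filter]
    refine Finset.sum_congr rfl fun k _ => ?_
    by_cases hk : (hp.eigenvalues k : ℂ) = 0
    · rw [if_neg (not_not.2 hk), hk, mul_zero, zero_mul]
    · rw [if_pos hk, mul_left_cancel₀ hk ((hev k).trans (mul_one _).symm), mul_one]

/-- A nonzero corner of a matrix algebra is a matrix algebra. -/
lemma Mat.exists_corner_hom {n : ℕ} {p : Mat n} (hp : IsStarProjection p) (h0 : p ≠ 0) :
    ∃ r, 0 < r ∧ ∃ θ : Mat r →⋆ₙₐ[ℂ] Mat n, Function.Injective θ ∧ (∀ g, p * θ g * p = θ g) ∧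
      ∀ m, p * m * p = m → ∃ g, θ g = m := by
  obtain ⟨r, V, hV, hVp⟩ := Matrix.exists_mul_conjTranspose_eq
    (p := CStarMatrix.ofMatrix.symm p) hp.isSelfAdjoint hp.isIdempotentElem
  have hinv : ∀ g : Matrix (Fin r) (Fin r) ℂ,
      V.conjTranspose * (V * g * V.conjTranspose) * V = g := fun g => by
    calc V.conjTranspose * (V * g * V.conjTranspose) * V =
          (V.conjTranspose * V) * g * (V.conjTranspose * V) := by simp only [Matrix.mul_assoc]
      _ = g := by rw [hV, Matrix.one_mul, Matrix.mul_one]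
  let θ : Mat r →⋆ₙₐ[ℂ] Mat n :=
    { toFun := fun g => CStarMatrix.ofMatrix
        (V * CStarMatrix.ofMatrix.symm g * V.conjTranspose)
      map_smul' := fun c g => by
        change V * (c • CStarMatrix.ofMatrix.symm g) * V.conjTranspose =
          c • (V * CStarMatrix.ofMatrix.symm g * V.conjTranspose)
        rw [Matrix.mul_smul, Matrix.smul_mul]
      map_zero' := by
        change V * (0 : Matrix (Fin r) (Fin r) ℂ) * V.conjTranspose = 0
        rw [Matrix.mul_zero, Matrix.zero_mul]
      map_add' := fun g g' => by
        change V * (CStarMatrix.ofMatrix.symm g + CStarMatrix.ofMatrix.symm g') *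
          V.conjTranspose = V * CStarMatrix.ofMatrix.symm g * V.conjTranspose +
            V * CStarMatrix.ofMatrix.symm g' * V.conjTranspose
        rw [Matrix.mul_add, Matrix.add_mul]
      map_mul' := fun g g' => by
        change V * (CStarMatrix.ofMatrix.symm g * CStarMatrix.ofMatrix.symm g') *
          V.conjTranspose = V * CStarMatrix.ofMatrix.symm g * V.conjTranspose *
            (V * CStarMatrix.ofMatrix.symm g' * V.conjTranspose)
        rw [← Matrix.mul_one (CStarMatrix.ofMatrix.symm g), ← hV]
        simp only [Matrix.mul_assoc]
        rw [← Matrix.mul_assoc V.conjTranspose V (V.conjTranspose * _), hV, Matrix.one_mul]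
      map_star' := fun g => by
        change V * (CStarMatrix.ofMatrix.symm g).conjTranspose * V.conjTranspose =
          (V * CStarMatrix.ofMatrix.symm g * V.conjTranspose).conjTranspose
        simp only [Matrix.conjTranspose_mul, Matrix.conjTranspose_conjTranspose,
          Matrix.mul_assoc] }
  refine ⟨r, Nat.pos_of_ne_zero fun hr => ?_, θ, fun g g' hg => ?_, fun g => ?_, fun m hm => ?_⟩
  · subst hr
    refine h0 ?_
    have : CStarMatrix.ofMatrix.symm p = 0 := by
      rw [← hVp]
      ext i j
      rw [Matrix.mul_apply]
      simp
    exact this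
  · have h1 := congrArg (fun m : Matrix (Fin n) (Fin n) ℂ => V.conjTranspose * m * V) hg
    have h2 := (hinv (CStarMatrix.ofMatrix.symm g)).symm.trans
      (h1.trans (hinv (CStarMatrix.ofMatrix.symm g')))
    exact h2
  · change CStarMatrix.ofMatrix.symm p * (V * CStarMatrix.ofMatrix.symm g * V.conjTranspose) *
      CStarMatrix.ofMatrix.symm p = V * CStarMatrix.ofMatrix.symm g * V.conjTranspose
    rw [← hVp]
    calc _ = V * (V.conjTranspose * (V * CStarMatrix.ofMatrix.symm g * V.conjTranspose) * V) *
          V.conjTranspose := by simp only [Matrix.mul_assoc]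
      _ = _ := by rw [hinv]
  · refine ⟨CStarMatrix.ofMatrix (V.conjTranspose * CStarMatrix.ofMatrix.symm m * V), ?_⟩
    change V * (V.conjTranspose * CStarMatrix.ofMatrix.symm m * V) * V.conjTranspose =
      CStarMatrix.ofMatrix.symm m
    have hm' : CStarMatrix.ofMatrix.symm p * CStarMatrix.ofMatrix.symm m *
      CStarMatrix.ofMatrix.symm p = CStarMatrix.ofMatrix.symm m := hm
    rw [← hVp] at hm'
    nth_rw 2 [← hm']
    simp only [Matrix.mul_assoc]

/-! ### Local triviality of projections -/

/-- Conjugation by a unitary function. -/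
def conjHom {Y : Type*} [TopologicalSpace Y] [CompactSpace Y] {n : ℕ} (w : C(Y, Mat n))
    (hw : ∀ y, star (w y) * w y = 1) : C₀(Y, Mat n) →⋆ₙₐ[ℂ] C₀(Y, Mat n) where
  toFun f :=
    { toFun := fun y => w y * f y * star (w y)
      continuous_toFun := ((map_continuous w).mul (map_continuous f)).mul (map_continuous w).star
      zero_at_infty' := by simp }
  map_smul' c f := by
    ext1 y
    change w y * (c • f y) * star (w y) = c • (w y * f y * star (w y))
    rw [mul_smul_comm, smul_mul_assoc]
  map_zero' := by
    ext1 y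
    change w y * 0 * star (w y) = 0
    rw [mul_zero, zero_mul]
  map_add' f g := by
    ext1 y
    change w y * (f y + g y) * star (w y) = w y * f y * star (w y) + w y * g y * star (w y)
    rw [mul_add, add_mul]
  map_mul' f g := by
    ext1 y
    change w y * (f y * g y) * star (w y) = w y * f y * star (w y) * (w y * g y * star (w y))
    calc w y * (f y * g y) * star (w y) = w y * f y * 1 * g y * star (w y) := by
          simp only [mul_one, mul_assoc]
      _ = _ := by rw [← hw y]; simp only [mul_assoc]
  map_star' f := by
    ext1 y
    change w y * star (f y) * star (w y) = star (w y * f y * star (w y))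
    simp only [star_mul, star_star, mul_assoc]

/-- The corner of a projection-valued function is trivial over a set. -/
def IsTrivialOver {X : Type*} [TopologicalSpace X] {n : ℕ} (p : C₀(X, Mat n)) (Y : Set X) : Prop :=
  ∃ r, 0 < r ∧ ∃ Λ : C₀(Y, Mat r) →⋆ₙₐ[ℂ] C₀(Y, Mat n), (∀ g y, Λ g y = 0 ↔ g y = 0) ∧
    (∀ g (y : Y), p y * Λ g y * p y = Λ g y) ∧
      ∀ f : C₀(Y, Mat n), (∀ y : Y, p y * f y * p y = f y) → ∃ g, Λ g = f

/-- Over the compact set `Y`, `p` and the constant `e` are projections in `C(Y, Mₙ)` at distance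
less than one, hence conjugate by a unitary function; the corner of a nonzero constant projection is
a matrix algebra. -/
lemma isTrivialOver_of_norm_sub_le {X : Type*} [TopologicalSpace X] {n : ℕ} {p : C₀(X, Mat n)}
    (hp : ∀ x, IsStarProjection (p x)) {Y : Set X} (hY : IsCompact Y) {e : Mat n}
    (he : IsStarProjection e) (he0 : e ≠ 0) (hpe : ∀ y ∈ Y, ‖p y - e‖ ≤ 1 / 2) :
    IsTrivialOver p Y := by
  have : CompactSpace Y := isCompact_iff_compactSpace.1 hY
  let P : C(Y, Mat n) := ⟨fun y => p y, (map_continuous p).comp continuous_subtype_val⟩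
  let E : C(Y, Mat n) := .const Y e
  have hP : IsStarProjection P := ⟨ContinuousMap.ext fun y => (hp y).isIdempotentElem,
    ContinuousMap.ext fun y => (hp y).isSelfAdjoint⟩
  have hE : IsStarProjection E := ⟨ContinuousMap.ext fun y => he.isIdempotentElem,
    ContinuousMap.ext fun y => he.isSelfAdjoint⟩
  have hPE : ‖P - E‖ ≤ 1 / 2 := (ContinuousMap.norm_le _ (by norm_num)).2 fun y => hpe y y.2
  obtain ⟨w, hw₁, hw₂, hwe⟩ := IsStarProjection.exists_unitary_of_norm_sub_lt_one
    (B := C(Y, Mat n)) hP hE (hPE.trans_lt (by norm_num))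
  replace hw₁ : ∀ y, star (w y) * w y = 1 := fun y => DFunLike.congr_fun hw₁ y
  replace hw₂ : ∀ y, w y * star (w y) = 1 := fun y => DFunLike.congr_fun hw₂ y
  replace hwe : ∀ y, w y * e = p y * w y := fun y => DFunLike.congr_fun hwe y
  have hwe' : ∀ y, e * star (w y) = star (w y) * p y := fun y => by
    have := congrArg star (hwe y)
    rwa [star_mul, star_mul, he.isSelfAdjoint.star_eq, (hp y).isSelfAdjoint.star_eq] at this
  obtain ⟨r, hr, θ, hθ, hθe, hθs⟩ := Mat.exists_corner_hom he he0
  refine ⟨r, hr, (conjHom w hw₁).comp (mapHom θ), fun g y => ?_, fun g y => ?_, fun f hf => ?_⟩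
  · change w y * θ (g y) * star (w y) = 0 ↔ g y = 0
    constructor
    · intro h
      rw [← map_eq_zero_iff θ hθ]
      calc θ (g y) = (star (w y) * w y) * θ (g y) * (star (w y) * w y) := by
            rw [hw₁, one_mul, mul_one]
        _ = star (w y) * (w y * θ (g y) * star (w y)) * w y := by simp only [mul_assoc]
        _ = 0 := by rw [h, mul_zero, zero_mul]
    · intro h
      rw [h, map_zero, mul_zero, zero_mul]
  · change p y * (w y * θ (g y) * star (w y)) * p y = w y * θ (g y) * star (w y)
    calc p y * (w y * θ (g y) * star (w y)) * p y =
          (p y * w y) * θ (g y) * (star (w y) * p y) := by simp only [mul_assoc]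
      _ = w y * (e * θ (g y) * e) * star (w y) := by
          rw [← hwe, ← hwe']; simp only [mul_assoc]
      _ = _ := by rw [hθe]
  · have hmem : ∀ y : Y, e * (star (w y) * f y * w y) * e = star (w y) * f y * w y := fun y => by
      calc e * (star (w y) * f y * w y) * e = (e * star (w y)) * f y * (w y * e) := by
            simp only [mul_assoc]
        _ = star (w y) * (p y * f y * p y) * w y := by
            rw [hwe, hwe']; simp only [mul_assoc]
        _ = _ := by rw [hf]
    choose g hg using fun y => hθs _ (hmem y)
    have hcont : Continuous g := by
      refine continuous_iff_continuousAt.2 fun y => ?_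
      rw [ContinuousAt, tendsto_iff_norm_sub_tendsto_zero]
      have : ∀ z, ‖g z - g y‖ = ‖star (w z) * f z * w z - star (w y) * f y * w y‖ := fun z => by
        rw [← NonUnitalStarAlgHom.norm_map θ hθ, map_sub, hg, hg]
      simp_rw [this]
      rw [← tendsto_iff_norm_sub_tendsto_zero]
      exact Continuous.tendsto (f := fun z => star (w z) * f z * w z)
        (((map_continuous w).star.mul (map_continuous f)).mul (map_continuous w)) y
    refine ⟨⟨⟨g, hcont⟩, by simp⟩, ZeroAtInftyContinuousMap.ext fun y => ?_⟩
    change w y * θ (g y) * star (w y) = f y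
    rw [hg]
    calc w y * (star (w y) * f y * w y) * star (w y) =
          (w y * star (w y)) * f y * (w y * star (w y)) := by simp only [mul_assoc]
      _ = f y := by rw [hw₂, one_mul, mul_one]

/-- Nonzero projections have norm one, so the support of `p` is the compact set where `‖p‖ ≥ 1/2`.
The sets where `p` stays within `1/2` of `p x` are closed, and they are compact since `‖p‖ ≥ 1/2` on
them. -/
lemma exists_isTrivialOver_cover {X : Type*} [TopologicalSpace X] {n : ℕ} {p : C₀(X, Mat n)}
    (hp : ∀ x, IsStarProjection (p x)) : ∃ t : Set (Set X), t.Finite ∧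
      (∀ Y ∈ t, IsClosed Y ∧ IsCompact Y ∧ IsTrivialOver p Y) ∧
        ∀ x, p x ≠ 0 → ∃ Y ∈ t, x ∈ Y := by
  have hnorm : ∀ x, p x ≠ 0 → ‖p x‖ = 1 := fun x hx => by
    have h1 : ‖p x‖ * ‖p x‖ = ‖p x‖ := by
      rw [← CStarRing.norm_star_mul_self, (hp x).isSelfAdjoint.star_eq, (hp x).isIdempotentElem.eq]
    exact (mul_eq_left₀ (norm_ne_zero_iff.2 hx)).1 h1
  have hhalf : (0 : ℝ) < 1 / 2 := by norm_num
  have hne : ∀ x, 1 / 2 ≤ ‖p x‖ → p x ≠ 0 := fun x hx h0 => by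
    rw [h0, norm_zero] at hx
    exact absurd hx (not_le.2 hhalf)
  obtain ⟨t, ht⟩ := (isCompact_le_norm p hhalf).elim_nhds_subcover
    (fun x => {y | ‖p y - p x‖ ≤ 1 / 2}) fun x _ =>
      Filter.mem_of_superset ((isOpen_lt ((map_continuous p).sub continuous_const).norm
        continuous_const).mem_nhds (show ‖p x - p x‖ < 1 / 2 by simp)) fun y hy => by
          change ‖p y - p x‖ ≤ 1 / 2
          exact le_of_lt hy
  have hclosed : ∀ x, IsClosed {y | ‖p y - p x‖ ≤ 1 / 2} := fun x =>
    isClosed_le ((map_continuous p).sub continuous_const).norm continuous_const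
  refine ⟨(fun x => {y | ‖p y - p x‖ ≤ 1 / 2}) '' t, t.finite_toSet.image _, ?_, fun x hx => ?_⟩
  · rintro _ ⟨x, hx, rfl⟩
    have hx0 := hne x (ht.1 x hx)
    have hcomp : IsCompact {y | ‖p y - p x‖ ≤ 1 / 2} :=
      (isCompact_le_norm p hhalf).of_isClosed_subset (hclosed x) fun y hy => by
        have h1 := norm_sub_norm_le (p x) (p y)
        rw [hnorm x hx0, norm_sub_rev] at h1
        have h2 : ‖p y - p x‖ ≤ 1 / 2 := hy
        change 1 / 2 ≤ ‖p y‖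
        linarith
    exact ⟨hclosed x, hcomp, isTrivialOver_of_norm_sub_le hp hcomp (hp x) hx0 fun y hy => hy⟩
  · have hx' : (1 / 2 : ℝ) ≤ ‖p x‖ := by rw [hnorm x hx]; norm_num
    obtain ⟨y, hy, hxy⟩ := Set.mem_iUnion₂.1 (ht.2 hx')
    exact ⟨_, ⟨y, hy, rfl⟩, hxy⟩

/-! ### Corners -/

/-- `A` is an iterated unital pullback with compact base spaces of covering dimension at most
`d`. -/
inductive RSHUnital (d : WithBot ℕ∞) : (A : Type u) → [NonUnitalCStarAlgebra A] → Prop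
  | zero (A : Type u) [NonUnitalCStarAlgebra A] (h : Subsingleton A) : RSHUnital d A
  | step {A P X : Type u} [NonUnitalCStarAlgebra A] [NonUnitalCStarAlgebra P]
      [TopologicalSpace X] [T2Space X] [CompactSpace X] {n : ℕ} (hn : 0 < n) {X₀ : Set X}
      {φ : A →⋆ₙₐ[ℂ] C₀(X, Mat n)} {q : A →⋆ₙₐ[ℂ] P} (hX : HasCoveringDimLE X d)
      (hs : IsStep X₀ φ q) {e : A} (he : IsIdentityElement e) (hφ : ∀ x, φ e x = 1)
      (hP : RSHUnital d P) : RSHUnital d A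

lemma IsStep.comp_bijective {A B P X : Type*} [NonUnitalCStarAlgebra A] [NonUnitalCStarAlgebra B]
    [NonUnitalCStarAlgebra P] [TopologicalSpace X] {n : ℕ} {X₀ : Set X}
    {φ : A →⋆ₙₐ[ℂ] C₀(X, Mat n)} {q : A →⋆ₙₐ[ℂ] P} (hs : IsStep X₀ φ q) {θ : B →⋆ₙₐ[ℂ] A}
    (hθ : Function.Bijective θ) : IsStep X₀ (φ.comp θ) (q.comp θ) where
  isClosed := hs.isClosed
  surjective := hs.surjective.comp hθ.2
  map_eq_zero b := hs.map_eq_zero (θ b)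
  eq_zero b h h' := hθ.1 (by rw [map_zero]; exact hs.eq_zero (θ b) h h')
  lift f hf := by
    obtain ⟨a, ha⟩ := hs.lift f hf
    obtain ⟨b, rfl⟩ := hθ.2 a
    exact ⟨b, ha⟩

namespace RSHUnital

variable {d : WithBot ℕ∞}

lemma of_bijective {A B : Type u} [NonUnitalCStarAlgebra A] [NonUnitalCStarAlgebra B]
    (h : RSHUnital d A) {θ : B →⋆ₙₐ[ℂ] A} (hθ : Function.Bijective θ) : RSHUnital d B := by
  cases h with
  | zero _ h => exact .zero _ ⟨fun a b => hθ.1 (h.elim _ _)⟩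
  | @step _ P X _ _ _ _ _ n hn X₀ φ q hX hs e he hφ hP =>
    obtain ⟨u, hu⟩ := hθ.2 e
    refine .step hn hX (hs.comp_bijective hθ) (e := u) (fun b => ?_) (fun x => ?_) hP
    · constructor <;> apply hθ.1 <;> rw [map_mul, hu]
      · exact (he _).1
      · exact (he _).2
    · rw [← hφ x, ← hu]
      rfl

lemma exists_decomposition {A : Type u} [NonUnitalCStarAlgebra A] (h : RSHUnital d A) :
    ∃ E : RSHZeroDecomposition A, E.IsUnital ∧ E.DimLE d := by
  induction h with
  | zero A h =>
    obtain ⟨e⟩ := nonempty_starAlgEquiv_of_subsingleton A C₀(PEmpty.{u + 1}, Mat 1)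
    have hc : CompactSpace PEmpty.{u + 1} := inferInstance
    exact ⟨.base PEmpty.{u + 1} 1 one_pos e, ⟨hc, 0, fun a => ⟨h.elim _ _, h.elim _ _⟩⟩,
      HasCoveringDimLE.of_isEmpty d⟩
  | @step A P X _ _ _ _ hcX n hn X₀ φ q hX hs u hu hφ hP ih =>
    obtain ⟨E, hE, hEd⟩ := ih
    obtain ⟨ρ, e, hφe, hqe⟩ := hs.exists_pullback
    refine ⟨.step E _ _ hs.isClosed _ hn ρ e, ⟨hE, hcX, ⟨u, hu⟩, q u, hu.map hs.surjective,
      fun f => ?_⟩, hEd, hX⟩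
    have hρ : ∀ x : X₀, ρ (q u) x = 1 := fun x => by
      rw [← hqe, ← pullback_compat e u x, hφe, hφ]
    constructor <;> ext1 x <;> rw [ZeroAtInftyContinuousMap.mul_apply, hρ]
    · exact one_mul _
    · exact mul_one _

end RSHUnital

/-- A *-homomorphism whose range is contained in the range of an injective one factors. -/
lemma NonUnitalStarAlgHom.exists_lift {A B D : Type*} [NonUnitalCStarAlgebra A]
    [NonUnitalCStarAlgebra B] [NonUnitalCStarAlgebra D] (Λ : D →⋆ₙₐ[ℂ] B)
    (hΛ : Function.Injective Λ) (f : A →⋆ₙₐ[ℂ] B) (h : ∀ a, ∃ g, Λ g = f a) :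
    ∃ f' : A →⋆ₙₐ[ℂ] D, ∀ a, Λ (f' a) = f a := by
  choose g hg using h
  exact ⟨{
    toFun := g
    map_smul' := fun c a => hΛ ((hg _).trans ((map_smul f c a).trans
      ((congrArg (c • ·) (hg a).symm).trans (map_smul Λ c (g a)).symm)))
    map_zero' := hΛ (by rw [hg, map_zero, map_zero])
    map_add' := fun a b => hΛ (by rw [hg, map_add, map_add, hg, hg])
    map_mul' := fun a b => hΛ (by rw [hg, map_mul, map_mul, hg, hg])
    map_star' := fun a => hΛ (by rw [hg, map_star, map_star, hg]) }, hg⟩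

/-- An extension of an RSH-algebra by a corner of an algebra of matrix-valued functions. -/
lemma RSHUnital.of_cover {d : WithBot ℕ∞} {B X : Type u} [NonUnitalCStarAlgebra B]
    [TopologicalSpace X] [T2Space X] [LocallyCompactSpace X] {n : ℕ} (hX : HasCoveringDimLE X d)
    (φ : B →⋆ₙₐ[ℂ] C₀(X, Mat n)) {e : B} (he : IsIdentityElement e)
    {t : Set (Set X)} (ht : t.Finite)
    (htY : ∀ Y ∈ t, IsClosed Y ∧ IsCompact Y ∧ IsTrivialOver (φ e) Y)
    {P : Type u} [NonUnitalCStarAlgebra P] (hP : RSHUnital d P) {X₀ : Set X} (hX₀ : IsClosed X₀)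
    (hcov : ∀ x, φ e x ≠ 0 → x ∈ X₀ ∨ ∃ Y ∈ t, x ∈ Y) {q : B →⋆ₙₐ[ℂ] P}
    (hq : Function.Surjective q) (hφ₀ : ∀ b, q b = 0 → ∀ x ∈ X₀, φ b x = 0)
    (hzero : ∀ b, q b = 0 → φ b = 0 → b = 0)
    (hlift : ∀ f : C₀(X, Mat n), (∀ x ∈ X₀, f x = 0) → φ e * f * φ e = f →
      ∃ b, q b = 0 ∧ φ b = f) : RSHUnital d B := by
  have hee : φ e * φ e = φ e := by rw [← map_mul, (he e).1]
  have heb : ∀ b, φ e * φ b * φ e = φ b := fun b => by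
    rw [← map_mul, ← map_mul, (he b).1, (he b).2]
  -- Each set `Y` of the cover is absorbed in turn: `P` is replaced by the image `R` of `B` in
  -- `C₀(Y, Mₙ) × P`, a unital step over `P` with base `Y`, and `X₀` grows to `X₀ ∪ Y`. Once the
  -- cover is used up, `φ e` vanishes off `X₀` and `q` is bijective.
  induction t, ht using Set.Finite.induction_on generalizing P X₀ with
  | empty =>
    refine hP.of_bijective (θ := q) ⟨?_, hq⟩
    rw [injective_iff_map_eq_zero]
    refine fun b hb => hzero b hb (ZeroAtInftyContinuousMap.ext fun x => ?_)
    by_cases hx : φ e x = 0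
    · rw [← heb, ZeroAtInftyContinuousMap.mul_apply, ZeroAtInftyContinuousMap.mul_apply, hx,
        mul_zero]
      rfl
    · exact hφ₀ b hb x ((hcov x hx).resolve_right (by simp))
  | @insert Y t _ _ ih =>
    obtain ⟨hYc, hYK, r, hr, Λ, hΛ₀, hΛe, hΛs⟩ := htY Y (Set.mem_insert _ _)
    have hj := hYc.isClosedEmbedding_subtypeVal
    have : CompactSpace Y := isCompact_iff_compactSpace.1 hYK
    have hΛinj : Function.Injective Λ := by
      rw [injective_iff_map_eq_zero]
      exact fun g hg => ZeroAtInftyContinuousMap.ext fun y => (hΛ₀ g y).1 (by rw [hg]; rfl)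
    have hepw : ∀ b x, φ e x * φ b x * φ e x = φ b x := fun b x => DFunLike.congr_fun (heb b) x
    obtain ⟨R, _, π, β, γ, hπ, hβ, hγ, hπ₀⟩ :=
      NonUnitalStarAlgHom.exists_image_prod ((restr Subtype.val hj).comp φ) q
    have hβ' : ∀ b (y : Y), β (π b) y = φ b y := fun b y => by rw [hβ]; rfl
    obtain ⟨ψ, hψ⟩ := NonUnitalStarAlgHom.exists_lift (B := C₀(Y, Mat n))
      (D := C₀(Y, Mat r)) Λ hΛinj β fun c => hΛs _ fun y => by
      obtain ⟨b, rfl⟩ := hπ c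
      rw [hβ', hepw]
    have hψ₀ : ∀ b (y : Y), ψ (π b) y = 0 ↔ φ b y = 0 := fun b y => by
      rw [← hΛ₀, hψ, hβ']
    have hsq : ∀ f : C₀(X, Mat n), φ e * (φ e * f * φ e) * φ e = φ e * f * φ e := fun f => by
      ext1 x
      change φ e x * (φ e x * f x * φ e x) * φ e x = φ e x * f x * φ e x
      calc _ = (φ e x * φ e x) * f x * (φ e x * φ e x) := by simp only [mul_assoc]
        _ = _ := by rw [show φ e x * φ e x = φ e x from DFunLike.congr_fun hee x]
    have hs : IsStep (Subtype.val ⁻¹' X₀) ψ γ := by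
      refine ⟨hX₀.preimage continuous_subtype_val, fun p => ?_, fun c hc y hy => ?_,
        fun c hc hc' => ?_, fun g hg => ?_⟩
      · obtain ⟨b, rfl⟩ := hq p
        exact ⟨π b, hγ b⟩
      · obtain ⟨b, rfl⟩ := hπ c
        rw [hγ] at hc
        exact (hψ₀ b y).2 (hφ₀ b hc y hy)
      · obtain ⟨b, rfl⟩ := hπ c
        rw [hγ] at hc
        exact hπ₀ b (by rw [← hβ, ← hψ, hc', map_zero]) hc
      -- `Λ g` is extended by `0` on `X₀` and then compressed by `φ e`; the compression does not
      -- change it on `Y`.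
      · obtain ⟨F, hF, hF₀⟩ := exists_glue hYc hX₀ (Λ g) 0 fun x h₁ h₂ =>
          (hΛ₀ g ⟨x, h₁⟩).2 (hg ⟨x, h₁⟩ h₂)
        obtain ⟨b, hb, hφb⟩ := hlift (φ e * F * φ e) (fun x hx => by
          rw [ZeroAtInftyContinuousMap.mul_apply, ZeroAtInftyContinuousMap.mul_apply]
          rw [show F x = 0 from hF₀ ⟨x, hx⟩, mul_zero, zero_mul]) (hsq F)
        refine ⟨π b, by rw [hγ, hb], hΛinj ?_⟩
        rw [hψ]
        ext1 y
        rw [hβ', hφb, ZeroAtInftyContinuousMap.mul_apply, ZeroAtInftyContinuousMap.mul_apply,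
          hF y, hΛe]
    have hπe := he.map hπ
    -- `φ e` acts as a unit on the range of the injective map `Λ`.
    have hψe : ∀ y, ψ (π e) y = 1 := fun y => by
      let g : C₀(Y, Mat r) := ⟨.const Y 1, by simp⟩
      have h1 : ψ (π e) * g = g := by
        apply hΛinj
        rw [map_mul, hψ]
        ext1 z
        rw [ZeroAtInftyContinuousMap.mul_apply, hβ', ← hΛe g z]
        simp only [← mul_assoc]
        rw [show φ e (z : X) * φ e (z : X) = φ e (z : X) from DFunLike.congr_fun hee (z : X)]
      have h2 : ψ (π e) y * 1 = 1 := DFunLike.congr_fun h1 y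
      rwa [mul_one] at h2
    refine ih (fun Z hZ => htY Z (Set.mem_insert_of_mem _ hZ))
      (P := R) (.step hr (hX.of_isClosedEmbedding hj) hs hπe hψe hP) (X₀ := X₀ ∪ Y)
      (hX₀.union hYc) (fun x hx => ?_) hπ (fun b hb x hx => ?_) (fun b hb hb' => ?_)
      fun f hf hef => ?_
    · rcases hcov x hx with h | ⟨Z, rfl | hZ, hxZ⟩
      · exact Or.inl (Or.inl h)
      · exact Or.inl (Or.inr hxZ)
      · exact Or.inr ⟨Z, hZ, hxZ⟩
    · rcases hx with hx | hx
      · exact hφ₀ b (by rw [← hγ, hb, map_zero]) x hx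
      · rw [← hβ' b ⟨x, hx⟩, hb, map_zero]
        rfl
    · exact hzero b (by rw [← hγ, hb, map_zero]) hb'
    · obtain ⟨b, hb, hφb⟩ := hlift f (fun x hx => hf x (Or.inl hx)) hef
      refine ⟨b, hπ₀ b (ZeroAtInftyContinuousMap.ext fun y => ?_) hb, hφb⟩
      change φ b (y : X) = 0
      rw [hφb]
      exact hf y (Or.inr y.2)

/-- Corners of RSH₀-algebras are RSH-algebras. -/
lemma RSHDim.rshUnital_corner {d : WithBot ℕ∞} {A : Type u} [NonUnitalCStarAlgebra A]
    (h : RSHDim d A) {p : A} (hp : IsStarProjection p) {B : Type u} [NonUnitalCStarAlgebra B]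
    {ι : B →⋆ₙₐ[ℂ] A} (hι : Function.Injective ι) (hιp : ∀ a, (∃ b, ι b = a) ↔ p * a * p = a) :
    RSHUnital d B := by
  induction h generalizing B with
  | zero A h => exact .zero _ ⟨fun a b => hι (h.elim _ _)⟩
  | @step A P X _ _ _ _ _ n hn X₀ φ q hX hs hP ih =>
    have hpp : p * p = p := hp.isIdempotentElem
    have hcorner : ∀ a, p * (p * a * p) * p = p * a * p := fun a => by
      calc p * (p * a * p) * p = (p * p) * a * (p * p) := by simp only [mul_assoc]
        _ = _ := by rw [hpp]
    have hιb : ∀ b, p * ι b * p = ι b := fun b => (hιp _).1 ⟨b, rfl⟩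
    obtain ⟨e, he⟩ := (hιp p).2 (by rw [hpp, hpp])
    have heid : IsIdentityElement e := fun b => by
      constructor <;> apply hι <;> rw [map_mul, he, ← hιb]
      · simp only [← mul_assoc, hpp]
      · simp only [mul_assoc, hpp]
    -- `R` is the corner of `P` at `q p`, to which the induction hypothesis applies.
    obtain ⟨R, _, π, κ, hπ, hκ, hκπ⟩ := NonUnitalStarAlgHom.exists_image (q.comp ι)
    have hκπ' : ∀ b, κ (π b) = q (ι b) := hκπ
    have hπ₀ : ∀ b, π b = 0 → q (ι b) = 0 := fun b hb => by rw [← hκπ', hb, map_zero]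
    have hR : RSHUnital d R := ih (hp.map q) hκ fun c => by
      constructor
      · rintro ⟨s, rfl⟩
        obtain ⟨b, rfl⟩ := hπ s
        rw [hκπ', ← map_mul, ← map_mul, hιb]
      · intro hc
        obtain ⟨a, rfl⟩ := hs.surjective c
        obtain ⟨b, hb⟩ := (hιp (p * a * p)).2 (hcorner a)
        exact ⟨π b, by rw [hκπ', hb, map_mul, map_mul, hc]⟩
    have hφe : (φ.comp ι) e = φ p := by rw [← he]; rfl
    obtain ⟨t, ht, htY, hcov⟩ := exists_isTrivialOver_cover (p := φ p)
      fun x => (hp.map φ).map (evalHom (E := Mat n) x)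
    refine RSHUnital.of_cover hX (φ.comp ι) heid ht (by rwa [hφe]) hR hs.isClosed
      (fun x hx => Or.inr (hcov x (by rwa [hφe] at hx))) hπ
      (fun b hb => hs.map_eq_zero _ (hπ₀ b hb))
      (fun b hb hb' => hι (by rw [map_zero]; exact hs.eq_zero _ (hπ₀ b hb) hb')) fun f hf hef => ?_
    rw [hφe] at hef
    obtain ⟨a, ha, hφa⟩ := hs.lift f hf
    obtain ⟨b, hb⟩ := (hιp (p * a * p)).2 (hcorner a)
    refine ⟨b, hκ ?_, ?_⟩
    · rw [hκπ', hb, map_zero, map_mul, map_mul, ha, mul_zero, zero_mul]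
    · change φ (ι b) = f
      rw [hb, map_mul, map_mul, hφa, hef]

lemma RSHDim.rshUnital_cornerSubalgebra {d : WithBot ℕ∞} {A : Type u} [NonUnitalCStarAlgebra A]
    (h : RSHDim d A) {p : A} (hp : IsStarProjection p) :
    RSHUnital d (cornerSubalgebra p hp) := by
  refine h.rshUnital_corner hp
    (ι := NonUnitalStarSubalgebraClass.subtype (cornerSubalgebra p hp)) Subtype.val_injective
    fun a => ?_
  have hpp : p * p = p := hp.isIdempotentElem
  constructor
  · rintro ⟨⟨_, a, rfl⟩, rfl⟩
    change p * (p * a * p) * p = p * a * p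
    calc p * (p * a * p) * p = (p * p) * a * (p * p) := by simp only [mul_assoc]
      _ = _ := by rw [hpp]
  · exact fun ha => ⟨⟨a, a, ha.symm⟩, rfl⟩


end

/-! ### The proposition. -/

theorem mainTheorem10 {A : Type u} [NonUnitalCStarAlgebra A] (hA : IsRSHZero A) :
    -- (i) ideals and quotients
    (∀ I : TwoSidedIdeal A, IsClosed (I : Set A) →
      (∃ (J : NonUnitalStarSubalgebra ℂ A) (_ : IsClosed (J : Set A)),
        (J : Set A) = (I : Set A) ∧ IsRSHZero J) ∧
      (∃ (B : Type u) (_ : NonUnitalCStarAlgebra B) (q : A →⋆ₙₐ[ℂ] B),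
        Function.Surjective q ∧ (∀ a : A, q a = 0 ↔ a ∈ I) ∧ IsRSHZero B)) ∧
    -- (ii) compact spectrum and standard decompositions
    (HasCompactSpectrum A ↔ ∃ (D : RSHZeroDecomposition A) (l : ℕ), D.IsStandard l) ∧
    -- (iii) the unitization
    (∀ (D : RSHZeroDecomposition A) (l : ℕ), HasCompactSpectrum A → D.IsStandard l →
      ∃ E : RSHZeroDecomposition (Unitization ℂ A),
        E.IsUnital ∧ RSHZeroDecomposition.IsUnitizationOf l D E) ∧
    -- (iv) tensor products with commutative C*-algebras
    (∀ (X : Type u) [TopologicalSpace X] [T2Space X] [LocallyCompactSpace X]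
      (T : Type u) [NonUnitalCStarAlgebra T] (β : C₀(X, ℂ) →ₗ[ℂ] A →ₗ[ℂ] T),
      IsCStarTensorProduct β →
        IsRSHZero T ∧ (CompactSpace X → HasCompactSpectrum A → HasCompactSpectrum T)) ∧
    -- (v) corners
    (HasCompactSpectrum A → ∀ (p : A) (hp : IsStarProjection p),
      IsRSH (cornerSubalgebra p hp)) ∧
    -- the topological dimension does not increase
    (∀ D : RSHZeroDecomposition A,
      (∀ I : TwoSidedIdeal A, IsClosed (I : Set A) →
        (∃ (J : NonUnitalStarSubalgebra ℂ A) (_ : IsClosed (J : Set A)),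
          (J : Set A) = (I : Set A) ∧
          ∃ E : RSHZeroDecomposition J, E.topDim ≤ D.topDim) ∧
        (∃ (B : Type u) (_ : NonUnitalCStarAlgebra B) (q : A →⋆ₙₐ[ℂ] B),
          Function.Surjective q ∧ (∀ a : A, q a = 0 ↔ a ∈ I) ∧
          ∃ E : RSHZeroDecomposition B, E.topDim ≤ D.topDim)) ∧
      (HasCompactSpectrum A →
        ∃ (E : RSHZeroDecomposition A) (l : ℕ), E.IsStandard l ∧ E.topDim ≤ D.topDim) ∧
      (HasCompactSpectrum A → ∀ (p : A) (hp : IsStarProjection p),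
        ∃ E : RSHZeroDecomposition (cornerSubalgebra p hp),
          E.IsUnital ∧ E.topDim ≤ D.topDim)) := by
  have hcs : ∀ {d : WithBot ℕ∞}, RSHDim d A → HasCompactSpectrum A →
      ∃ (E : RSHZeroDecomposition A) (l : ℕ), E.IsStandard l ∧ E.DimLE d := fun h hc => by
    obtain ⟨S, hS, hrep⟩ := hc.exists_finite
    obtain ⟨E, l, hE, -, hd⟩ := h.exists_isStandard hS hrep
    exact ⟨E, l, hE, hd⟩
  have hreps : ∀ (D : RSHZeroDecomposition A) (l : ℕ), D.IsStandard l → HasBoundedReps A :=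
    fun D l hD => D.hasBoundedReps hD.compact hD.full
  have hideal : ∀ D : RSHZeroDecomposition A, ∀ I : TwoSidedIdeal A, IsClosed (I : Set A) →
      ∃ (J : NonUnitalStarSubalgebra ℂ A) (_ : IsClosed (J : Set A)),
        (J : Set A) = (I : Set A) ∧ ∃ E : RSHZeroDecomposition J, E.topDim ≤ D.topDim :=
    fun D I hI => by
      have hc : IsClosed (I.toStarSubalgebra hI : Set A) := hI
      obtain ⟨E, hE⟩ := ((RSHDim.of_decomposition D D.dimLE_topDim).ideal I hI).exists_decomposition
      exact ⟨I.toStarSubalgebra hI, hc, rfl, E, E.topDim_le hE⟩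
  have hquot : ∀ D : RSHZeroDecomposition A, ∀ I : TwoSidedIdeal A, IsClosed (I : Set A) →
      ∃ (B : Type u) (_ : NonUnitalCStarAlgebra B) (q : A →⋆ₙₐ[ℂ] B),
        Function.Surjective q ∧ (∀ a : A, q a = 0 ↔ a ∈ I) ∧
        ∃ E : RSHZeroDecomposition B, E.topDim ≤ D.topDim := fun D I hI => by
    obtain ⟨B, _, q, hq, hqI, hB⟩ :=
      (RSHDim.of_decomposition D D.dimLE_topDim).exists_quotient I hI
    obtain ⟨E, hE⟩ := hB.exists_decomposition
    exact ⟨B, _, q, hq, hqI, E, E.topDim_le hE⟩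
  have hcorner : ∀ D : RSHZeroDecomposition A, ∀ (p : A) (hp : IsStarProjection p),
      ∃ E : RSHZeroDecomposition (cornerSubalgebra p hp), E.IsUnital ∧ E.topDim ≤ D.topDim :=
    fun D p hp => by
      obtain ⟨E, hE, hd⟩ := ((RSHDim.of_decomposition D
        D.dimLE_topDim).rshUnital_cornerSubalgebra hp).exists_decomposition
      exact ⟨E, hE, E.topDim_le hd⟩
  obtain ⟨D₀⟩ := hA
  have h₀ : RSHDim D₀.topDim A := .of_decomposition D₀ D₀.dimLE_topDim
  refine ⟨fun I hI => ⟨?_, ?_⟩, ⟨fun hc => ?_, fun ⟨D, l, hD⟩ => (hreps D l hD).hasCompactSpectrum⟩,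
    fun D l _ hD => D.exists_isUnitizationOf l hD.compact hD.le_length hD.unital hD.isUnital,
    fun X _ _ _ T _ β hβ => ?_, fun _ p hp => ?_,
    fun D => ⟨fun I hI => ⟨hideal D I hI, hquot D I hI⟩, fun hc => ?_, fun _ => hcorner D⟩⟩
  · obtain ⟨J, hJ, hJI, E, -⟩ := hideal D₀ I hI
    exact ⟨J, hJ, hJI, ⟨E⟩⟩
  · obtain ⟨B, _, q, hq, hqI, E, -⟩ := hquot D₀ I hI
    exact ⟨B, _, q, hq, hqI, ⟨E⟩⟩
  · obtain ⟨E, l, hE, -⟩ := hcs h₀ hc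
    exact ⟨E, l, hE⟩
  · obtain ⟨Φ, hΦ⟩ := hβ.exists_bijective h₀
    obtain ⟨E, -⟩ := (h₀.functions hΦ).exists_decomposition
    refine ⟨⟨E⟩, fun _ hc => ?_⟩
    -- A standard decomposition of `A` converts compactness of its spectrum into `HasBoundedReps`,
    -- which passes to functions on a compact space.
    obtain ⟨E, l, hE, -⟩ := hcs h₀ hc
    exact (HasBoundedReps.functions hΦ (hreps E l hE)).hasCompactSpectrum
  · obtain ⟨E, hE, -⟩ := hcorner D₀ p hp
    exact ⟨E, hE⟩
  · obtain ⟨E, l, hE, hd⟩ := hcs (.of_decomposition D D.dimLE_topDim) hc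
    exact ⟨E, l, hE, E.topDim_le hd⟩
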